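/- Fix an alphabet $\Sigma$ with $k$ letters and a countably infinite set of string variables. A string term is a finite concatenation of variables. A conjunctive string formula $\Phi$ over $\Sigma$ is a finite conjunction of relational constraints $T(t,t')$ ($T$ a finite transducer over $\Sigma$, with $\varepsilon$-moves; $t,t'$ string terms), possibly negated memberships $t\in L(A)$ ($A$ a finite automaton over $\Sigma$), and possibly negated inequalities $s\le s'$ between linear integer terms over lengths $|t|$ of string terms. It is satisfiable if some assignment of words of $\Sigma^*$ to the variables makes all conjuncts true. The relation-concatenation skeleton of $\Phi$ is the sequence of pairs $(t_1,t_1'),\dots,(t_m,t_m')$ of terms of its relational constraints; it forgets the transducers, the memberships and the length constraints. The skeleton class of $\Phi$ is the set of all conjunctive string formulae over $\Sigma$ with the same skeleton as $\Phi$. The splitting graph of $\Phi$ has as its nodes the positions, that is, the occurrences of variables in $t_1,t_1',\dots,t_m,t_m'$. Two positions are opposing if they lie on different sides of the same constraint. There is an edge from $p$ to $p'$ if some position $p''\ne p'$ opposing $p$ is labelled by the same variable as $p'$. A chain is a sequence of edges $(p_0,p_1),(p_1,p_2),\dots,(p_n,p_0)$ with $n\ge 0$. The formula $\Phi$ (and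 its skeleton class) is chaining if its splitting graph has a chain, and chain-free otherwise. Lemma. Let $\Phi$ be any conjunctive string formula over $\Sigma$. (1) If $k\ge 2$ and $\Phi$ is chaining, then the satisfiability problem for the formulae in the (fixed) skeleton class of $\Phi$ is undecidable: no algorithm decides correctly, for every formula in the class, whether it is satisfiable. (2) If $\Phi$ is chain-free, then the satisfiability problem for the formulae in its skeleton class is decidable. Hence, for $k\ge 2$, satisfiability for a skeleton class is decidable if and only if the class is chain-free. -/

import Mathlib

namespace StringConstraints

/-! ### Automata and transducers as finite data -/

/-- A finite automaton with letters in `A`. States are natural numbers; only the finitely many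
numbers occurring in the three lists matter. -/
structure Automaton (A : Type) where
  trans : List (ℕ × A × ℕ)
  init : List ℕ
  final : List ℕ

namespace Automaton

def equivProd (A : Type) : Automaton A ≃ List (ℕ × A × ℕ) × List ℕ × List ℕ where
  toFun M := (M.trans, M.init, M.final)
  invFun p := ⟨p.1, p.2.1, p.2.2⟩
  left_inv _ := rfl
  right_inv _ := rfl

instance (A : Type) [Primcodable A] : Primcodable (Automaton A) :=
  Primcodable.ofEquiv _ (equivProd A)

/-- `M.Run q l q'`: there is a run of `M` from `q` to `q'` whose sequence of labels is `l`. -/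
inductive Run {A : Type} (M : Automaton A) : ℕ → List A → ℕ → Prop
  | nil (q : ℕ) : Run M q [] q
  | cons {q q' q'' : ℕ} {a : A} {l : List A} :
      (q, a, q') ∈ M.trans → Run M q' l q'' → Run M q (a :: l) q''

/-- `M` has an accepting run with sequence of labels `l`. -/
def Accepts {A : Type} (M : Automaton A) (l : List A) : Prop :=
  ∃ q ∈ M.init, ∃ q' ∈ M.final, M.Run q l q'

end Automaton

/-- Words over an alphabet with `k` letters. -/
abbrev Word (k : ℕ) := List (Fin k)

/-- A finite automaton over a `k`-letter alphabet, with `ε`-transitions (label `none`). -/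
abbrev FA (k : ℕ) := Automaton (Option (Fin k))

/-- The language of a finite automaton: concatenate the labels of an accepting run, where `none`
is the empty word. -/
def FA.language {k : ℕ} (M : FA k) : Set (Word k) :=
  {w | ∃ l : List (Option (Fin k)), M.Accepts l ∧ w = l.reduceOption}

/-- A transducer, that is, a 2-tape automaton: each label is a pair of letters or `ε`s. -/
abbrev Transducer (k : ℕ) := Automaton (Option (Fin k) × Option (Fin k))

/-- The relation recognised by a transducer. -/
def Transducer.relation {k : ℕ} (T : Transducer k) : Set (Word k × Word k) :=
  {w | ∃ l : List (Option (Fin k) × Option (Fin k)), T.Accepts l ∧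
    w.1 = (l.map Prod.fst).reduceOption ∧ w.2 = (l.map Prod.snd).reduceOption}

/-! ### Conjunctive string formulae -/

/-- A string term: a concatenation of variables; variables are natural numbers. -/
abbrev Term := List ℕ

/-- A linear arithmetic term `c₁ * |t₁| + ⋯ + cₘ * |tₘ| + c` over lengths of string terms. -/
abbrev LengthTerm := List (ℤ × Term) × ℤ

/-- An interpretation assigns a word to every variable. -/
abbrev Interpretation (k : ℕ) := ℕ → Word k

def termValue {k : ℕ} (η : Interpretation k) (t : Term) : Word k := t.flatMap η

def lengthValue {k : ℕ} (η : Interpretation k) (s : LengthTerm) : ℤ :=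
  (s.1.map fun ct => ct.1 * ((termValue η ct.2).length : ℤ)).sum + s.2

/-- A conjunctive string formula over a `k`-letter alphabet.
* `(t, T, t') ∈ rels` is the relational constraint `T(t, t')`;
* `(b, t, A) ∈ mems` is the membership `t ∈ L(A)`, negated if `b = false`;
* `(b, s, s') ∈ lens` is the length constraint `s ≤ s'`, negated if `b = false`. -/
structure ConjFormula (k : ℕ) where
  rels : List (Term × Transducer k × Term)
  mems : List (Bool × Term × FA k)
  lens : List (Bool × LengthTerm × LengthTerm)

namespace ConjFormula

def equivProd (k : ℕ) : ConjFormula k ≃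
    List (Term × Transducer k × Term) × List (Bool × Term × FA k) ×
      List (Bool × LengthTerm × LengthTerm) where
  toFun Φ := (Φ.rels, Φ.mems, Φ.lens)
  invFun p := ⟨p.1, p.2.1, p.2.2⟩
  left_inv _ := rfl
  right_inv _ := rfl

/-- The encoding of formulae (as finite syntactic data) on which algorithms operate. -/
instance (k : ℕ) : Primcodable (ConjFormula k) :=
  Primcodable.ofEquiv _ (equivProd k)

/-- `η` is a solution of `Φ`. -/
def Models {k : ℕ} (η : Interpretation k) (Φ : ConjFormula k) : Prop :=
  (∀ c ∈ Φ.rels, (termValue η c.1, termValue η c.2.2) ∈ c.2.1.relation) ∧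
  (∀ c ∈ Φ.mems, (c.1 = true ↔ termValue η c.2.1 ∈ c.2.2.language)) ∧
  (∀ c ∈ Φ.lens, (c.1 = true ↔ lengthValue η c.2.1 ≤ lengthValue η c.2.2))

def Satisfiable {k : ℕ} (Φ : ConjFormula k) : Prop := ∃ η : Interpretation k, Models η Φ

end ConjFormula

/-! ### Skeletons and skeleton classes -/

/-- What remains of a conjunctive formula when memberships, length constraints and the identity of
the relations are forgotten: the list of pairs `(t, t')` of related terms. -/
abbrev Skeleton := List (Term × Term)

namespace ConjFormula

def skeleton {k : ℕ} (Φ : ConjFormula k) : Skeleton := Φ.rels.map fun c => (c.1, c.2.2)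

/-- Two conjunctive formulae have the same relation-concatenation skeleton. -/
def SameSkeleton {k : ℕ} (Φ Ψ : ConjFormula k) : Prop := Φ.skeleton = Ψ.skeleton

/-- The skeleton class of `Φ`. -/
def skeletonClass {k : ℕ} (Φ : ConjFormula k) : Set (ConjFormula k) := {Ψ | Ψ.SameSkeleton Φ}

end ConjFormula

/-! ### The splitting graph and chains -/

/-- The left (`false`) or right (`true`) term of the `j`-th constraint. -/
def Skeleton.side (S : Skeleton) (j : Fin S.length) : Bool → Term
  | false => (S.get j).1
  | true => (S.get j).2

/-- A position: the `idx`-th variable occurrence on a side of the `con`-th constraint. -/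
structure Position (S : Skeleton) where
  con : Fin S.length
  right : Bool
  idx : Fin (S.side con right).length

/-- The variable labelling a position. -/
def Position.var {S : Skeleton} (p : Position S) : ℕ := (S.side p.con p.right).get p.idx

/-- `p` and `q` lie on different sides of the same constraint. -/
def Position.Opposing {S : Skeleton} (p q : Position S) : Prop :=
  p.con = q.con ∧ p.right ≠ q.right

/-- The splitting graph: `p ⟶ p'` if some position `p'' ≠ p'` opposing `p` carries the same
variable as `p'`. -/
def Skeleton.splittingGraph (S : Skeleton) : Digraph (Position S) where
  Adj p p' := ∃ p'' : Position S, p'' ≠ p' ∧ p.Opposing p'' ∧ p''.var = p'.var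

/-- A chain is a sequence of edges `(p₀, p₁), (p₁, p₂), …, (pₙ, p₀)`; the successor of the index
`i : Fin (n + 1)` is taken cyclically. -/
def Skeleton.HasChain (S : Skeleton) : Prop :=
  ∃ (n : ℕ) (p : Fin (n + 1) → Position S), ∀ i, S.splittingGraph.Adj (p i) (p (i + 1))

def ConjFormula.Chaining {k : ℕ} (Φ : ConjFormula k) : Prop := Φ.skeleton.HasChain

def ConjFormula.ChainFree {k : ℕ} (Φ : ConjFormula k) : Prop := ¬ Φ.skeleton.HasChain

/-! ### Decidability -/

/-- The satisfiability problem for the formulae in `C` is decidable: some algorithm (which always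
halts) gives the correct answer on every formula in `C`. -/
def SatDecidable {k : ℕ} (C : Set (ConjFormula k)) : Prop :=
  ∃ p : ConjFormula k → Prop, ComputablePred p ∧ ∀ Φ ∈ C, (p Φ ↔ Φ.Satisfiable)

end StringConstraints

/-!
Chain-free skeletons. The point is that satisfiable formulae have solutions of bounded size.
If the splitting graph has no chain, then every nonempty set of constraints contains one with a
side that is *fresh*: its variables are pairwise distinct and occur nowhere else in the set
(`exists_fresh`; otherwise one could walk backwards in the splitting graph for ever, and a finite
graph would contain a cycle). A constraint with a fresh side can be eliminated
(`SmallModel.of_erase`). Suppose every variable ranges over the language of a finite automaton.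
Composing the transducer with the automata of the fresh variables, in sequence, gives an automaton
for the words that the other side may denote, and a run of it cuts into runs along the variables
of that side. Each of these variables then ranges over the product of its automaton with such a
piece. The remaining constraints are handled by induction, and from a solution of them one reads
off values of the fresh variables.

Length constraints survive the elimination because the automata carry weights in `ℤ ^ m`, one
coordinate for each inequality, and only the total weight matters; the weights of the fresh
variables become weights of the composed automaton. Once no relational constraint is left, the
variables are independent except for the total weight. Each run is a short path into which short
cycles are pumped (`TPath.pump`); the short paths, the cycles and the slack of the inequalities
form a zero-sum family of short integer vectors, which splits into zero-sum subfamilies of bounded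
size (`exists_zero_sum_mem`), and the subfamily that contains the short paths is a small solution
(`exists_small_family`). Possibly negated memberships of terms are put into the automata of single
variables: the behaviour of the word on the state sets of all automata in the formula is a finite
type, and a given solution fixes the type of every variable (`typeNet`). All bounds are primitive
recursive in the size of the formula, and so is checking a given interpretation
(`models_primrec`), whence `exists_small_model` and `satDecidable_of_chainFree`.

Chaining skeletons. The source of undecidability is a fixed rational relation `G` for which it is
undecidable whether `G x x` for some extension `x` of a given word
(`exists_rational_undecidable`): `x` is a halting computation of a stack machine written as a
sequence of configurations, and `G` compares `x` with `x` shifted by one configuration. To apply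
this, a machine that evaluates partial recursive codes is run one stack operation at a time.

Along a chain with `n + 1` edges every variable is made, by a membership constraint, to consist of
`n + 1` words, the tracks. The transducers link certain tracks of opposing positions: on track `i`
the endpoints of links are the positions `q i` and `p (i + 1)`, where `p i` and `q i` oppose each
other while `q i` and `p (i + 1)` carry the same variable. Both sides of each constraint have
equally many endpoints (`ChainLinks.countP_mark`), so they can be linked in order of appearance,
but it is not under control which endpoint is linked to which. A parity argument makes this
irrelevant. A link requires its two ends to be equal, unless one of them is the special endpoint,
`q 0` on track `0`, when they must be related by `G`. Let `w` be the word at the special endpoint.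
The endpoints on one track belong to one variable, so an even number of endpoints equal `w`; and
if `w` were not related to itself by `G`, each link without special end would have an even number
of ends equal to `w`, whereas the special one would have exactly one
(`even_linkCount`, `ChainLinks.self_related`). Hence `G w w`. Conversely, if `G x x`, then all
tracks may equal `x` (`linked_replicate`). As rational relations are recognised by transducers
(`Rational.exists_transducer`), the constraints are conjuncts with the given skeleton
(`ChainLinks.exists_constraints`); only one membership, which prescribes a prefix, depends on the
instance (`not_satDecidable_of_chaining`).
-/


namespace StringConstraints

/-! ### Labelled paths and finite-state networks -/

/-- `Path step q l q'`: following edges of the labelled graph `step`, one gets from `q` to `q'`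
along edges labelled, in order, by the entries of `l`. -/
def Path {Q L : Type} (step : Q → L → Q → Prop) : Q → List L → Q → Prop
  | q, [], q' => q = q'
  | q, a :: l, q' => ∃ r, step q a r ∧ Path step r l q'

section Path

variable {Q L : Type} {step : Q → L → Q → Prop}

@[simp] theorem path_nil {q q' : Q} : Path step q [] q' ↔ q = q' := Iff.rfl

theorem path_cons {q q' : Q} {a : L} {l : List L} :
    Path step q (a :: l) q' ↔ ∃ r, step q a r ∧ Path step r l q' := Iff.rfl

theorem path_append {q q' : Q} {l₁ l₂ : List L} :
    Path step q (l₁ ++ l₂) q' ↔ ∃ r, Path step q l₁ r ∧ Path step r l₂ q' := by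
  induction l₁ generalizing q with
  | nil => simp
  | cons a l ih =>
    simp only [List.cons_append, path_cons, ih]
    constructor
    · rintro ⟨r, h, s, h', h''⟩; exact ⟨s, ⟨r, h, h'⟩, h''⟩
    · rintro ⟨s, ⟨r, h, h'⟩, h''⟩; exact ⟨r, h, s, h', h''⟩

theorem Path.append {q r q' : Q} {l₁ l₂ : List L} (h₁ : Path step q l₁ r)
    (h₂ : Path step r l₂ q') : Path step q (l₁ ++ l₂) q' :=
  path_append.2 ⟨r, h₁, h₂⟩

/-- A graph homomorphism, relabelling edges, maps paths to paths. -/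
theorem Path.map {Q' L' : Type} {step' : Q' → L' → Q' → Prop} (f : Q → Q') (g : L → L')
    (hfg : ∀ q a q', step q a q' → step' (f q) (g a) (f q')) {q q' : Q} {l : List L}
    (h : Path step q l q') : Path step' (f q) (l.map g) (f q') := by
  induction l generalizing q with
  | nil => exact congrArg f h
  | cons a l ih => obtain ⟨r, h1, h2⟩ := h; exact ⟨f r, hfg _ _ _ h1, ih h2⟩

end Path

theorem Automaton.run_iff_path {A : Type} (M : Automaton A) {q q' : ℕ} {l : List A} :
    M.Run q l q' ↔ Path (fun q a q' => (q, a, q') ∈ M.trans) q l q' := by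
  constructor
  · intro h
    induction h with
    | nil q => rfl
    | cons h1 _ ih => exact ⟨_, h1, ih⟩
  · intro h
    induction l generalizing q with
    | nil => obtain rfl := h; exact .nil _
    | cons a l ih => obtain ⟨r, h1, h2⟩ := h; exact .cons h1 (ih h2)

/-- A finite graph with labels in `L`, one initial and one final state. In contrast to
`Automaton`, the states form an arbitrary finite type. -/
structure Net (L : Type) where
  Q : Type
  finite : Finite Q
  step : Q → L → Q → Prop
  init : Q
  final : Q

namespace Net

variable {L : Type}

instance (N : Net L) : Finite N.Q := N.finite

/-- `N` accepts the list `l` of labels. -/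
def Acc (N : Net L) (l : List L) : Prop := Path N.step N.init l N.final

/-- The same graph with other initial and final states. -/
def segment (N : Net L) (q q' : N.Q) : Net L := { N with init := q, final := q' }

/-- The network without edges and with a single state; it accepts only the empty list. -/
def unit : Net L where
  Q := Unit
  finite := inferInstance
  step _ _ _ := False
  init := ()
  final := ()

theorem unit_acc {l : List L} : (unit : Net L).Acc l ↔ l = [] := by
  cases l with
  | nil => exact ⟨fun _ => rfl, fun _ => rfl⟩
  | cons a l => exact ⟨fun ⟨_, h, _⟩ => h.elim, fun h => by simp at h⟩

/-- The steps of a concatenation: those of the two parts and a connecting edge labelled `e`. -/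
inductive SeqStep (e : L) (M N : Net L) : M.Q ⊕ N.Q → L → M.Q ⊕ N.Q → Prop
  | left {q a q'} : M.step q a q' → SeqStep e M N (.inl q) a (.inl q')
  | link : SeqStep e M N (.inl M.final) e (.inr N.init)
  | right {q a q'} : N.step q a q' → SeqStep e M N (.inr q) a (.inr q')

/-- The concatenation of two networks, with a connecting edge labelled `e`. -/
def seq (e : L) (M N : Net L) : Net L where
  Q := M.Q ⊕ N.Q
  finite := inferInstance
  step := SeqStep e M N
  init := .inl M.init
  final := .inr N.final

theorem seq_path_right {e : L} {M N : Net L} {q : N.Q} {q' : M.Q ⊕ N.Q} {l : List L} :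
    Path (SeqStep e M N) (.inr q) l q' ↔ ∃ r, q' = .inr r ∧ Path N.step q l r := by
  induction l generalizing q with
  | nil => simp [eq_comm]
  | cons a l ih =>
    constructor
    · rintro ⟨r, h1, h2⟩
      cases h1 with
      | right h => obtain ⟨r, rfl, h'⟩ := ih.1 h2; exact ⟨r, rfl, _, h, h'⟩
    · rintro ⟨r, rfl, s, h1, h2⟩
      exact ⟨_, .right h1, ih.2 ⟨r, rfl, h2⟩⟩

theorem seq_path_left {e : L} {M N : Net L} {q : M.Q} {q' : N.Q} {l : List L} :
    Path (SeqStep e M N) (.inl q) l (.inr q') ↔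
      ∃ l₁ l₂, l = l₁ ++ e :: l₂ ∧ Path M.step q l₁ M.final ∧ Path N.step N.init l₂ q' := by
  constructor
  · intro h
    induction l generalizing q with
    | nil => simp at h
    | cons a l ih =>
      obtain ⟨r, h1, h2⟩ := h
      cases h1 with
      | left h =>
        obtain ⟨l₁, l₂, rfl, h3, h4⟩ := ih h2
        exact ⟨a :: l₁, l₂, rfl, ⟨_, h, h3⟩, h4⟩
      | link =>
        obtain ⟨r, h3, h4⟩ := seq_path_right.1 h2
        cases h3
        exact ⟨[], l, rfl, rfl, h4⟩
  · rintro ⟨l₁, l₂, rfl, h1, h2⟩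
    have h3 : Path (SeqStep e M N) (.inl q) l₁ (.inl M.final) := by
      simpa using Path.map (g := id) (Sum.inl : M.Q → M.Q ⊕ N.Q)
        (fun _ _ _ h => SeqStep.left h) h1
    exact h3.append ⟨_, .link, seq_path_right.2 ⟨_, rfl, h2⟩⟩

theorem seq_acc {e : L} {M N : Net L} {l : List L} :
    (seq e M N).Acc l ↔ ∃ l₁ l₂, l = l₁ ++ e :: l₂ ∧ M.Acc l₁ ∧ N.Acc l₂ :=
  seq_path_left

theorem card_seq (e : L) (M N : Net L) : Nat.card (seq e M N).Q = Nat.card M.Q + Nat.card N.Q :=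
  Nat.card_sum

end Net

/-! ### Weighted networks -/

section Weighted

variable {k : ℕ} {V : Type}

/-- The word spelled by a list of weighted `ε`-labels. -/
def wordOf (l : List (Option (Fin k) × V)) : Word k := (l.map Prod.fst).reduceOption

@[simp] theorem wordOf_nil : wordOf ([] : List (Option (Fin k) × V)) = [] := rfl

@[simp] theorem wordOf_cons_none (v : V) (l : List (Option (Fin k) × V)) :
    wordOf ((none, v) :: l) = wordOf l := rfl

@[simp] theorem wordOf_cons_some (a : Fin k) (v : V) (l : List (Option (Fin k) × V)) :
    wordOf ((some a, v) :: l) = a :: wordOf l := rfl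

theorem wordOf_cons (a : Option (Fin k)) (v : V) (l : List (Option (Fin k) × V)) :
    wordOf ((a, v) :: l) = a.toList ++ wordOf l := by
  cases a <;> rfl

@[simp] theorem wordOf_append (l l' : List (Option (Fin k) × V)) :
    wordOf (l ++ l') = wordOf l ++ wordOf l' := by
  simp [wordOf, List.reduceOption_append]

variable [AddCommMonoid V]

/-- The total weight of a list of labels. -/
def weightOf (l : List (Option (Fin k) × V)) : V := (l.map Prod.snd).sum

@[simp] theorem weightOf_nil : weightOf ([] : List (Option (Fin k) × V)) = 0 := rfl

@[simp] theorem weightOf_cons (a : Option (Fin k)) (v : V) (l : List (Option (Fin k) × V)) :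
    weightOf ((a, v) :: l) = v + weightOf l := by simp [weightOf]

@[simp] theorem weightOf_append (l l' : List (Option (Fin k) × V)) :
    weightOf (l ++ l') = weightOf l + weightOf l' := by
  simp [weightOf]

/-- A weighted automaton: a network whose edges read at most one letter and carry a weight. -/
abbrev WNet (k : ℕ) (V : Type) := Net (Option (Fin k) × V)

/-- `N.Gen w v n`: some accepting path of `N` has `n` edges, spells `w` and weighs `v`. -/
def Net.Gen (N : WNet k V) (w : Word k) (v : V) (n : ℕ) : Prop :=
  ∃ l, N.Acc l ∧ wordOf l = w ∧ weightOf l = v ∧ l.length = n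

/-- A weighted transducer: edges carry an input letter or `ε`, an output letter or `ε`, and a
weight. -/
abbrev WTrans (k : ℕ) (V : Type) := Net (Option (Fin k) × Option (Fin k) × V)

/-- `T.Rel u w v`: some accepting path of `T` has input `u`, output `w` and weight `v`. -/
def Net.Rel (T : WTrans k V) (u w : Word k) (v : V) : Prop :=
  ∃ l, T.Acc l ∧ (l.map Prod.fst).reduceOption = u ∧ wordOf (l.map Prod.snd) = w ∧
    weightOf (l.map Prod.snd) = v

namespace Net

/-- The steps of the composition of a weighted transducer with a weighted automaton. -/
inductive CompStep (T : WTrans k V) (N : WNet k V) :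
    T.Q × N.Q → Option (Fin k) × V → T.Q × N.Q → Prop
  | both {p a b v p' q v' q'} : T.step p (a, some b, v) p' → N.step q (some b, v') q' →
      CompStep T N (p, q) (a, v + v') (p', q')
  | left {p a v p' q} : T.step p (a, none, v) p' → CompStep T N (p, q) (a, v) (p', q)
  | right {p q v q'} : N.step q (none, v) q' → CompStep T N (p, q) (none, v) (p, q')

/-- The composition of a weighted transducer `T` with a weighted automaton `N`: it reads the words
that `T` relates to a word read by `N`; weights add up. -/
def comp (T : WTrans k V) (N : WNet k V) : WNet k V where
  Q := T.Q × N.Q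
  finite := inferInstance
  step := CompStep T N
  init := (T.init, N.init)
  final := (T.final, N.final)

theorem comp_path {T : WTrans k V} {N : WNet k V} {p p' : T.Q} {q q' : N.Q}
    {l : List (Option (Fin k) × Option (Fin k) × V)} {l' : List (Option (Fin k) × V)}
    (h : Path T.step p l p') (h' : Path N.step q l' q')
    (hw : wordOf (l.map Prod.snd) = wordOf l') :
    ∃ m, Path (CompStep T N) (p, q) m (p', q') ∧ wordOf m = (l.map Prod.fst).reduceOption ∧
      weightOf m = weightOf (l.map Prod.snd) + weightOf l' := by
  induction l' generalizing p q l with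
  | nil =>
    obtain rfl := h'
    induction l generalizing p with
    | nil => obtain rfl := h; exact ⟨[], rfl, rfl, by simp⟩
    | cons a l ih =>
      obtain ⟨r, h1, h2⟩ := h
      obtain ⟨a, _ | b, v⟩ := a
      · obtain ⟨m, hm1, hm2, hm3⟩ := ih h2 (by simpa using hw)
        refine ⟨(a, v) :: m, ⟨_, .left h1, hm1⟩, ?_, ?_⟩
        · rw [wordOf_cons, hm2]; cases a <;> simp
        · simp [hm3]
      · simp at hw
  | cons a' l' ih' =>
    obtain ⟨r', h1', h2'⟩ := h'
    obtain ⟨_ | b', v'⟩ := a'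
    · obtain ⟨m, hm1, hm2, hm3⟩ := ih' h h2' (by simpa using hw)
      refine ⟨(none, v') :: m, ⟨_, .right h1', hm1⟩, by simpa using hm2, ?_⟩
      simp [hm3, add_left_comm]
    · induction l generalizing p with
      | nil => simp at hw
      | cons a l ih =>
        obtain ⟨r, h1, h2⟩ := h
        obtain ⟨a, _ | b, v⟩ := a
        · obtain ⟨m, hm1, hm2, hm3⟩ := ih h2 (by simpa using hw)
          refine ⟨(a, v) :: m, ⟨_, .left h1, hm1⟩, ?_, ?_⟩
          · rw [wordOf_cons, hm2]; cases a <;> simp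
          · simp [hm3, add_assoc]
        · simp only [List.map_cons, wordOf_cons_some, List.cons.injEq] at hw
          obtain ⟨rfl, hw⟩ := hw
          obtain ⟨m, hm1, hm2, hm3⟩ := ih' h2 h2' hw
          refine ⟨(a, v + v') :: m, ⟨_, .both h1 h1', hm1⟩, ?_, ?_⟩
          · rw [wordOf_cons, hm2]; cases a <;> simp
          · simp only [weightOf_cons, hm3, List.map_cons]; abel

theorem comp_path_inv {T : WTrans k V} {N : WNet k V} {x x' : T.Q × N.Q}
    {m : List (Option (Fin k) × V)} (h : Path (CompStep T N) x m x') :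
    ∃ l l', Path T.step x.1 l x'.1 ∧ Path N.step x.2 l' x'.2 ∧
      wordOf (l.map Prod.snd) = wordOf l' ∧ wordOf m = (l.map Prod.fst).reduceOption ∧
      weightOf m = weightOf (l.map Prod.snd) + weightOf l' ∧ l.length ≤ m.length ∧
      l'.length ≤ m.length := by
  induction m generalizing x with
  | nil => obtain rfl := h; exact ⟨[], [], rfl, rfl, rfl, rfl, by simp, le_rfl, le_rfl⟩
  | cons c m ih =>
    obtain ⟨y, h1, h2⟩ := h
    obtain ⟨l, l', i1, i2, i3, i4, i5, i6, i7⟩ := ih h2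
    cases h1 with
    | @both p a b v p' q v' q' s1 s2 =>
      refine ⟨(a, some b, v) :: l, (some b, v') :: l', ⟨_, s1, i1⟩, ⟨_, s2, i2⟩, by simp [i3],
        ?_, ?_, by simpa using i6, by simpa using i7⟩
      · rw [wordOf_cons, i4]; cases a <;> simp
      · simp only [weightOf_cons, i5, List.map_cons]; abel
    | @left p a v p' q s1 =>
      refine ⟨(a, none, v) :: l, l', ⟨_, s1, i1⟩, i2, by simp [i3], ?_, ?_, by simpa using i6,
        by simp; omega⟩
      · rw [wordOf_cons, i4]; cases a <;> simp
      · simp only [weightOf_cons, i5, List.map_cons]; abel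
    | @right p q v q' s1 =>
      refine ⟨l, (none, v) :: l', i1, ⟨_, s1, i2⟩, by simp [i3], by simp [i4], ?_, by simp; omega,
        by simpa using i7⟩
      simp only [weightOf_cons, i5]; abel

/-- A weighted automaton as the weighted transducer that relates every word it reads to itself. -/
def diag (N : WNet k V) : WTrans k V where
  Q := N.Q
  finite := inferInstance
  step q a q' := a.1 = a.2.1 ∧ N.step q a.2 q'
  init := N.init
  final := N.final

theorem diag_path {V : Type} {N : WNet k V} {q q' : N.Q}
    {l : List (Option (Fin k) × Option (Fin k) × V)} :
    Path N.diag.step q l q' ↔ l.map Prod.fst = (l.map Prod.snd).map Prod.fst ∧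
      Path N.step q (l.map Prod.snd) q' := by
  induction l generalizing q with
  | nil => exact ⟨fun h => ⟨rfl, h⟩, fun h => h.2⟩
  | cons a l ih =>
    simp only [path_cons, List.map_cons, List.cons.injEq]
    constructor
    · rintro ⟨r, ⟨h1, h2⟩, h3⟩; exact ⟨⟨h1, (ih.1 h3).1⟩, r, h2, (ih.1 h3).2⟩
    · rintro ⟨⟨h1, h2⟩, r, h3, h4⟩; exact ⟨r, ⟨h1, h3⟩, ih.2 ⟨h2, h4⟩⟩

/-- The product of weighted automata: reads the words read by both; weights add up. -/
def prod (M N : WNet k V) : WNet k V := comp M.diag N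

theorem comp_gen {T : WTrans k V} {N : WNet k V} {u w : Word k} {v v' : V} {n : ℕ}
    (h : T.Rel u w v) (h' : N.Gen w v' n) : ∃ n', (comp T N).Gen u (v + v') n' := by
  obtain ⟨l, h1, rfl, rfl, rfl⟩ := h
  obtain ⟨l', h1', h2', rfl, rfl⟩ := h'
  obtain ⟨m, hm, hm1, hm2⟩ := comp_path h1 h1' h2'.symm
  exact ⟨_, m, hm, hm1, hm2, rfl⟩

theorem comp_gen_inv {T : WTrans k V} {N : WNet k V} {u : Word k} {v : V} {n : ℕ}
    (h : (comp T N).Gen u v n) :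
    ∃ w v₁ v₂ n', v = v₁ + v₂ ∧ n' ≤ n ∧ T.Rel u w v₁ ∧ N.Gen w v₂ n' := by
  obtain ⟨m, hm, rfl, rfl, rfl⟩ := h
  obtain ⟨l, l', h1, h2, h3, h4, h5, h6, h7⟩ := comp_path_inv hm
  exact ⟨_, _, _, _, h5, h7, ⟨l, h1, h4.symm, h3, rfl⟩, l', h2, rfl, rfl, rfl⟩

theorem prod_gen {M N : WNet k V} {w : Word k} {v v' : V} {n n' : ℕ}
    (h : M.Gen w v n) (h' : N.Gen w v' n') : ∃ n'', (prod M N).Gen w (v + v') n'' := by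
  obtain ⟨l, h1, rfl, rfl, rfl⟩ := h
  refine comp_gen (w := wordOf l) ⟨l.map fun a => (a.1, a), ?_, ?_, ?_, ?_⟩ h'
  · refine diag_path.2 ⟨by simp, ?_⟩
    rw [List.map_map]
    exact (List.map_id l).symm ▸ h1
  · simp [wordOf, Function.comp_def]
  · simp [Function.comp_def]
  · simp [Function.comp_def]

theorem prod_gen_inv {M N : WNet k V} {w : Word k} {v : V} {n : ℕ} (h : (prod M N).Gen w v n) :
    ∃ v₁ v₂ n₁ n₂, v = v₁ + v₂ ∧ n₁ ≤ n ∧ n₂ ≤ n ∧ M.Gen w v₁ n₁ ∧ N.Gen w v₂ n₂ := by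
  obtain ⟨m, hm, rfl, rfl, rfl⟩ := h
  obtain ⟨l, l', h1, h2, h3, h4, h5, h6, h7⟩ := comp_path_inv hm
  obtain ⟨h8, h9⟩ := diag_path.1 h1
  have h10 : wordOf m = wordOf (l.map Prod.snd) := by rw [h4, h8]; rfl
  exact ⟨_, _, _, _, h5, by simpa using h6, h7, ⟨_, h9, h10.symm, rfl, rfl⟩,
    ⟨l', h2, by rw [h10, h3], rfl, rfl⟩⟩

theorem seq_gen {M N : WNet k V} {w w' : Word k} {v v' : V} {n n' : ℕ}
    (h : M.Gen w v n) (h' : N.Gen w' v' n') :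
    ∃ n'', (seq (none, 0) M N).Gen (w ++ w') (v + v') n'' := by
  obtain ⟨l, h1, rfl, rfl, rfl⟩ := h
  obtain ⟨l', h1', rfl, rfl, rfl⟩ := h'
  exact ⟨_, l ++ (none, 0) :: l', seq_acc.2 ⟨_, _, rfl, h1, h1'⟩, by simp, by simp, rfl⟩

theorem seq_gen_inv {M N : WNet k V} {w : Word k} {v : V} {n : ℕ}
    (h : (seq (none, 0) M N).Gen w v n) :
    ∃ w₁ w₂ v₁ v₂ n₁ n₂, w = w₁ ++ w₂ ∧ v = v₁ + v₂ ∧ n₁ ≤ n ∧ n₂ ≤ n ∧ M.Gen w₁ v₁ n₁ ∧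
      N.Gen w₂ v₂ n₂ := by
  obtain ⟨l, h1, rfl, rfl, rfl⟩ := h
  obtain ⟨l₁, l₂, rfl, h2, h3⟩ := seq_acc.1 h1
  exact ⟨_, _, _, _, _, _, by simp, by simp, by simp, by simp; omega,
    ⟨l₁, h2, rfl, rfl, rfl⟩, ⟨l₂, h3, rfl, rfl, rfl⟩⟩

theorem unit_gen : (unit : WNet k V).Gen [] 0 0 := ⟨[], unit_acc.2 rfl, rfl, rfl, rfl⟩

theorem unit_gen_inv {w : Word k} {v : V} {n : ℕ} (h : (unit : WNet k V).Gen w v n) :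
    w = [] ∧ v = 0 := by
  obtain ⟨l, h1, rfl, rfl, rfl⟩ := h
  obtain rfl := unit_acc.1 h1
  simp

/-- A path reading `w ++ w'` passes through a state that separates `w` from `w'`. -/
theorem segment_gen_append {N : WNet k V} {q q' : N.Q} {w w' : Word k} {v : V} {n : ℕ}
    (h : (N.segment q q').Gen (w ++ w') v n) :
    ∃ r v₁ v₂ n₁ n₂, v = v₁ + v₂ ∧ (N.segment q r).Gen w v₁ n₁ ∧
      (N.segment r q').Gen w' v₂ n₂ := by
  obtain ⟨l, h1, h2, rfl, rfl⟩ := h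
  replace h1 : Path N.step q l q' := h1
  have key : ∃ l₁ l₂, l = l₁ ++ l₂ ∧ wordOf l₁ = w ∧ wordOf l₂ = w' := by
    clear h1
    induction l generalizing w with
    | nil =>
      obtain ⟨rfl, rfl⟩ := List.append_eq_nil_iff.1 h2.symm
      exact ⟨[], [], rfl, rfl, rfl⟩
    | cons a l ih =>
      cases w with
      | nil => exact ⟨[], _, rfl, rfl, h2⟩
      | cons b w =>
        obtain ⟨_ | a, v⟩ := a
        · obtain ⟨l₁, l₂, rfl, h3, h4⟩ := ih (w := b :: w) (by simpa using h2)
          exact ⟨(none, v) :: l₁, l₂, rfl, by simpa using h3, h4⟩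
        · simp only [wordOf_cons_some, List.cons_append, List.cons.injEq] at h2
          obtain ⟨l₁, l₂, rfl, h3, h4⟩ := ih h2.2
          exact ⟨(some a, v) :: l₁, l₂, rfl, by simp [h3, h2.1], h4⟩
  obtain ⟨l₁, l₂, rfl, rfl, rfl⟩ := key
  obtain ⟨r, h3, h4⟩ := path_append.1 h1
  exact ⟨r, _, _, _, _, weightOf_append _ _, ⟨l₁, h3, rfl, rfl, rfl⟩, ⟨l₂, h4, rfl, rfl, rfl⟩⟩

theorem segment_gen_trans {N : WNet k V} {q r q' : N.Q} {w w' : Word k} {v v' : V} {n n' : ℕ}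
    (h : (N.segment q r).Gen w v n) (h' : (N.segment r q').Gen w' v' n') :
    (N.segment q q').Gen (w ++ w') (v + v') (n + n') := by
  obtain ⟨l, h1, rfl, rfl, rfl⟩ := h
  obtain ⟨l', h1', rfl, rfl, rfl⟩ := h'
  exact ⟨l ++ l', Path.append h1 h1', by simp, by simp, by simp⟩

end Net

end Weighted

/-! ### Removing cycles from paths -/

section Cycles

variable {Q L : Type} {step : Q → L → Q → Prop}

/-- Paths whose labels also record the state that is entered. -/
abbrev TPath (step : Q → L → Q → Prop) : Q → List (L × Q) → Q → Prop :=
  Path fun q x q' => x.2 = q' ∧ step q x.1 q'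

theorem TPath.path {q q' : Q} {t : List (L × Q)} (h : TPath step q t q') :
    Path step q (t.map Prod.fst) q' := by
  simpa using Path.map (id : Q → Q) Prod.fst (fun _ _ _ h => h.2) h

theorem Path.exists_tPath {q q' : Q} {l : List L} (h : Path step q l q') :
    ∃ t, TPath step q t q' ∧ t.map Prod.fst = l := by
  induction l generalizing q with
  | nil => exact ⟨[], h, rfl⟩
  | cons a l ih =>
    obtain ⟨r, h1, h2⟩ := h
    obtain ⟨t, h3, rfl⟩ := ih h2
    exact ⟨(a, r) :: t, ⟨r, ⟨rfl, h1⟩, h3⟩, rfl⟩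

theorem TPath.split {q q' r : Q} {a : L} {s t : List (L × Q)}
    (h : TPath step q (s ++ (a, r) :: t) q') :
    TPath step q (s ++ [(a, r)]) r ∧ TPath step r t q' := by
  obtain ⟨p, h1, p', ⟨rfl, h2⟩, h3⟩ := path_append.1 h
  exact ⟨h1.append ⟨_, ⟨rfl, h2⟩, rfl⟩, h3⟩

/-- Either a path visits no state twice, or it contains a cycle. -/
theorem TPath.nodup_or_cycle {q q' : Q} {t : List (L × Q)} (h : TPath step q t q') :
    (q :: t.map Prod.snd).Nodup ∨ ∃ α γ β p, t = α ++ γ ++ β ∧ γ ≠ [] ∧ TPath step q α p ∧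
      TPath step p γ p ∧ TPath step p β q' := by
  induction t generalizing q with
  | nil => exact .inl (List.nodup_singleton q)
  | cons x t ih =>
    obtain ⟨a, r⟩ := x
    have hh := h
    obtain ⟨_, ⟨rfl, h1⟩, h2⟩ := h
    rcases ih h2 with h3 | ⟨α, γ, β, p, rfl, h3, h4, h5, h6⟩
    · by_cases hq : q ∈ ((a, r) :: t).map Prod.snd
      · right
        obtain ⟨⟨b, _⟩, hx, rfl⟩ := List.mem_map.1 hq
        obtain ⟨s, s', hs⟩ := List.append_of_mem hx
        rw [hs] at hh ⊢
        obtain ⟨h4, h5⟩ := TPath.split hh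
        exact ⟨[], _, s', _, by simp, by simp, rfl, h4, h5⟩
      · exact .inl (List.nodup_cons.2 ⟨hq, h3⟩)
    · exact .inr ⟨(a, r) :: α, γ, β, p, rfl, h3, ⟨r, ⟨rfl, h1⟩, h4⟩, h5, h6⟩

theorem TPath.exists_cycle [Finite Q] {q q' : Q} {t : List (L × Q)} (h : TPath step q t q')
    (ht : Nat.card Q ≤ t.length) : ∃ α γ β p, t = α ++ γ ++ β ∧ γ ≠ [] ∧ TPath step q α p ∧
      TPath step p γ p ∧ TPath step p β q' := by
  refine h.nodup_or_cycle.resolve_left fun hn => ?_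
  have := Fintype.ofFinite Q
  have h1 := hn.length_le_card
  rw [← Nat.card_eq_fintype_card, List.length_cons, List.length_map] at h1
  omega

/-- A long path contains a short cycle all of whose states have been visited before, or belong
to a given set `U`. -/
theorem TPath.exists_removable_cycle_aux [Finite Q] (c : ℕ) :
    ∀ {U : Set Q} {q q' : Q} {t : List (L × Q)}, TPath step q t q' → Uᶜ.ncard ≤ c →
    Nat.card Q * (c + 1) ≤ t.length → ∃ α γ β p, t = α ++ γ ++ β ∧ γ ≠ [] ∧
      γ.length ≤ Nat.card Q ∧ TPath step q α p ∧ TPath step p γ p ∧ TPath step p β q' ∧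
      ∀ x ∈ γ, x.2 ∈ U ∨ ∃ y ∈ α, y.2 = x.2 := by
  induction c with
  | zero =>
    intro U q q' t h hU ht
    have hU' : ∀ s, s ∈ U := by
      intro s
      by_contra hs
      have : Uᶜ = ∅ := (Set.ncard_eq_zero (Set.toFinite _)).1 (Nat.le_zero.1 hU)
      exact (this ▸ (hs : s ∈ Uᶜ) : s ∈ (∅ : Set Q))
    rw [← List.take_append_drop (Nat.card Q) t] at h
    obtain ⟨r, h1, h2⟩ := path_append.1 h
    have hl : (t.take (Nat.card Q)).length = Nat.card Q := by simp; omega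
    obtain ⟨α, γ, β, p, h3, h4, h5, h6, h7⟩ := TPath.exists_cycle h1 hl.ge
    refine ⟨α, γ, β ++ t.drop (Nat.card Q), p, ?_, h4, ?_, h5, h6, h7.append h2,
      fun x _ => .inl (hU' _)⟩
    · rw [← List.append_assoc, ← h3, List.take_append_drop]
    · rw [h3] at hl; simp at hl; omega
  | succ c ih =>
    intro U q q' t h hU ht
    have hc : Nat.card Q ≤ t.length := le_trans (Nat.le_mul_of_pos_right _ (by omega)) ht
    have hd : t = t.take (Nat.card Q) ++ t.drop (Nat.card Q) := (List.take_append_drop _ _).symm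
    have hl : (t.take (Nat.card Q)).length = Nat.card Q := by simp; omega
    have hld : (t.drop (Nat.card Q)).length = t.length - Nat.card Q := by simp
    generalize t.take (Nat.card Q) = t₁ at hd hl
    generalize t.drop (Nat.card Q) = t₂ at hd hld
    subst hd
    by_cases hU1 : ∀ x ∈ t₁, x.2 ∈ U
    · obtain ⟨r, h1, h2⟩ := path_append.1 h
      obtain ⟨α, γ, β, p, rfl, h4, h5, h6, h7⟩ := TPath.exists_cycle h1 hl.ge
      refine ⟨α, γ, β ++ t₂, p, by simp, h4, ?_, h5, h6, h7.append h2,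
        fun x hx => .inl (hU1 x (by simp [hx]))⟩
      simp at hl; omega
    · push Not at hU1
      obtain ⟨⟨a, s⟩, hx, hs⟩ := hU1
      obtain ⟨t₃, t₄, rfl⟩ := List.append_of_mem hx
      rw [List.append_assoc, List.cons_append] at h
      obtain ⟨h1, h2⟩ := TPath.split h
      have hcard : (insert s U)ᶜ.ncard ≤ c := by
        have : (insert s U)ᶜ = Uᶜ \ {s} := by
          ext y; simp [not_or, and_comm]
        rw [this, Set.ncard_sdiff_singleton_of_mem (by simpa using hs)]
        omega
      obtain ⟨α, γ, β, p, h3, h4, h5, h6, h7, h8, h9⟩ := ih h2 hcard (by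
        simp only [List.length_append, List.length_cons] at ht hl hld ⊢
        have : Nat.card Q * (c + 1 + 1) = Nat.card Q * (c + 1) + Nat.card Q := by ring
        omega)
      refine ⟨t₃ ++ [(a, s)] ++ α, γ, β, p, by simp [h3], h4, h5, h1.append h6, h7, h8, ?_⟩
      intro x hx
      rcases h9 x hx with h | ⟨y, hy, hyx⟩
      · rcases h with h | h
        · exact .inr ⟨(a, s), by simp, h.symm⟩
        · exact .inl h
      · exact .inr ⟨y, by simp [hy], hyx⟩

/-- A path of length at least the square of the number of states contains a short cycle whose
removal does not change the set of visited states. -/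
theorem TPath.exists_removable_cycle [Finite Q] {q q' : Q} {t : List (L × Q)}
    (h : TPath step q t q') (ht : Nat.card Q * Nat.card Q ≤ t.length) :
    ∃ α γ β p, t = α ++ γ ++ β ∧ γ ≠ [] ∧ γ.length ≤ Nat.card Q ∧ TPath step q α p ∧
      TPath step p γ p ∧ TPath step p β q' ∧ ∀ x ∈ γ, x.2 = q ∨ ∃ y ∈ α, y.2 = x.2 := by
  have : Nonempty Q := ⟨q⟩
  have hpos : 0 < Nat.card Q := Nat.card_pos
  refine TPath.exists_removable_cycle_aux (Nat.card Q - 1) (U := {q}) h ?_ ?_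
  · rw [Set.ncard_compl, Set.ncard_singleton]
  · rwa [Nat.sub_add_cancel hpos]

/-- **Pumping decomposition.** The weight of a path is that of a short skeleton plus the weights of
short cycles, and any subset of these cycles can be realised by a path between the same states. -/
theorem TPath.pump [Finite Q] {M : Type} [AddCommMonoid M] (wt : L → M) {q q' : Q} (n : ℕ) :
    ∀ {t : List (L × Q)}, t.length = n → TPath step q t q' →
    ∃ (t₀ : List (L × Q)) (I : Finset ℕ) (c : ℕ → List (L × Q)),
      TPath step q t₀ q' ∧ t₀.length ≤ Nat.card Q * Nat.card Q ∧
      (∀ i ∈ I, (c i).length ≤ Nat.card Q ∧ ∃ p, TPath step p (c i) p) ∧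
      (t.map fun x => wt x.1).sum =
        (t₀.map fun x => wt x.1).sum + ∑ i ∈ I, ((c i).map fun x => wt x.1).sum ∧
      ∀ I' ⊆ I, ∃ t', TPath step q t' q' ∧ (∀ x ∈ t, x.2 = q ∨ ∃ y ∈ t', y.2 = x.2) ∧
        (t'.map fun x => wt x.1).sum =
          (t₀.map fun x => wt x.1).sum + ∑ i ∈ I', ((c i).map fun x => wt x.1).sum ∧
        t'.length ≤ Nat.card Q * Nat.card Q + Nat.card Q * I'.card := by
  classical
  induction n using Nat.strong_induction_on with
  | _ n ih =>
  intro t hn h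
  by_cases hlt : t.length ≤ Nat.card Q * Nat.card Q
  · refine ⟨t, ∅, fun _ => [], h, hlt, by simp, by simp, fun I' hI' => ?_⟩
    obtain rfl : I' = ∅ := Finset.subset_empty.1 hI'
    exact ⟨t, h, fun x hx => .inr ⟨x, hx, rfl⟩, by simp, by simpa using hlt⟩
  obtain ⟨α, γ, β, p, rfl, hγ, hγ', hα, hγp, hβ, hvis⟩ := h.exists_removable_cycle (le_of_not_ge hlt)
  have hγpos : 0 < γ.length := List.length_pos_iff.2 hγ
  obtain ⟨t₀, I, c, h1, h2, h3, h4, h5⟩ := ih (α ++ β).length (by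
    rw [← hn]; simp; omega) rfl (hα.append hβ)
  obtain ⟨i₀, hi₀⟩ := Infinite.exists_notMem_finset I
  have hc : ∀ i ∈ I, Function.update c i₀ γ i = c i := fun i hi =>
    Function.update_of_ne (by rintro rfl; exact hi₀ hi) _ _
  have hsum : ∀ I' ⊆ I, ∑ i ∈ I', ((Function.update c i₀ γ i).map fun x => wt x.1).sum =
      ∑ i ∈ I', ((c i).map fun x => wt x.1).sum := fun I' hI' =>
    Finset.sum_congr rfl fun i hi => by rw [hc i (hI' hi)]
  have hvis' : ∀ t' : List (L × Q), (∀ x ∈ α ++ β, x.2 = q ∨ ∃ y ∈ t', y.2 = x.2) →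
      ∀ x ∈ α ++ γ ++ β, x.2 = q ∨ ∃ y ∈ t', y.2 = x.2 := by
    intro t' ht' x hx
    simp only [List.mem_append] at hx ht'
    rcases hx with (hx | hx) | hx
    · exact ht' x (.inl hx)
    · rcases hvis x hx with h | ⟨y, hy, hyx⟩
      · exact .inl h
      · rw [← hyx]; exact ht' y (.inl hy)
    · exact ht' x (.inr hx)
  refine ⟨t₀, insert i₀ I, Function.update c i₀ γ, h1, h2, ?_, ?_, ?_⟩
  · intro i hi
    rcases Finset.mem_insert.1 hi with rfl | hi
    · simp only [Function.update_self]; exact ⟨hγ', p, hγp⟩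
    · rw [hc i hi]; exact h3 i hi
  · rw [Finset.sum_insert hi₀, hsum I subset_rfl, Function.update_self]
    simp only [List.map_append, List.sum_append] at h4 ⊢
    rw [add_left_comm, ← h4]; abel
  · intro I' hI'
    by_cases hi : i₀ ∈ I'
    · have hsub : I'.erase i₀ ⊆ I := by
        intro i hi'
        rw [Finset.mem_erase] at hi'
        exact (Finset.mem_insert.1 (hI' hi'.2)).resolve_left hi'.1
      obtain ⟨t', h6, h7, h8, h9⟩ := h5 _ hsub
      -- the cycle is reinserted at a visit of its base point `p`
      have hp : ∃ s s', t' = s ++ s' ∧ TPath step q s p ∧ TPath step p s' q' := by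
        by_cases hqp : p = q
        · subst hqp; exact ⟨[], t', rfl, rfl, h6⟩
        · obtain ⟨x, hx, hxp⟩ : ∃ x ∈ γ, x.2 = p := by
            obtain ⟨γ', ⟨a, r⟩, rfl⟩ := List.eq_nil_or_concat γ |>.resolve_left hγ
            rw [List.concat_eq_append] at hγp
            obtain ⟨_, _, r', ⟨h, _⟩, h'⟩ := path_append.1 hγp
            exact ⟨(a, r), by simp, h.trans h'⟩
          obtain h | ⟨y, hy, hyx⟩ := hvis' t' h7 x (by simp [hx])
          · exact absurd (hxp.symm.trans h) hqp
          · obtain ⟨s, s', rfl⟩ := List.append_of_mem hy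
            obtain ⟨a, r⟩ := y
            obtain rfl : r = p := hyx.trans hxp
            obtain ⟨h10, h11⟩ := TPath.split h6
            exact ⟨s ++ [(a, r)], s', by simp, h10, h11⟩
      obtain ⟨s, s', rfl, h10, h11⟩ := hp
      refine ⟨s ++ γ ++ s', (h10.append hγp).append h11, ?_, ?_, ?_⟩
      · intro x hx
        rcases hvis' _ h7 x hx with h | ⟨y, hy, hyx⟩
        · exact .inl h
        · refine .inr ⟨y, ?_, hyx⟩
          simp only [List.mem_append] at hy ⊢
          tauto
      · rw [← Finset.add_sum_erase _ _ hi, hsum _ hsub, Function.update_self]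
        simp only [List.map_append, List.sum_append] at h8 ⊢
        rw [add_left_comm, ← h8]; abel
      · have := Finset.card_erase_add_one hi
        rw [← this, mul_add]
        simp only [List.length_append] at h9 ⊢
        omega
    · have hsub : I' ⊆ I := fun i hi' => (Finset.mem_insert.1 (hI' hi')).resolve_left
        (by rintro rfl; exact hi hi')
      obtain ⟨t', h6, h7, h8, h9⟩ := h5 I' hsub
      exact ⟨t', h6, hvis' t' h7, by rw [h8, hsum I' hsub], h9⟩

end Cycles

/-! ### Small zero-sum subfamilies -/

section ZeroSum

variable {ι : Type} [DecidableEq ι]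

/-- Integers of absolute value at most `K` with sum zero contain a short zero-sum subfamily: order
them so that all partial sums stay in `[-K, K]`. -/
theorem exists_small_zero_sum (z : ι → ℤ) (K : ℕ) (s : Finset ι) (hs : s.Nonempty)
    (hz : ∀ i ∈ s, |z i| ≤ K) (hsum : ∑ i ∈ s, z i = 0) :
    ∃ b ⊆ s, b.Nonempty ∧ b.card ≤ 2 * K + 1 ∧ ∑ i ∈ b, z i = 0 := by
  by_cases hcard : s.card ≤ 2 * K + 1
  · exact ⟨s, subset_rfl, hs, hcard, hsum⟩
  -- Elements are chosen one by one, keeping the partial sums in `[-K, K]`: as the total is zero,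
  -- some remaining element has the sign opposite to the current sum. Two of the first `2 * K + 2`
  -- partial sums coincide.
  have hnext : ∀ t : Finset ι, ∃ t', t ⊆ s → |∑ i ∈ t, z i| ≤ K → t.card < s.card →
      t ⊆ t' ∧ t' ⊆ s ∧ |∑ i ∈ t', z i| ≤ K ∧ t'.card = t.card + 1 := by
    intro t
    by_cases h : t ⊆ s ∧ |∑ i ∈ t, z i| ≤ K ∧ t.card < s.card
    swap
    · exact ⟨t, fun h1 h2 h3 => absurd ⟨h1, h2, h3⟩ h⟩
    obtain ⟨h1, h2, h3⟩ := h
    have hrest := Finset.sum_sdiff (f := z) h1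
    have hne : (s \ t).Nonempty := by
      rw [← Finset.card_pos, Finset.card_sdiff_of_subset h1]; omega
    have key : ∃ i ∈ s \ t, |∑ i ∈ t, z i + z i| ≤ K := by
      by_contra! hcon
      rw [abs_le] at h2
      rcases le_or_gt (∑ i ∈ t, z i) 0 with h0 | h0
      · have : ∑ i ∈ s \ t, z i < 0 := by
          refine Finset.sum_neg (fun i hi => ?_) hne
          have h4 := hcon i hi
          have h5 := abs_le.1 (hz i (Finset.sdiff_subset hi))
          by_contra! h6
          refine absurd (abs_le.2 ⟨?_, ?_⟩) (not_le.2 h4) <;> omega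
        omega
      · have : 0 ≤ ∑ i ∈ s \ t, z i := by
          refine Finset.sum_nonneg (fun i hi => ?_)
          have h4 := hcon i hi
          have h5 := abs_le.1 (hz i (Finset.sdiff_subset hi))
          by_contra! h6
          refine absurd (abs_le.2 ⟨?_, ?_⟩) (not_le.2 h4) <;> omega
        omega
    obtain ⟨i, hi, hi'⟩ := key
    rw [Finset.mem_sdiff] at hi
    refine ⟨insert i t, fun _ _ _ => ⟨Finset.subset_insert _ _,
      Finset.insert_subset hi.1 h1, ?_, Finset.card_insert_of_notMem hi.2⟩⟩
    rwa [Finset.sum_insert hi.2, add_comm]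
  choose nxt hnxt using hnext
  let f : ℕ → Finset ι := fun n => nxt^[n] ∅
  have hf : ∀ n ≤ s.card, f n ⊆ s ∧ |∑ i ∈ f n, z i| ≤ K ∧ (f n).card = n := by
    intro n
    induction n with
    | zero => intro _; simp [f]
    | succ n ih =>
      intro hn
      obtain ⟨h1, h2, h3⟩ := ih (by omega)
      obtain ⟨-, h5, h6, h7⟩ := hnxt (f n) h1 h2 (by omega)
      simp only [f, Function.iterate_succ_apply'] at *
      exact ⟨h5, h6, by omega⟩
  have hmono : ∀ n m, n ≤ m → m ≤ s.card → f n ⊆ f m := by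
    intro n m hnm
    induction m, hnm using Nat.le_induction with
    | base => intro _; exact subset_rfl
    | succ m hnm ih =>
      intro hm
      obtain ⟨h1, h2, h3⟩ := hf m (by omega)
      have h4 := (hnxt (f m) h1 h2 (by omega)).1
      simp only [f, Function.iterate_succ_apply'] at *
      exact (ih (by omega)).trans h4
  obtain ⟨n, hn, m, hm, hnm, heq⟩ := Finset.exists_ne_map_eq_of_card_lt_of_maps_to
    (s := Finset.range (2 * K + 2)) (t := Finset.Icc (-K : ℤ) K) (f := fun n => ∑ i ∈ f n, z i)
    (by simp; omega) (by
      intro n hn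
      have := abs_le.1 (hf n (by simp at hn; omega)).2.1
      simpa using this)
  wlog hlt : n < m generalizing n m
  · exact this m hm n hn hnm.symm heq.symm (by omega)
  simp only [Finset.mem_range] at hn hm
  have hsub := hmono n m hlt.le (by omega)
  have hc : (f m \ f n).card = m - n := by
    rw [Finset.card_sdiff_of_subset hsub, (hf m (by omega)).2.2, (hf n (by omega)).2.2]
  refine ⟨f m \ f n, Finset.sdiff_subset.trans (hf m (by omega)).1, ?_, by omega, ?_⟩
  · rw [← Finset.card_pos]; omega
  · have := Finset.sum_sdiff (f := z) hsub
    omega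

/-- A zero-sum family of small integers splits into short zero-sum blocks. -/
theorem exists_zero_sum_blocks (z : ι → ℤ) (K : ℕ) (s : Finset ι)
    (hz : ∀ i ∈ s, |z i| ≤ K) (hsum : ∑ i ∈ s, z i = 0) :
    ∃ P : Finset (Finset ι), (P : Set (Finset ι)).PairwiseDisjoint id ∧ P.biUnion id = s ∧
      ∀ b ∈ P, b.card ≤ 2 * K + 1 ∧ ∑ i ∈ b, z i = 0 := by
  induction s using Finset.strongInduction with
  | _ s ih =>
  rcases s.eq_empty_or_nonempty with rfl | hne
  · exact ⟨∅, by simp, by simp, by simp⟩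
  obtain ⟨b, hb, hbne, hbc, hb0⟩ := exists_small_zero_sum z K s hne hz hsum
  obtain ⟨P, h1, h2, h3⟩ := ih (s \ b) (Finset.sdiff_ssubset hb hbne)
    (fun i hi => hz i (Finset.sdiff_subset hi)) (by
      have := Finset.sum_sdiff (f := z) hb
      omega)
  refine ⟨insert b P, ?_, ?_, ?_⟩
  · rw [Finset.coe_insert]
    refine h1.insert fun c hc _ => ?_
    have : c ⊆ s \ b := h2 ▸ Finset.subset_biUnion_of_mem id hc
    exact (Finset.disjoint_of_subset_left this Finset.sdiff_disjoint).symm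
  · rw [Finset.biUnion_insert, h2]
    simp [hb]
  · intro c hc
    rcases Finset.mem_insert.1 hc with rfl | hc
    · exact ⟨hbc, hb0⟩
    · exact h3 c hc

/-- One step of the recursion for `zeroSumBound`: the pair holds the current bound on the entries
and the current bound on the size of the blocks. -/
def zeroSumStep (p : ℕ × ℕ) : ℕ × ℕ := ((2 * p.1 + 1) * p.1, (2 * p.1 + 1) * p.2)

/-- A bound on the size of zero-sum subfamilies of integer vectors with `m` entries, all of
absolute value at most `K`. -/
def zeroSumBound (m K : ℕ) : ℕ := (zeroSumStep^[m] (K, 1)).2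

theorem zeroSumStep_iterate_snd (m K c : ℕ) :
    (zeroSumStep^[m] (K, c)).2 = c * zeroSumBound m K ∧
      (zeroSumStep^[m] (K, c)).1 = (zeroSumStep^[m] (K, 1)).1 := by
  induction m with
  | zero => simp [zeroSumBound]
  | succ m ih =>
    simp only [zeroSumBound, Function.iterate_succ_apply', zeroSumStep] at ih ⊢
    rw [ih.1, ih.2]
    exact ⟨by ring, rfl⟩

theorem zeroSumBound_succ (m K : ℕ) :
    zeroSumBound (m + 1) K = (2 * K + 1) * zeroSumBound m ((2 * K + 1) * K) := by
  rw [zeroSumBound, Function.iterate_succ_apply]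
  exact (zeroSumStep_iterate_snd m _ _).1.trans (by simp [zeroSumBound])

/-- Every member of a zero-sum family of small integer vectors lies in a zero-sum subfamily of
bounded size. -/
theorem exists_zero_sum_mem {κ : Type} (J : List κ) :
    ∀ {ι : Type} [DecidableEq ι] (z : ι → κ → ℤ) (K : ℕ) (s : Finset ι) (i₀ : ι), i₀ ∈ s →
    (∀ i ∈ s, ∀ j ∈ J, |z i j| ≤ K) → (∀ j ∈ J, ∑ i ∈ s, z i j = 0) →
    ∃ s' ⊆ s, i₀ ∈ s' ∧ s'.card ≤ zeroSumBound J.length K ∧ ∀ j ∈ J, ∑ i ∈ s', z i j = 0 := by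
  induction J with
  | nil =>
    intro ι _ z K s i₀ hi₀ _ _
    exact ⟨{i₀}, by simpa using hi₀, by simp, by simp [zeroSumBound], by simp⟩
  | cons j J ih =>
    intro ι _ z K s i₀ hi₀ hz hsum
    obtain ⟨P, h1, h2, h3⟩ := exists_zero_sum_blocks (fun i => z i j) K s
      (fun i hi => hz i hi j (by simp)) (hsum j (by simp))
    have hsub : ∀ b ∈ P, b ⊆ s := fun b hb => h2 ▸ Finset.subset_biUnion_of_mem id hb
    obtain ⟨b₀, hb₀, hib₀⟩ : ∃ b ∈ P, i₀ ∈ b := by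
      rw [← h2] at hi₀; simpa using hi₀
    obtain ⟨P', h4, h5, h6, h7⟩ := ih (fun b j => ∑ i ∈ b, z i j) ((2 * K + 1) * K) P b₀ hb₀
      (by
        intro b hb j' hj'
        refine (Finset.abs_sum_le_sum_abs _ _).trans ?_
        refine (Finset.sum_le_card_nsmul _ _ (K : ℤ)
          fun i hi => hz i (hsub b hb hi) j' (by simp [hj'])).trans ?_
        have := (h3 b hb).1
        simp only [nsmul_eq_mul]
        push_cast
        gcongr
        exact_mod_cast this)
      (by
        intro j' hj'
        rw [← hsum j' (by simp [hj']), ← h2, Finset.sum_biUnion h1]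
        rfl)
    have h1' : (P' : Set (Finset ι)).PairwiseDisjoint id := h1.subset (by exact_mod_cast h4)
    refine ⟨P'.biUnion id, ?_, ?_, ?_, ?_⟩
    · exact Finset.biUnion_subset.2 fun b hb => hsub b (h4 hb)
    · exact Finset.mem_biUnion.2 ⟨b₀, h5, hib₀⟩
    · rw [List.length_cons, zeroSumBound_succ]
      refine Finset.card_biUnion_le.trans ?_
      refine (Finset.sum_le_card_nsmul _ _ (2 * K + 1) fun b hb => (h3 b (h4 hb)).1).trans ?_
      rw [smul_eq_mul, mul_comm]
      gcongr
    · intro j' hj'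
      rw [Finset.sum_biUnion h1']
      rcases List.mem_cons.1 hj' with rfl | hj'
      · exact Finset.sum_eq_zero fun b hb => (h3 b (h4 hb)).2
      · exact h7 j' hj'

end ZeroSum

/-! ### Small solutions of weight constraints on a family of weighted automata -/

section Family

variable {k m : ℕ}

/-- The number of states and the absolute values of all entries of the weights are at most `B`. -/
def Net.Bdd (N : WNet k (Fin m → ℤ)) (B : ℕ) : Prop :=
  Nat.card N.Q ≤ B ∧ ∀ q a v q', N.step q (a, v) q' → ∀ j, |v j| ≤ B

theorem Net.Bdd.mono {N : WNet k (Fin m → ℤ)} {B B' : ℕ} (h : N.Bdd B) (hB : B ≤ B') :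
    N.Bdd B' :=
  ⟨h.1.trans hB, fun q a v q' hs j => (h.2 q a v q' hs j).trans (by exact_mod_cast hB)⟩

theorem Net.Bdd.abs_weight_le {N : WNet k (Fin m → ℤ)} {B : ℕ} (h : N.Bdd B) {q q' : N.Q}
    {t : List ((Option (Fin k) × (Fin m → ℤ)) × N.Q)} (ht : TPath N.step q t q') (j : Fin m) :
    |(t.map fun x => x.1.2).sum j| ≤ t.length * B := by
  induction t generalizing q with
  | nil => simp
  | cons x t ih =>
    obtain ⟨⟨a, v⟩, r⟩ := x
    obtain ⟨_, ⟨rfl, h1⟩, h2⟩ := ht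
    have h3 := ih h2
    have h4 := h.2 _ _ _ _ h1 j
    simp only [List.map_cons, List.sum_cons, Pi.add_apply, List.length_cons, Nat.cast_add,
      Nat.cast_one]
    refine (abs_add_le _ _).trans ?_
    linarith

/-- The weight of a run is the weight of a short path plus the weights of short cycles, any part of
which can be left out. -/
theorem Net.Gen.pump {N : WNet k (Fin m → ℤ)} {B : ℕ} (hN : N.Bdd B) {w : Word k}
    {u : Fin m → ℤ} {n : ℕ} (h : N.Gen w u n) :
    ∃ (v₀ : Fin m → ℤ) (I : Finset ℕ) (c : ℕ → Fin m → ℤ), u = v₀ + ∑ i ∈ I, c i ∧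
      (∀ j, |v₀ j| ≤ (B * B * B : ℕ)) ∧ (∀ i ∈ I, ∀ j, |c i j| ≤ (B * B : ℕ)) ∧
      ∀ I' ⊆ I, ∃ w' n', N.Gen w' (v₀ + ∑ i ∈ I', c i) n' ∧ n' ≤ B * B + B * I'.card := by
  obtain ⟨l, h1, rfl, rfl, rfl⟩ := h
  obtain ⟨t, ht, rfl⟩ := h1.exists_tPath
  obtain ⟨t₀, I, c, h2, h3, h4, h5, h6⟩ := TPath.pump Prod.snd _ rfl ht
  refine ⟨(t₀.map fun x => x.1.2).sum, I, fun i => ((c i).map fun x => x.1.2).sum, ?_, fun j => ?_, fun i hi j => ?_,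
    fun I' hI' => ?_⟩
  · simpa [weightOf, Function.comp_def] using h5
  · refine (hN.abs_weight_le h2 j).trans ?_
    have := h3.trans (Nat.mul_le_mul hN.1 hN.1)
    push_cast
    gcongr
    exact_mod_cast this
  · obtain ⟨h7, p, h8⟩ := h4 i hi
    refine (hN.abs_weight_le h8 j).trans ?_
    have := h7.trans hN.1
    push_cast
    gcongr
  · obtain ⟨t', h7, -, h8, h9⟩ := h6 I' hI'
    refine ⟨_, _, ⟨t'.map Prod.fst, h7.path, rfl, ?_, rfl⟩, ?_⟩
    · rw [← h8]; simp [weightOf, Function.comp_def]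
    · rw [List.length_map]
      refine h9.trans ?_
      have := hN.1
      gcongr

/-- A bound on all vectors that occur in the pumping argument for a family of at most `B`
automata bounded by `B`. -/
def vectorBound (B : ℕ) : ℕ := B + B * (B * B * B) + B * B + 1

/-- A family of weighted automata with total weight in a shifted orthant has a member of bounded
length: pump the given one down, keeping a zero-sum subfamily of the skeleton, the cycles and the
slack vectors. -/
theorem exists_small_family {P : ℕ → WNet k (Fin m → ℤ)} {X : Finset ℕ} {b : Fin m → ℤ} {B : ℕ}
    (hP : ∀ x ∈ X, (P x).Bdd B) (hX : X.card ≤ B) (hb : ∀ j, |b j| ≤ B)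
    {η : Interpretation k} {u : ℕ → Fin m → ℤ} {n : ℕ → ℕ}
    (hgen : ∀ x ∈ X, (P x).Gen (η x) (u x) (n x)) (hpos : ∀ j, 0 ≤ b j + ∑ x ∈ X, u x j) :
    ∃ (η' : Interpretation k) (u' : ℕ → Fin m → ℤ) (n' : ℕ → ℕ),
      (∀ x ∈ X, (P x).Gen (η' x) (u' x) (n' x) ∧
        n' x ≤ B * B + B * zeroSumBound m (vectorBound B)) ∧
      ∀ j, 0 ≤ b j + ∑ x ∈ X, u' x j := by
  classical
  have hpump : ∀ x, ∃ (v₀ : Fin m → ℤ) (I : Finset ℕ) (c : ℕ → Fin m → ℤ), x ∈ X →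
      u x = v₀ + ∑ i ∈ I, c i ∧
      (∀ j, |v₀ j| ≤ (B * B * B : ℕ)) ∧ (∀ i ∈ I, ∀ j, |c i j| ≤ (B * B : ℕ)) ∧
      ∀ I' ⊆ I, ∃ w' n', (P x).Gen w' (v₀ + ∑ i ∈ I', c i) n' ∧ n' ≤ B * B + B * I'.card := by
    intro x
    by_cases hx : x ∈ X
    · obtain ⟨v₀, I, c, h⟩ := (hgen x hx).pump (hP x hx)
      exact ⟨v₀, I, c, fun _ => h⟩
    · exact ⟨0, ∅, 0, fun h => absurd h hx⟩
  choose v₀ I c hpump using hpump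
  -- The slack of inequality `j` is written as that many copies of the vector `-e_j`, so that the
  -- constant vector `none`, the cycles `inl` and the slack vectors `inr` add up to zero.
  let slack : Fin m → ℕ := fun j => (b j + ∑ x ∈ X, u x j).toNat
  have hslack : ∀ j, (slack j : ℤ) = b j + ∑ x ∈ X, u x j := fun j => Int.toNat_of_nonneg (hpos j)
  let S₁ : Finset (Σ _ : ℕ, ℕ) := X.sigma I
  let S₂ : Finset (Σ _ : Fin m, ℕ) := Finset.univ.sigma fun j => Finset.range (slack j)
  let s : Finset (Option ((Σ _ : ℕ, ℕ) ⊕ (Σ _ : Fin m, ℕ))) := Finset.insertNone (S₁.disjSum S₂)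
  let z : Option ((Σ _ : ℕ, ℕ) ⊕ (Σ _ : Fin m, ℕ)) → Fin m → ℤ
    | none => b + ∑ x ∈ X, v₀ x
    | some (.inl p) => c p.1 p.2
    | some (.inr p) => fun j => if j = p.1 then -1 else 0
  have hzsum : ∀ (A : Finset (Σ _ : ℕ, ℕ)) (A' : Finset (Σ _ : Fin m, ℕ)) j,
      ∑ i ∈ Finset.insertNone (A.disjSum A'), z i j =
        b j + ∑ x ∈ X, v₀ x j + ∑ p ∈ A, c p.1 p.2 j - (A'.filter fun p => j = p.1).card := by
    intro A A' j
    rw [Finset.sum_insertNone, Finset.sum_disjSum]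
    simp only [z, Pi.add_apply, Finset.sum_apply]
    have : ∑ p ∈ A', (if j = p.1 then (-1 : ℤ) else 0) = -((A'.filter fun p => j = p.1).card) := by
      rw [← Finset.sum_filter]; simp
    rw [this]
    ring
  have hu : ∀ j, ∑ x ∈ X, u x j = ∑ x ∈ X, v₀ x j + ∑ p ∈ S₁, c p.1 p.2 j := by
    intro j
    rw [Finset.sum_sigma, ← Finset.sum_add_distrib]
    refine Finset.sum_congr rfl fun x hx => ?_
    rw [(hpump x hx).1]; simp
  have hcardS₂ : ∀ j, (S₂.filter fun p => j = p.1).card = slack j := by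
    intro j
    have : S₂.filter (fun p => j = p.1) = (Finset.range (slack j)).image fun i => ⟨j, i⟩ := by
      ext ⟨j', i⟩
      simp only [S₂, Finset.mem_filter, Finset.mem_sigma, Finset.mem_univ, true_and,
        Finset.mem_range, Finset.mem_image, Sigma.mk.injEq, heq_eq_eq]
      constructor
      · rintro ⟨h, rfl⟩; exact ⟨i, h, rfl, rfl⟩
      · rintro ⟨_, h, rfl, rfl⟩; exact ⟨h, rfl⟩
    rw [this, Finset.card_image_of_injective _ (fun a b h => by simpa using h), Finset.card_range]
  obtain ⟨s', hs', hnone, hcard, hsum⟩ := exists_zero_sum_mem (List.finRange m) z (vectorBound B) s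
    none (by simp [s]) (by
      intro i hi j _
      obtain _ | ⟨⟨x, i⟩⟩ | ⟨⟨j', i⟩⟩ := i
      · have h1 : |∑ x ∈ X, v₀ x j| ≤ (B * (B * B * B) : ℕ) := by
          refine (Finset.abs_sum_le_sum_abs _ _).trans ?_
          refine (Finset.sum_le_card_nsmul _ _ _ fun x hx => (hpump x hx).2.1 j).trans ?_
          rw [nsmul_eq_mul]
          push_cast
          gcongr
        have h2 := hb j
        simp only [z, Pi.add_apply, Finset.sum_apply]
        refine (abs_add_le _ _).trans ?_
        rw [vectorBound]
        push_cast at h1 ⊢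
        nlinarith
      · simp only [s, S₁, Finset.some_mem_insertNone, Finset.inl_mem_disjSum,
          Finset.mem_sigma] at hi
        have h1 := (hpump x hi.1).2.2.1 i hi.2 j
        simp only [z]
        refine h1.trans ?_
        rw [vectorBound]
        exact_mod_cast (by omega : B * B ≤ B + B * (B * B * B) + B * B + 1)
      · simp only [z]
        rw [vectorBound]
        split_ifs
        · simp; positivity
        · simp; positivity) (by
      intro j _
      rw [hzsum, hcardS₂, hslack, hu]
      ring)
  let S₁' := S₁.filter fun p => some (.inl p) ∈ s'
  let S₂' := S₂.filter fun p => some (.inr p) ∈ s'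
  have hs'eq : s' = Finset.insertNone (S₁'.disjSum S₂') := by
    ext i
    obtain _ | p | p := i
    · simp [hnone]
    · have : some (Sum.inl p) ∈ s' → p ∈ S₁ := fun h => by simpa [s] using hs' h
      simp only [Finset.some_mem_insertNone, Finset.inl_mem_disjSum, S₁', Finset.mem_filter]
      tauto
    · have : some (Sum.inr p) ∈ s' → p ∈ S₂ := fun h => by simpa [s] using hs' h
      simp only [Finset.some_mem_insertNone, Finset.inr_mem_disjSum, S₂', Finset.mem_filter]
      tauto
  let I' : ℕ → Finset ℕ := fun x => (I x).filter fun i => some (Sum.inl ⟨x, i⟩) ∈ s'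
  have hS₁' : S₁' = X.sigma I' := by
    ext ⟨x, i⟩
    simp [S₁', S₁, I', and_assoc]
  have hI'card : ∀ x, (I' x).card ≤ s'.card := by
    intro x
    refine Finset.card_le_card_of_injOn (fun i => some (Sum.inl ⟨x, i⟩)) ?_ ?_
    · intro i hi
      exact (Finset.mem_filter.1 (Finset.mem_coe.1 hi)).2
    · intro i _ i' _ h
      simpa using h
  have hnew : ∀ x, ∃ w' n', x ∈ X →
      (P x).Gen w' (v₀ x + ∑ i ∈ I' x, c x i) n' ∧ n' ≤ B * B + B * (I' x).card := by
    intro x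
    by_cases hx : x ∈ X
    · obtain ⟨w', n', h⟩ := (hpump x hx).2.2.2 (I' x) (Finset.filter_subset _ _)
      exact ⟨w', n', fun _ => h⟩
    · exact ⟨[], 0, fun h => absurd h hx⟩
  choose η' n' hnew using hnew
  refine ⟨η', fun x => v₀ x + ∑ i ∈ I' x, c x i, n', fun x hx => ⟨(hnew x hx).1, ?_⟩, fun j => ?_⟩
  · refine (hnew x hx).2.trans ?_
    have := (hI'card x).trans hcard
    rw [List.length_finRange] at this
    gcongr
  · have h1 := hsum j (List.mem_finRange j)
    rw [hs'eq, hzsum, hS₁', Finset.sum_sigma] at h1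
    have h2 : ∑ x ∈ X, (v₀ x + ∑ i ∈ I' x, c x i) j =
        ∑ x ∈ X, v₀ x j + ∑ x ∈ X, ∑ i ∈ I' x, c x i j := by
      rw [← Finset.sum_add_distrib]
      exact Finset.sum_congr rfl fun x _ => by simp
    rw [h2]
    dsimp only at h1
    omega

end Family

/-! ### Eliminating a relational constraint -/

theorem termValue_cons {k : ℕ} (η : Interpretation k) (x : ℕ) (t : Term) :
    termValue η (x :: t) = η x ++ termValue η t := rfl

theorem termValue_congr {k : ℕ} {η η' : Interpretation k} {t : Term}
    (h : ∀ x ∈ t, η x = η' x) : termValue η t = termValue η' t :=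
  List.flatMap_congr h

section Elimination

variable {k m : ℕ}

/-- A finite transducer without weights. -/
abbrev PTrans (k : ℕ) := Net (Option (Fin k) × Option (Fin k))

/-- `T.PRel u w`: some accepting path of `T` has input `u` and output `w`. -/
def Net.PRel (T : PTrans k) (u w : Word k) : Prop :=
  ∃ l, T.Acc l ∧ (l.map Prod.fst).reduceOption = u ∧ (l.map Prod.snd).reduceOption = w

/-- Exchange of input and output of a pair if `b = false`. -/
def orient (α : Type) (b : Bool) (p : α × α) : α × α := if b then p else p.swap

/-- A transducer as a weighted transducer with zero weights; for `b = false`, input and output are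
exchanged. -/
def Net.toWTrans (T : PTrans k) (b : Bool) : WTrans k (Fin m → ℤ) where
  Q := T.Q
  finite := inferInstance
  step q a q' := a.2.2 = 0 ∧ T.step q (orient _ b (a.1, a.2.1)) q'
  init := T.init
  final := T.final

theorem Net.toWTrans_path {T : PTrans k} {b : Bool} {q q' : T.Q}
    {l : List (Option (Fin k) × Option (Fin k) × (Fin m → ℤ))} :
    Path (T.toWTrans b).step q l q' ↔ (∀ a ∈ l, a.2.2 = 0) ∧
      Path T.step q (l.map fun a => orient _ b (a.1, a.2.1)) q' := by
  induction l generalizing q with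
  | nil => exact ⟨fun h => ⟨by simp, h⟩, fun h => h.2⟩
  | cons a l ih =>
    simp only [path_cons, List.map_cons, List.forall_mem_cons]
    constructor
    · rintro ⟨r, ⟨h1, h2⟩, h3⟩; exact ⟨⟨h1, (ih.1 h3).1⟩, r, h2, (ih.1 h3).2⟩
    · rintro ⟨⟨h1, h2⟩, r, h3, h4⟩; exact ⟨r, ⟨h1, h3⟩, ih.2 ⟨h2, h4⟩⟩

theorem Net.toWTrans_rel {T : PTrans k} {b : Bool} {p : Word k × Word k} {v : Fin m → ℤ} :
    (T.toWTrans b).Rel (orient _ b p).1 (orient _ b p).2 v ↔ v = 0 ∧ T.PRel p.1 p.2 := by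
  obtain ⟨u, w⟩ := p
  constructor
  · rintro ⟨l, h1, h2, h3, rfl⟩
    obtain ⟨h4, h5⟩ := Net.toWTrans_path.1 h1
    refine ⟨?_, _, h5, ?_⟩
    · refine List.sum_eq_zero fun a ha => ?_
      simp only [List.map_map, List.mem_map] at ha
      obtain ⟨c, hc, rfl⟩ := ha
      exact h4 c hc
    · cases b
      · simp only [orient, wordOf, List.map_map, Function.comp_def] at h2 h3 ⊢
        exact ⟨h3, h2⟩
      · simp only [orient, wordOf, List.map_map, Function.comp_def] at h2 h3 ⊢
        exact ⟨h2, h3⟩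
  · rintro ⟨rfl, l, h1, h2, h3⟩
    dsimp only at h2 h3
    refine ⟨l.map fun a => ((orient _ b a).1, (orient _ b a).2, 0), ?_, ?_, ?_, ?_⟩
    · refine Net.toWTrans_path.2 ⟨fun a ha => ?_, ?_⟩
      · obtain ⟨c, -, rfl⟩ := List.mem_map.1 ha
        rfl
      have : (l.map fun a => ((orient _ b a).1, (orient _ b a).2, (0 : Fin m → ℤ))).map
          (fun a => orient _ b (a.1, a.2.1)) = l := by
        cases b <;> simp [orient, Function.comp_def]
      rw [this]
      exact h1
    · cases b
      · simpa [orient, Function.comp_def] using h3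
      · simpa [orient, Function.comp_def] using h2
    · cases b
      · simpa [orient, wordOf, Function.comp_def] using h2
      · simpa [orient, wordOf, Function.comp_def] using h3
    · simp [weightOf, Function.comp_def]

/-- The concatenation of the automata of the variables of a term. -/
def chainNet (P : ℕ → WNet k (Fin m → ℤ)) : Term → WNet k (Fin m → ℤ)
  | [] => Net.unit
  | y :: ys => Net.seq (none, 0) (P y) (chainNet P ys)

theorem chainNet_gen {P : ℕ → WNet k (Fin m → ℤ)} {η : Interpretation k} {u : ℕ → Fin m → ℤ}
    {n : ℕ → ℕ} {ys : Term} (h : ∀ y ∈ ys, (P y).Gen (η y) (u y) (n y)) :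
    ∃ n', (chainNet P ys).Gen (termValue η ys) (ys.map u).sum n' := by
  induction ys with
  | nil => exact ⟨0, Net.unit_gen⟩
  | cons y ys ih =>
    obtain ⟨n', h'⟩ := ih fun z hz => h z (by simp [hz])
    exact Net.seq_gen (h y (by simp)) h'

theorem chainNet_gen_inv {P : ℕ → WNet k (Fin m → ℤ)} {ys : Term} (hys : ys.Nodup) :
    ∀ {w : Word k} {v : Fin m → ℤ} {n : ℕ}, (chainNet P ys).Gen w v n →
    ∃ (η : Interpretation k) (u : ℕ → Fin m → ℤ) (n' : ℕ → ℕ),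
      (∀ y ∈ ys, (P y).Gen (η y) (u y) (n' y) ∧ n' y ≤ n) ∧ w = termValue η ys ∧
        v = (ys.map u).sum := by
  induction ys with
  | nil =>
    intro w v n h
    obtain ⟨rfl, rfl⟩ := Net.unit_gen_inv h
    exact ⟨fun _ => [], 0, 0, by simp, rfl, by simp⟩
  | cons y ys ih =>
    intro w v n h
    obtain ⟨w₁, w₂, v₁, v₂, n₁, n₂, rfl, rfl, hn₁, hn₂, h₁, h₂⟩ := Net.seq_gen_inv h
    obtain ⟨hy, hys⟩ := List.nodup_cons.1 hys
    obtain ⟨η, u, n', h3, rfl, rfl⟩ := ih hys h₂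
    have hne : ∀ z ∈ ys, z ≠ y := fun z hz => by rintro rfl; exact hy hz
    refine ⟨Function.update η y w₁, Function.update u y v₁, Function.update n' y n₁, ?_, ?_, ?_⟩
    · intro z hz
      rcases List.mem_cons.1 hz with rfl | hz
      · simpa using ⟨h₁, hn₁⟩
      · rw [Function.update_of_ne (hne z hz), Function.update_of_ne (hne z hz),
          Function.update_of_ne (hne z hz)]
        exact ⟨(h3 z hz).1, (h3 z hz).2.trans hn₂⟩
    · rw [termValue_cons, Function.update_self]
      congr 1
      exact termValue_congr fun z hz => (Function.update_of_ne (hne z hz) _ _).symm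
    · rw [List.map_cons, List.sum_cons, Function.update_self]
      congr 2
      exact List.map_congr_left fun z hz => (Function.update_of_ne (hne z hz) _ _).symm

theorem Net.Bdd.seq {M N : WNet k (Fin m → ℤ)} {B B' C : ℕ} (hM : M.Bdd B)
    (hN : Nat.card N.Q ≤ B' ∧ ∀ q a v q', N.step q (a, v) q' → ∀ j, |v j| ≤ C) (hC : B ≤ C) :
    Nat.card (Net.seq (none, 0) M N).Q ≤ B + B' ∧
      ∀ q a v q', (Net.seq (none, 0) M N).step q (a, v) q' → ∀ j, |v j| ≤ C := by
  refine ⟨(Net.card_seq _ M N).le.trans (add_le_add hM.1 hN.1), fun q a v q' h j => ?_⟩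
  cases h with
  | left h => exact (hM.2 _ _ _ _ h j).trans (by exact_mod_cast hC)
  | link => simp
  | right h => exact hN.2 _ _ _ _ h j

theorem chainNet_bdd {P : ℕ → WNet k (Fin m → ℤ)} {B : ℕ} {ys : Term}
    (h : ∀ y ∈ ys, (P y).Bdd B) : Nat.card (chainNet P ys).Q ≤ ys.length * B + 1 ∧
      ∀ q a v q', (chainNet P ys).step q (a, v) q' → ∀ j, |v j| ≤ B := by
  induction ys with
  | nil => exact ⟨by simp [chainNet, Net.unit], fun q a v q' h => h.elim⟩
  | cons y ys ih =>
    obtain ⟨h1, h2⟩ := (h y (by simp)).seq (ih fun z hz => h z (by simp [hz])) le_rfl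
    refine ⟨h1.trans (le_of_eq ?_), h2⟩
    simp only [List.length_cons]; ring

theorem comp_bdd {T : PTrans k} {b : Bool} {N : WNet k (Fin m → ℤ)} {B B' : ℕ}
    (hT : Nat.card T.Q ≤ B) (hN : Nat.card N.Q ≤ B' ∧
      ∀ q a v q', N.step q (a, v) q' → ∀ j, |v j| ≤ B) :
    (Net.comp (T.toWTrans b) N).Bdd (B * B' + B) := by
  refine ⟨?_, fun q a v q' h j => ?_⟩
  · have : Nat.card (Net.comp (T.toWTrans (m := m) b) N).Q = Nat.card T.Q * Nat.card N.Q :=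
      Nat.card_prod _ _
    rw [this]
    exact (Nat.mul_le_mul hT hN.1).trans (Nat.le_add_right _ _)
  · have key : |v j| ≤ B := by
      cases h with
      | @both p a b v p' q v' q' h1 h2 =>
        obtain rfl : v = 0 := h1.1
        simpa using hN.2 _ _ _ _ h2 j
      | left h1 =>
        obtain rfl : v = 0 := h1.1
        simp
      | right h1 => exact hN.2 _ _ _ _ h1 j
    push_cast
    have : (0 : ℤ) ≤ B * B' := by positivity
    linarith

theorem prod_bdd {M N : WNet k (Fin m → ℤ)} {B : ℕ} (hM : M.Bdd B) (hN : N.Bdd B) :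
    (Net.prod M N).Bdd (B * B + 2 * B) := by
  refine ⟨?_, fun q a v q' h j => ?_⟩
  · have : Nat.card (Net.prod M N).Q = Nat.card M.Q * Nat.card N.Q := Nat.card_prod _ _
    rw [this]
    exact (Nat.mul_le_mul hM.1 hN.1).trans (Nat.le_add_right _ _)
  · have key : |v j| ≤ 2 * B := by
      cases h with
      | both h1 h2 =>
        have h3 := hM.2 _ _ _ _ h1.2 j
        have h4 := hN.2 _ _ _ _ h2 j
        refine (abs_add_le _ _).trans ?_
        linarith
      | left h1 => have h3 := hM.2 _ _ _ _ h1.2 j; linarith [Int.natCast_nonneg B]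
      | right h1 => have h3 := hN.2 _ _ _ _ h1 j; linarith [Int.natCast_nonneg B]
    push_cast
    have : (0 : ℤ) ≤ B * B := by positivity
    linarith

/-- The bound for products of automata bounded by `B`. -/
def prodBound (B : ℕ) : ℕ := B * B + 2 * B

theorem le_prodBound (B : ℕ) : B ≤ prodBound B := by unfold prodBound; nlinarith

theorem le_prodBound_iterate (a B : ℕ) : B ≤ prodBound^[a] B := by
  induction a generalizing B with
  | zero => exact le_rfl
  | succ a ih => rw [Function.iterate_succ_apply]; exact (le_prodBound B).trans (ih _)

/-- Replacing the automaton of one variable by its product with `D` turns the condition that `D`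
reads the value of the variable into a part of the family. -/
theorem attach_one (D : WNet k (Fin m → ℤ)) (P : ℕ → WNet k (Fin m → ℤ)) (X : Finset ℕ) {x : ℕ}
    (hx : x ∈ X) {η : Interpretation k} {u : ℕ → Fin m → ℤ} {n : ℕ → ℕ} {s : Fin m → ℤ} {nD : ℕ}
    (h : ∀ y ∈ X, (P y).Gen (η y) (u y) (n y)) (hD : D.Gen (η x) s nD) :
    ∃ (P' : ℕ → WNet k (Fin m → ℤ)) (u' : ℕ → Fin m → ℤ) (n' : ℕ → ℕ),
      (∀ y ∈ X, (P' y).Gen (η y) (u' y) (n' y)) ∧ ∑ y ∈ X, u' y = ∑ y ∈ X, u y + s ∧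
      (∀ B, (∀ y ∈ X, (P y).Bdd B) → D.Bdd B → ∀ y ∈ X, (P' y).Bdd (prodBound B)) ∧
      ∀ (η' : Interpretation k) (u' : ℕ → Fin m → ℤ) (n' : ℕ → ℕ) (G : ℕ),
        (∀ y ∈ X, (P' y).Gen (η' y) (u' y) (n' y) ∧ n' y ≤ G) →
        ∃ (u₁ : ℕ → Fin m → ℤ) (n₁ : ℕ → ℕ) (s₁ : Fin m → ℤ) (n₂ : ℕ),
          (∀ y ∈ X, (P y).Gen (η' y) (u₁ y) (n₁ y) ∧ n₁ y ≤ G) ∧ D.Gen (η' x) s₁ n₂ ∧ n₂ ≤ G ∧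
            ∑ y ∈ X, u' y = ∑ y ∈ X, u₁ y + s₁ := by
  have hsum : ∀ (f : ℕ → Fin m → ℤ) (v s : Fin m → ℤ), f x = v + s →
      ∑ y ∈ X, f y = ∑ y ∈ X, Function.update f x v y + s := by
    intro f v s hf
    rw [← Finset.add_sum_erase _ _ hx, ← Finset.add_sum_erase _ _ hx, hf, Function.update_self,
      Finset.sum_congr rfl fun y hy => (Function.update_of_ne (Finset.ne_of_mem_erase hy) _ _).symm]
    abel
  obtain ⟨n₀, hn₀⟩ := Net.prod_gen (h x hx) hD
  refine ⟨Function.update P x (Net.prod (P x) D), Function.update u x (u x + s),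
    Function.update n x n₀, ?_, ?_, ?_, ?_⟩
  · intro y hy
    by_cases hyx : y = x
    · subst hyx; simpa using hn₀
    · simpa [hyx] using h y hy
  · rw [hsum (Function.update u x (u x + s)) (u x) s (by simp)]
    simp
  · intro B hP hDB y hy
    by_cases hyx : y = x
    · subst hyx; simpa [prodBound] using prod_bdd (hP y hy) hDB
    · simpa [hyx] using (hP y hy).mono (le_prodBound B)
  · intro η' u' n' G h'
    obtain ⟨h1, h2⟩ := h' x hx
    rw [Function.update_self] at h1
    obtain ⟨v₁, v₂, m₁, m₂, hv, hm₁, hm₂, h3, h4⟩ := Net.prod_gen_inv h1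
    refine ⟨Function.update u' x v₁, Function.update n' x m₁, v₂, m₂, ?_, h4, hm₂.trans h2,
      hsum u' v₁ v₂ hv⟩
    intro y hy
    by_cases hyx : y = x
    · subst hyx; simpa using ⟨h3, hm₁.trans h2⟩
    · simpa [hyx] using h' y hy

/-- The condition that `D` reads the value of a nonempty term can be absorbed by the automata of
the variables: the run of `D` is cut between the variables. -/
theorem attach (D : WNet k (Fin m → ℤ)) (X : Finset ℕ) (r' : D.Q) (t : Term) :
    ∀ (_ : t ≠ []) (_ : ∀ x ∈ t, x ∈ X) (r : D.Q) (P : ℕ → WNet k (Fin m → ℤ))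
    {η : Interpretation k} {u : ℕ → Fin m → ℤ} {n : ℕ → ℕ} {s : Fin m → ℤ} {nD : ℕ}
    (_ : ∀ y ∈ X, (P y).Gen (η y) (u y) (n y)) (_ : (D.segment r r').Gen (termValue η t) s nD),
    ∃ (P' : ℕ → WNet k (Fin m → ℤ)) (u' : ℕ → Fin m → ℤ) (n' : ℕ → ℕ),
      (∀ y ∈ X, (P' y).Gen (η y) (u' y) (n' y)) ∧ ∑ y ∈ X, u' y = ∑ y ∈ X, u y + s ∧
      (∀ B, (∀ y ∈ X, (P y).Bdd B) → D.Bdd B → ∀ y ∈ X, (P' y).Bdd (prodBound^[t.length] B)) ∧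
      ∀ (η' : Interpretation k) (u' : ℕ → Fin m → ℤ) (n' : ℕ → ℕ) (G : ℕ),
        (∀ y ∈ X, (P' y).Gen (η' y) (u' y) (n' y) ∧ n' y ≤ G) →
        ∃ (u₁ : ℕ → Fin m → ℤ) (n₁ : ℕ → ℕ) (s₁ : Fin m → ℤ) (n₂ : ℕ),
          (∀ y ∈ X, (P y).Gen (η' y) (u₁ y) (n₁ y) ∧ n₁ y ≤ G) ∧
          (D.segment r r').Gen (termValue η' t) s₁ n₂ ∧ n₂ ≤ t.length * G ∧
            ∑ y ∈ X, u' y = ∑ y ∈ X, u₁ y + s₁ := by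
  induction t with
  | nil => exact fun h => absurd rfl h
  | cons x t ih =>
    intro _ ht r P η u n s nD h hD
    have hx : x ∈ X := ht x (by simp)
    by_cases hne : t = []
    · subst hne
      have hval : ∀ η : Interpretation k, termValue η [x] = η x := fun η => by
        simp [termValue]
      rw [hval] at hD
      obtain ⟨P', u', n', h1, h2, h3, h4⟩ := attach_one (D.segment r r') P X hx h hD
      refine ⟨P', u', n', h1, h2, fun B hB hD => h3 B hB hD, fun η' u' n' G h' => ?_⟩
      obtain ⟨u₁, n₁, s₁, n₂, h5, h6, h7, h8⟩ := h4 η' u' n' G h'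
      exact ⟨u₁, n₁, s₁, n₂, h5, (hval η').symm ▸ h6, by simpa using h7, h8⟩
    · rw [termValue_cons] at hD
      obtain ⟨r'', s₁, s₂, n₁, n₂, rfl, hD₁, hD₂⟩ := Net.segment_gen_append hD
      obtain ⟨P₁, u₁, n₁', h1, h2, h3, h4⟩ := attach_one (D.segment r r'') P X hx h hD₁
      obtain ⟨P₂, u₂, n₂', h5, h6, h7, h8⟩ := ih hne (fun y hy => ht y (by simp [hy])) r'' P₁ h1 hD₂
      refine ⟨P₂, u₂, n₂', h5, by rw [h6, h2]; abel, ?_, ?_⟩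
      · intro B hB hD
        exact h7 (prodBound B) (h3 B hB hD) (hD.mono (le_prodBound B))
      · intro η' u' n' G h'
        obtain ⟨u₃, n₃, s₃, n₄, h9, h10, h11, h12⟩ := h8 η' u' n' G h'
        obtain ⟨u₄, n₅, s₄, n₆, h13, h14, h15, h16⟩ := h4 η' u₃ n₃ G h9
        refine ⟨u₄, n₅, s₄ + s₃, n₆ + n₄, h13, ?_, ?_, by rw [h12, h16]; abel⟩
        · exact Net.segment_gen_trans h14 h10
        · rw [List.length_cons, add_mul]; omega

/-- `η` solves the relational constraints with index in `J`, the automata `P x` read its values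
with weights `u x` along `n x` edges, and the total weight plus `b` is nonnegative. -/
structure IsSol (S : Skeleton) (J : Finset (Fin S.length)) (T : Fin S.length → PTrans k)
    (P : ℕ → WNet k (Fin m → ℤ)) (X : Finset ℕ) (b : Fin m → ℤ) (η : Interpretation k)
    (u : ℕ → Fin m → ℤ) (n : ℕ → ℕ) : Prop where
  gen : ∀ x ∈ X, (P x).Gen (η x) (u x) (n x)
  rel : ∀ j ∈ J, (T j).PRel (termValue η (S.side j false)) (termValue η (S.side j true))
  nonneg : ∀ i, 0 ≤ b i + ∑ x ∈ X, u x i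

/-- Solvable problems with the constraints in `J` have solutions whose size is bounded by a
primitive recursive function of the size of the problem. -/
def SmallModel (S : Skeleton) (J : Finset (Fin S.length)) : Prop :=
  ∃ g : ℕ → ℕ → ℕ, Primrec₂ g ∧ ∀ (k m B : ℕ) (T : Fin S.length → PTrans k)
    (P : ℕ → WNet k (Fin m → ℤ)) (X : Finset ℕ) (b : Fin m → ℤ) (η : Interpretation k)
    (u : ℕ → Fin m → ℤ) (n : ℕ → ℕ), (∀ j, Nat.card (T j).Q ≤ B) → (∀ x ∈ X, (P x).Bdd B) →
    X.card ≤ B → (∀ i, |b i| ≤ B) → (∀ j ∈ J, ∀ β, ∀ x ∈ S.side j β, x ∈ X) →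
    IsSol S J T P X b η u n →
    ∃ η' u' n', IsSol S J T P X b η' u' n' ∧ ∀ x ∈ X, n' x ≤ g m B

/-- Side `β` of constraint `c` consists of pairwise distinct variables that occur nowhere else in
the constraints with index in `J`. Unless it is empty, the other side is not empty either. -/
structure Fresh (S : Skeleton) (J : Finset (Fin S.length)) (c : Fin S.length) (β : Bool) :
    Prop where
  mem : c ∈ J
  nodup : (S.side c β).Nodup
  other : ∀ x ∈ S.side c β, x ∉ S.side c !β
  elsewhere : ∀ x ∈ S.side c β, ∀ c' ∈ J, c' ≠ c → ∀ β', x ∉ S.side c' β'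
  empty : S.side c (!β) ≠ [] ∨ S.side c β = []

theorem orient_side (S : Skeleton) (c : Fin S.length) (β : Bool) (η : Interpretation k) :
    orient _ β (termValue η (S.side c false), termValue η (S.side c true)) =
      (termValue η (S.side c !β), termValue η (S.side c β)) := by
  cases β <;> rfl

theorem zeroSumBound_primrec : Primrec₂ zeroSumBound := by
  have hstep : Primrec zeroSumStep := by
    have h1 : Primrec fun p : ℕ × ℕ => 2 * p.1 + 1 :=
      Primrec.succ.comp (Primrec.nat_mul.comp (Primrec.const 2) Primrec.fst)
    exact (Primrec.nat_mul.comp h1 Primrec.fst).pair (Primrec.nat_mul.comp h1 Primrec.snd)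
  refine (Primrec.snd.comp (Primrec.nat_iterate (f := fun p : ℕ × ℕ => p.1)
    (g := fun p : ℕ × ℕ => (p.2, 1)) (h := fun _ q => zeroSumStep q) Primrec.fst
    (Primrec.snd.pair (Primrec.const 1)) (hstep.comp₂ Primrec₂.right))).to₂

theorem vectorBound_primrec : Primrec vectorBound := by
  have h : Primrec fun B : ℕ => B * B := Primrec.nat_mul.comp Primrec.id Primrec.id
  exact Primrec.succ.comp (Primrec.nat_add.comp (Primrec.nat_add.comp Primrec.id
    (Primrec.nat_mul.comp Primrec.id (Primrec.nat_mul.comp h Primrec.id))) h)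

theorem prodBound_primrec : Primrec prodBound :=
  Primrec.nat_add.comp (Primrec.nat_mul.comp Primrec.id Primrec.id)
    (Primrec.nat_mul.comp (Primrec.const 2) Primrec.id)

theorem smallModel_empty (S : Skeleton) : SmallModel S ∅ := by
  refine ⟨fun m B => B * B + B * zeroSumBound m (vectorBound B), ?_, ?_⟩
  · have h : Primrec fun p : ℕ × ℕ => p.2 * p.2 := Primrec.nat_mul.comp Primrec.snd Primrec.snd
    exact (Primrec.nat_add.comp h (Primrec.nat_mul.comp Primrec.snd
      (zeroSumBound_primrec.comp Primrec.fst (vectorBound_primrec.comp Primrec.snd)))).to₂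
  · intro k m B T P X b η u n _ hP hX hb _ hsol
    obtain ⟨η', u', n', h1, h2⟩ := exists_small_family hP hX hb hsol.gen hsol.nonneg
    exact ⟨η', u', n', ⟨fun x hx => (h1 x hx).1, by simp, h2⟩, fun x hx => (h1 x hx).2⟩

/-- A constraint one side of which is fresh can be eliminated: composing its transducer with the
automata of the fresh variables gives a weighted automaton for the other side. -/
theorem SmallModel.of_erase {S : Skeleton} {J : Finset (Fin S.length)} {c : Fin S.length}
    {β : Bool} (hf : Fresh S J c β) (h : SmallModel S (J.erase c)) : SmallModel S J := by
  obtain ⟨g, hg, hmain⟩ := h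
  have hcJ := hf.mem
  set t := S.side c !β with ht
  set ys := S.side c β with hys
  let C : ℕ → ℕ := fun B => B * (ys.length * B + 1) + B
  have hC : ∀ B, B ≤ C B := fun B => Nat.le_add_left _ _
  refine ⟨fun m B => (t.length + 1) * g m (prodBound^[t.length] (C B)), ?_, ?_⟩
  · have h1 : Primrec fun B => prodBound^[t.length] (C B) :=
      Primrec.nat_iterate (Primrec.const _) (Primrec.nat_add.comp (Primrec.nat_mul.comp Primrec.id
        (Primrec.succ.comp (Primrec.nat_mul.comp (Primrec.const _) Primrec.id))) Primrec.id)
        (prodBound_primrec.comp₂ Primrec₂.right)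
    exact (Primrec.nat_mul.comp (Primrec.const _)
      (hg.comp Primrec.fst (h1.comp Primrec.snd))).to₂
  intro k m B T P X b η u n hT hP hX hb hJX hsol
  have hB' : B ≤ prodBound^[t.length] (C B) := (hC B).trans (le_prodBound_iterate _ _)
  obtain ⟨B', hB'def⟩ : ∃ B', B' = prodBound^[t.length] (C B) := ⟨_, rfl⟩
  simp only [← hB'def] at hB' ⊢
  have hT' : ∀ j, Nat.card (T j).Q ≤ B' := fun j => (hT j).trans hB'
  have hb' : ∀ i, |b i| ≤ B' := fun i => (hb i).trans (by exact_mod_cast hB')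
  have hrel := hsol.rel c hcJ
  by_cases hte : t = []
  · have hye : ys = [] := hf.empty.resolve_left (by simpa using hte)
    obtain ⟨η', u', n', h1, h2⟩ := hmain k m B' T P X b η u n hT'
      (fun x hx => (hP x hx).mono hB') (hX.trans hB') hb'
      (fun j hj => hJX j (Finset.mem_of_mem_erase hj))
      ⟨hsol.gen, fun j hj => hsol.rel j (Finset.mem_of_mem_erase hj), hsol.nonneg⟩
    refine ⟨η', u', n', ⟨h1.gen, fun j hj => ?_, h1.nonneg⟩, fun x hx => (h2 x hx).trans ?_⟩
    · by_cases hjc : j = c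
      · subst hjc
        have : ∀ β', S.side j β' = [] := by
          intro β'
          by_cases h : β' = β
          · rw [h]; exact hye
          · obtain rfl : β' = !β := Bool.eq_not.2 h
            exact hte
        rw [this, this] at hrel ⊢
        exact hrel
      · exact h1.rel j (Finset.mem_erase.2 ⟨hjc, hj⟩)
    · exact Nat.le_mul_of_pos_left _ (by omega)
  -- the automaton `D` reads the words that the constraint relates to values of the fresh variables
  let D : WNet k (Fin m → ℤ) := Net.comp ((T c).toWTrans β) (chainNet P ys)
  have hysX : ∀ y ∈ ys, y ∈ X := hJX c hcJ β
  have hDB : D.Bdd (C B) := comp_bdd (hT c) (chainNet_bdd fun y hy => hP y (hysX y hy))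
  obtain ⟨n₁, hn₁⟩ := chainNet_gen fun y hy => hsol.gen y (hysX y hy)
  have hTrel : ((T c).toWTrans (m := m) β).Rel (termValue η t) (termValue η ys) 0 := by
    have := (Net.toWTrans_rel (b := β) (m := m) (v := 0)
      (p := (termValue η (S.side c false), termValue η (S.side c true)))).2 ⟨rfl, hrel⟩
    rwa [orient_side] at this
  obtain ⟨nD, hnD⟩ := Net.comp_gen hTrel hn₁
  let X' : Finset ℕ := X \ ys.toFinset
  have hX'X : X' ⊆ X := Finset.sdiff_subset
  have hnot : ∀ x ∈ X', x ∉ ys := fun x hx => by simpa using (Finset.mem_sdiff.1 hx).2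
  have htX' : ∀ x ∈ t, x ∈ X' := fun x hx =>
    Finset.mem_sdiff.2 ⟨hJX c hcJ _ x hx, by simpa using fun h => hf.other x h hx⟩
  have hsumX : ∀ f : ℕ → Fin m → ℤ, ∑ x ∈ X, f x = ∑ x ∈ X', f x + (ys.map f).sum := by
    intro f
    rw [← Finset.sum_sdiff (s₁ := ys.toFinset) (s₂ := X)
      (fun y hy => hysX y (by simpa using hy)), List.sum_toFinset f hf.nodup]
  obtain ⟨P', u', n', h1, h2, h3, h4⟩ := attach D X' D.final t hte htX' D.init P
    (fun y hy => hsol.gen y (hX'X hy)) hnD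
  have hsol' : IsSol S (J.erase c) T P' X' b η u' n' := by
    refine ⟨h1, fun j hj => hsol.rel j (Finset.mem_of_mem_erase hj), fun i => ?_⟩
    have h5 := hsol.nonneg i
    rw [← Finset.sum_apply] at h5 ⊢
    rwa [h2, zero_add, ← hsumX]
  have hJX' : ∀ j ∈ J.erase c, ∀ β', ∀ x ∈ S.side j β', x ∈ X' := by
    intro j hj β' x hx
    rw [Finset.mem_erase] at hj
    refine Finset.mem_sdiff.2 ⟨hJX j hj.2 β' x hx, ?_⟩
    simpa using fun h => hf.elsewhere x h j hj.2 hj.1 β' hx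
  obtain ⟨η₁, u₁, n₂, h6, h7⟩ := hmain k m B' T P' X' b η u' n' hT'
    (hB'def ▸ h3 (C B) (fun y hy => (hP y (hX'X hy)).mono (hC B)) hDB)
    ((Finset.card_le_card hX'X).trans (hX.trans hB')) hb' hJX' hsol'
  obtain ⟨u₃, n₃, s₃, n₄, h8, h9, h10, h11⟩ := h4 η₁ u₁ n₂ (g m B') fun y hy =>
    ⟨h6.gen y hy, h7 y hy⟩
  obtain ⟨w, v₁, v₂, n₅, hv, hn₅, h12, h13⟩ := Net.comp_gen_inv (show D.Gen _ _ _ from h9)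
  obtain ⟨ηy, uy, ny, h14, rfl, rfl⟩ := chainNet_gen_inv hf.nodup h13
  let η₂ : Interpretation k := fun x => if x ∈ ys then ηy x else η₁ x
  let u₂ : ℕ → Fin m → ℤ := fun x => if x ∈ ys then uy x else u₃ x
  let n₆ : ℕ → ℕ := fun x => if x ∈ ys then ny x else n₃ x
  have hη₂ : ∀ t' : Term, (∀ x ∈ t', x ∉ ys) → termValue η₂ t' = termValue η₁ t' := fun t' h =>
    termValue_congr fun x hx => if_neg (h x hx)
  have hη₂ys : termValue η₂ ys = termValue ηy ys := termValue_congr fun x hx => if_pos hx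
  have hη₂t : termValue η₂ t = termValue η₁ t := hη₂ t fun x hx h => hf.other x h hx
  have hv₁ : v₁ = 0 ∧ (T c).PRel (termValue η₂ (S.side c false)) (termValue η₂ (S.side c true)) := by
    refine (Net.toWTrans_rel (b := β) (p := (termValue η₂ (S.side c false),
      termValue η₂ (S.side c true)))).1 ?_
    rw [orient_side, ← ht, ← hys, hη₂t, hη₂ys]
    exact h12
  refine ⟨η₂, u₂, n₆, ⟨?_, ?_, ?_⟩, ?_⟩
  · intro x hx
    by_cases hxy : x ∈ ys
    · simpa [η₂, u₂, n₆, hxy] using (h14 x hxy).1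
    · simpa [η₂, u₂, n₆, hxy] using
        (h8 x (Finset.mem_sdiff.2 ⟨hx, by simpa using hxy⟩)).1
  · intro j hj
    by_cases hjc : j = c
    · subst hjc; exact hv₁.2
    · have : ∀ β', termValue η₂ (S.side j β') = termValue η₁ (S.side j β') := fun β' =>
        hη₂ _ fun x hx h => hf.elsewhere x h j hj hjc β' hx
      rw [this, this]
      exact h6.rel j (Finset.mem_erase.2 ⟨hjc, hj⟩)
  · intro i
    have h15 := h6.nonneg i
    rw [← Finset.sum_apply] at h15 ⊢
    rw [h11, hv, hv₁.1, zero_add] at h15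
    have h16 : ∑ x ∈ X, u₂ x = ∑ x ∈ X', u₃ x + (ys.map uy).sum := by
      rw [hsumX u₂]
      congr 1
      · exact Finset.sum_congr rfl fun x hx => if_neg (hnot x hx)
      · congr 1
        exact List.map_congr_left fun x hx => if_pos hx
    rwa [h16]
  · intro x hx
    have hg' : g m B' ≤ (t.length + 1) * g m B' := Nat.le_mul_of_pos_left _ (by omega)
    by_cases hxy : x ∈ ys
    · simp only [n₆, hxy, if_true]
      refine (h14 x hxy).2.trans (hn₅.trans (h10.trans ?_))
      exact Nat.mul_le_mul_right _ (by omega)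
    · simp only [n₆, hxy, if_false]
      exact (h8 x (Finset.mem_sdiff.2 ⟨hx, by simpa using hxy⟩)).2.trans hg'

end Elimination

/-! ### Chain-free skeletons have an elimination order -/

/-- If no side of a nonempty set of constraints is fresh, following the splitting graph backwards
produces a chain. -/
theorem exists_fresh {S : Skeleton} (hS : ¬ S.HasChain) {J : Finset (Fin S.length)}
    (hJ : J.Nonempty) : ∃ c β, Fresh S J c β := by
  by_contra! hcon
  apply hS
  have hne : ∀ c ∈ J, ∀ β, S.side c β ≠ [] := by
    intro c hc β h
    exact hcon c β ⟨hc, by simp [h], by simp [h], by simp [h], .inr h⟩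
  have hpred : ∀ c ∈ J, ∀ β, ∃ p' p'' : Position S, p'.con = c ∧ p'.right = β ∧ p''.con ∈ J ∧
      p'' ≠ p' ∧ p''.var = p'.var := by
    intro c hc β
    by_contra! hno
    refine hcon c β ⟨hc, ?_, ?_, ?_, .inl (hne c hc _)⟩
    · rw [List.nodup_iff_injective_get]
      intro i j hij
      by_contra hne'
      refine hno ⟨c, β, i⟩ ⟨c, β, j⟩ rfl rfl hc ?_ hij.symm
      intro h
      simp only [Position.mk.injEq, heq_eq_eq, true_and] at h
      exact hne' h.symm
    · intro x hx hx'
      obtain ⟨i, rfl⟩ := List.mem_iff_get.1 hx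
      obtain ⟨j, hj⟩ := List.mem_iff_get.1 hx'
      refine hno ⟨c, β, i⟩ ⟨c, !β, j⟩ rfl rfl hc ?_ hj
      intro h
      have := congrArg Position.right h
      simp at this
    · intro x hx c' hc' hcc' β' hx'
      obtain ⟨i, rfl⟩ := List.mem_iff_get.1 hx
      obtain ⟨j, hj⟩ := List.mem_iff_get.1 hx'
      refine hno ⟨c, β, i⟩ ⟨c', β', j⟩ rfl rfl hc' ?_ hj
      intro h
      exact hcc' (congrArg Position.con h)
  -- every side of a constraint in `J` contains a position with a predecessor in another such side
  have hstep : ∀ s : {c // c ∈ J} × Bool, ∃ (p' : Position S) (s' : {c // c ∈ J} × Bool),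
      p'.con = s.1 ∧ p'.right = s.2 ∧
      ∀ p : Position S, p.con = s'.1 → p.right = s'.2 → S.splittingGraph.Adj p p' := by
    rintro ⟨⟨c, hc⟩, β⟩
    obtain ⟨p', p'', h1, h2, h3, h4, h5⟩ := hpred c hc β
    refine ⟨p', ⟨⟨p''.con, h3⟩, !p''.right⟩, h1, h2, fun p hp hp' => ⟨p'', h4, ⟨hp, ?_⟩, h5⟩⟩
    simp only at hp'
    simp [hp']
  choose pos prev hpos₁ hpos₂ hadj using hstep
  obtain ⟨c₀, hc₀⟩ := hJ
  let s : ℕ → {c // c ∈ J} × Bool := fun n => prev^[n] (⟨c₀, hc₀⟩, true)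
  have hs : ∀ n, s (n + 1) = prev (s n) := fun n => Function.iterate_succ_apply' _ _ _
  have hedge : ∀ n, S.splittingGraph.Adj (pos (s (n + 1))) (pos (s n)) := by
    intro n
    refine hadj (s n) _ ?_ ?_
    · rw [hpos₁, hs]
    · rw [hpos₂, hs]
  obtain ⟨a, b, hab, heq⟩ := Finite.exists_ne_map_eq_of_infinite s
  wlog hlt : a < b generalizing a b
  · exact this b a hab.symm heq.symm (by omega)
  refine ⟨b - a - 1, fun i => pos (s (b - i)), fun i => ?_⟩
  have hi := i.2
  by_cases hlast : i = Fin.last _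
  · subst hlast
    have h1 : b - (b - a - 1) = a + 1 := by omega
    simp only [Fin.last_add_one, Fin.val_last, Fin.val_zero, Nat.sub_zero, h1, ← heq]
    exact hedge a
  · have h1 : ((i + 1 : Fin (b - a - 1 + 1)) : ℕ) = i + 1 :=
      Fin.val_add_one_of_lt (Fin.lt_last_iff_ne_last.2 hlast)
    simp only [h1]
    have h2 : b - (i : ℕ) = (b - (i + 1)) + 1 := by
      have : (i : ℕ) ≠ b - a - 1 := fun h => hlast (Fin.ext h)
      omega
    rw [h2]
    exact hedge _

/-- Without a chain the constraints can be eliminated one by one. -/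
theorem smallModel_of_chainFree {S : Skeleton} (hS : ¬ S.HasChain) (J : Finset (Fin S.length)) :
    SmallModel S J := by
  induction J using Finset.strongInduction with
  | _ J ih =>
  rcases J.eq_empty_or_nonempty with rfl | hJ
  · exact smallModel_empty S
  · obtain ⟨c, β, hf⟩ := exists_fresh hS hJ
    exact .of_erase hf (ih _ (Finset.erase_ssubset hf.mem))

/-! ### Conjunctive formulae as families of weighted automata -/

section TypeNet

variable {k : ℕ} {V : Type} [AddCommMonoid V] {M : Type} [Finite M]

/-- The deterministic automaton that computes a right-invariant map `φ` into a finite set; every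
letter has weight `wt`, and the words of type `s` are accepted. -/
@[simps] def typeNet (φ : Word k → M) (wt : V) (s : M) : WNet k V where
  Q := M
  finite := inferInstance
  step p a p' := ∃ b w, a = (some b, wt) ∧ φ w = p ∧ φ (w ++ [b]) = p'
  init := φ []
  final := s

theorem typeNet_gen (φ : Word k → M) (wt : V) (w : Word k) :
    (typeNet φ wt (φ w)).Gen w (w.length • wt) w.length := by
  refine ⟨w.map fun a => (some a, wt), ?_, ?_, ?_, by simp⟩
  · have key : ∀ u v : Word k, Path (typeNet φ wt (φ w)).step (φ u)
        (v.map fun a => (some a, wt)) (φ (u ++ v)) := by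
      intro u v
      induction v generalizing u with
      | nil => exact congrArg φ (List.append_nil u).symm
      | cons a v ih =>
        refine ⟨φ (u ++ [a]), ⟨a, u, rfl, rfl, rfl⟩, ?_⟩
        simpa using ih (u ++ [a])
    exact key [] w
  · induction w with
    | nil => rfl
    | cons a w ih => simpa using ih
  · simp [weightOf, Function.comp_def]

/-- The words generated by `typeNet φ wt s` have type `s`, provided that `φ` is a right
congruence. -/
theorem typeNet_gen_inv {φ : Word k → M}
    (hφ : ∀ w w' a, φ w = φ w' → φ (w ++ [a]) = φ (w' ++ [a])) {wt : V} {s : M} {w : Word k}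
    {v : V} {n : ℕ} (h : (typeNet φ wt s).Gen w v n) :
    φ w = s ∧ v = w.length • wt ∧ n = w.length := by
  obtain ⟨l, h1, rfl, rfl, rfl⟩ := h
  have key : ∀ (u : Word k) (l : List (Option (Fin k) × V)),
      Path (typeNet φ wt s).step (φ u) l s → φ (u ++ wordOf l) = s ∧
        weightOf l = (wordOf l).length • wt ∧ l.length = (wordOf l).length := by
    intro u l
    induction l generalizing u with
    | nil =>
      intro h
      exact ⟨(congrArg φ (List.append_nil u)).trans h, by simp, rfl⟩
    | cons a l ih =>
      rintro ⟨r, ⟨b, w, rfl, h2, rfl⟩, h3⟩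
      rw [hφ w u b h2] at h3
      obtain ⟨h4, h5, h6⟩ := ih _ h3
      refine ⟨by simpa using h4, ?_, by simp [h6]⟩
      simp only [weightOf_cons, h5, wordOf_cons_some, List.length_cons, succ_nsmul']
  exact key [] l h1

end TypeNet

/-- The number `E` bounds the lengths of all lists in `Φ`, the absolute values of all coefficients,
and, strictly, all states and variables. -/
structure ConjFormula.SizeLE {k : ℕ} (Φ : ConjFormula k) (E : ℕ) : Prop where
  rel_var : ∀ c ∈ Φ.rels, (∀ x ∈ c.1, x < E) ∧ ∀ x ∈ c.2.2, x < E
  rel_state : ∀ c ∈ Φ.rels, (∀ q ∈ c.2.1.init, q < E) ∧ ∀ t ∈ c.2.1.trans, t.2.2 < E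
  mem_length : Φ.mems.length ≤ E
  mem_var : ∀ c ∈ Φ.mems, ∀ x ∈ c.2.1, x < E
  mem_state : ∀ c ∈ Φ.mems, (∀ q ∈ c.2.2.init, q < E) ∧ (∀ q ∈ c.2.2.final, q < E) ∧
    ∀ t ∈ c.2.2.trans, t.2.2 < E
  len_term : ∀ c ∈ Φ.lens, ∀ s, s = c.2.1 ∨ s = c.2.2 → s.1.length ≤ E ∧ |s.2| ≤ E ∧
    ∀ ct ∈ s.1, |ct.1| ≤ E ∧ ct.2.length ≤ E ∧ ∀ x ∈ ct.2, x < E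

section Runs

variable {A : Type} {E : ℕ}

/-- The restriction of an automaton to states smaller than `E`. -/
@[simps] def Automaton.toNet (M : Automaton A) (q q' : Fin E) : Net A where
  Q := Fin E
  finite := inferInstance
  step q a q' := (q.1, a, q'.1) ∈ M.trans
  init := q
  final := q'

theorem Automaton.run_lt {M : Automaton A} (hM : ∀ t ∈ M.trans, t.2.2 < E) {q q' : ℕ} (hq : q < E)
    {l : List A} (h : M.Run q l q') : q' < E := by
  induction h with
  | nil => exact hq
  | cons h1 _ ih => exact ih (hM _ h1)

theorem Automaton.toNet_acc {M : Automaton A} (hM : ∀ t ∈ M.trans, t.2.2 < E) {q q' : Fin E}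
    {l : List A} : (M.toNet q q').Acc l ↔ M.Run q l q' := by
  rw [Automaton.run_iff_path]
  constructor
  · intro h
    simpa using Path.map (fun q : Fin E => q.1) id
      (step' := fun q a q' => (q, a, q') ∈ M.trans) (fun _ _ _ h => h) h
  · intro h
    change Path (M.toNet q q').step q l q'
    generalize q' = p' at h
    induction l generalizing q with
    | nil => exact Fin.ext h
    | cons a l ih =>
      obtain ⟨r, h1, h2⟩ := h
      have hr : r < E := hM _ h1
      exact ⟨⟨r, hr⟩, h1, ih (q := ⟨r, hr⟩) h2⟩

end Runs

section Types

variable {k : ℕ} {E : ℕ}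

/-- The pairs of states smaller than `E` of the automata in the list that are connected by a run
with label `w`. -/
def typeOf (L : List (FA k)) (E : ℕ) (w : Word k) (c : Fin L.length) (q q' : Fin E) : Prop :=
  ∃ l, (L.get c).Run q l q' ∧ w = l.reduceOption

theorem typeOf_append {L : List (FA k)} (hL : ∀ M ∈ L, ∀ t ∈ M.trans, t.2.2 < E)
    (u v : Word k) (c : Fin L.length) (q q' : Fin E) :
    typeOf L E (u ++ v) c q q' ↔ ∃ r, typeOf L E u c q r ∧ typeOf L E v c r q' := by
  have hc := hL _ (List.get_mem L c)
  constructor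
  · rintro ⟨l, h1, h2⟩
    obtain ⟨l₁, l₂, rfl, rfl, rfl⟩ := List.reduceOption_eq_append_iff _ _ _ |>.1 h2.symm
    obtain ⟨r, h3, h4⟩ := path_append.1 ((Automaton.run_iff_path _).1 h1)
    rw [← Automaton.run_iff_path] at h3 h4
    exact ⟨⟨r, Automaton.run_lt hc q.2 h3⟩, ⟨l₁, h3, rfl⟩, ⟨l₂, h4, rfl⟩⟩
  · rintro ⟨r, ⟨l₁, h1, rfl⟩, ⟨l₂, h2, rfl⟩⟩
    refine ⟨l₁ ++ l₂, ?_, (List.reduceOption_append _ _).symm⟩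
    rw [Automaton.run_iff_path] at h1 h2 ⊢
    exact h1.append h2

theorem typeOf_append_congr {L : List (FA k)} (hL : ∀ M ∈ L, ∀ t ∈ M.trans, t.2.2 < E)
    {u u' v v' : Word k} (h : typeOf L E u = typeOf L E u') (h' : typeOf L E v = typeOf L E v') :
    typeOf L E (u ++ v) = typeOf L E (u' ++ v') := by
  ext c q q'
  rw [typeOf_append hL, typeOf_append hL, h, h']

theorem typeOf_termValue_congr {L : List (FA k)} (hL : ∀ M ∈ L, ∀ t ∈ M.trans, t.2.2 < E)
    {η η' : Interpretation k} {t : Term} (h : ∀ x ∈ t, typeOf L E (η x) = typeOf L E (η' x)) :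
    typeOf L E (termValue η t) = typeOf L E (termValue η' t) := by
  induction t with
  | nil => rfl
  | cons x t ih =>
    exact typeOf_append_congr hL (h x (by simp)) (ih fun y hy => h y (by simp [hy]))

theorem mem_language_iff_typeOf {L : List (FA k)} {c : Fin L.length} {w : Word k}
    (hi : ∀ q ∈ (L.get c).init, q < E) (hf : ∀ q ∈ (L.get c).final, q < E) :
    w ∈ FA.language (L.get c) ↔ ∃ q q' : Fin E, q.1 ∈ (L.get c).init ∧ q'.1 ∈ (L.get c).final ∧
      typeOf L E w c q q' := by
  constructor
  · rintro ⟨l, ⟨q, hq, q', hq', h⟩, hw⟩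
    exact ⟨⟨q, hi q hq⟩, ⟨q', hf q' hq'⟩, hq, hq', l, h, hw⟩
  · rintro ⟨q, q', hq, hq', l, h, hw⟩
    exact ⟨l, ⟨q, hq, q', hq', h⟩, hw⟩

theorem card_types (r E : ℕ) :
    Nat.card (Fin r → Fin E → Fin E → Prop) = 2 ^ (E * E * r) := by
  simp [Nat.card_eq_fintype_card, ← pow_mul]

end Types

section Lengths

variable {k : ℕ} {E : ℕ}

/-- The coefficient of the length of the variable `x` in a length term. -/
def coeff (s : LengthTerm) (x : ℕ) : ℤ := (s.1.map fun ct => ct.1 * (ct.2.count x : ℤ)).sum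

theorem length_termValue (η : Interpretation k) {t : Term} (ht : ∀ x ∈ t, x < E) :
    ((termValue η t).length : ℤ) = ∑ x ∈ Finset.range E, (t.count x : ℤ) * (η x).length := by
  induction t with
  | nil => simp [termValue]
  | cons y t ih =>
    rw [termValue_cons, List.length_append, Nat.cast_add, ih fun x hx => ht x (by simp [hx])]
    have : ∀ x, ((y :: t).count x : ℤ) * (η x).length =
        (if x = y then ((η x).length : ℤ) else 0) + (t.count x : ℤ) * (η x).length := by
      intro x
      rw [List.count_cons]
      by_cases h : y = x
      · subst h; simp; ring
      · simp [h, Ne.symm h]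
    simp only [this, Finset.sum_add_distrib]
    simp [ht y (by simp)]

theorem lengthValue_eq (η : Interpretation k) (s : LengthTerm)
    (hs : ∀ ct ∈ s.1, ∀ x ∈ ct.2, x < E) :
    lengthValue η s = ∑ x ∈ Finset.range E, coeff s x * (η x).length + s.2 := by
  obtain ⟨l, d⟩ := s
  simp only [lengthValue, coeff] at hs ⊢
  congr 1
  induction l with
  | nil => simp
  | cons ct l ih =>
    simp only [List.map_cons, List.sum_cons, add_mul, Finset.sum_add_distrib]
    rw [ih fun c hc => hs c (by simp [hc]), length_termValue η (hs ct (by simp)), Finset.mul_sum]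
    congr 1
    exact Finset.sum_congr rfl fun x _ => by ring

theorem abs_coeff_le {s : LengthTerm} (h1 : s.1.length ≤ E)
    (h2 : ∀ ct ∈ s.1, |ct.1| ≤ E ∧ ct.2.length ≤ E) (x : ℕ) : |coeff s x| ≤ (E * E * E : ℕ) := by
  obtain ⟨l, d⟩ := s
  simp only [coeff] at *
  have key : |(l.map fun ct => ct.1 * (ct.2.count x : ℤ)).sum| ≤ l.length * (E * E) := by
    clear h1
    induction l with
    | nil => simp
    | cons ct l ih =>
      obtain ⟨h3, h4⟩ := h2 ct (by simp)
      have h5 := ih fun c hc => h2 c (by simp [hc])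
      have h6 : |ct.1 * (ct.2.count x : ℤ)| ≤ E * E := by
        rw [abs_mul, Nat.abs_cast]
        have : (ct.2.count x : ℤ) ≤ E := by exact_mod_cast List.count_le_length.trans h4
        gcongr
      simp only [List.map_cons, List.sum_cons, List.length_cons, Nat.cast_add, Nat.cast_one]
      refine (abs_add_le _ _).trans ?_
      linarith
  refine key.trans ?_
  rw [mul_assoc]
  push_cast
  gcongr

/-- The contribution of each letter of the value of `x` to the slack of a length constraint. -/
def slackCoeff (c : Bool × LengthTerm × LengthTerm) (x : ℕ) : ℤ :=
  if c.1 then coeff c.2.2 x - coeff c.2.1 x else coeff c.2.1 x - coeff c.2.2 x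

/-- The constant part of the slack of a length constraint. -/
def slackConst (c : Bool × LengthTerm × LengthTerm) : ℤ :=
  if c.1 then c.2.2.2 - c.2.1.2 else c.2.1.2 - c.2.2.2 - 1

theorem len_iff_slack (η : Interpretation k) (c : Bool × LengthTerm × LengthTerm)
    (hc : ∀ s, s = c.2.1 ∨ s = c.2.2 → ∀ ct ∈ s.1, ∀ x ∈ ct.2, x < E) :
    (c.1 = true ↔ lengthValue η c.2.1 ≤ lengthValue η c.2.2) ↔
      0 ≤ slackConst c + ∑ x ∈ Finset.range E, slackCoeff c x * (η x).length := by
  rw [lengthValue_eq η c.2.1 (hc _ (.inl rfl)), lengthValue_eq η c.2.2 (hc _ (.inr rfl))]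
  obtain ⟨_ | _, s, s'⟩ := c
  · simp only [slackConst, slackCoeff, Bool.false_eq_true, if_false, false_iff, sub_mul,
      Finset.sum_sub_distrib]
    omega
  · simp only [slackConst, slackCoeff, if_true, true_iff, sub_mul, Finset.sum_sub_distrib]
    omega

end Lengths

/-- A bound for the automata of a formula of size `E`. -/
def formulaBound (E : ℕ) : ℕ := 2 ^ (E * E * E) + 2 * (E * E * E) + 2 * E + 1

theorem formulaBound_primrec : Primrec formulaBound := by
  have h : Primrec fun E : ℕ => E * E * E :=
    Primrec.nat_mul.comp (Primrec.nat_mul.comp Primrec.id Primrec.id) Primrec.id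
  have h' : Primrec fun E : ℕ => 2 ^ (E * E * E) := by
    refine (Primrec.nat_iterate h (Primrec.const 1) (h := fun _ n => 2 * n)
      (Primrec.nat_mul.comp (Primrec.const 2) Primrec.snd).to₂).of_eq fun E => ?_
    simp
  exact Primrec.succ.comp (Primrec.nat_add.comp (Primrec.nat_add.comp h'
    (Primrec.nat_mul.comp (Primrec.const 2) h)) (Primrec.nat_mul.comp (Primrec.const 2) Primrec.id))

theorem le_formulaBound (E : ℕ) : 2 ^ (E * E * E) ≤ formulaBound E ∧
    E * E * E + E * E * E ≤ formulaBound E ∧ E + E + 1 ≤ formulaBound E := by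
  unfold formulaBound
  generalize 2 ^ (E * E * E) = p
  omega

theorem ConjFormula.skeleton_side {k : ℕ} (Φ : ConjFormula k) (j : Fin Φ.skeleton.length)
    (β : Bool) : Skeleton.side Φ.skeleton j β =
      bif β then (Φ.rels.get (j.cast (List.length_map _))).2.2
      else (Φ.rels.get (j.cast (List.length_map _))).1 := by
  have h : List.get Φ.skeleton j = ((Φ.rels.get (j.cast (List.length_map _))).1,
      (Φ.rels.get (j.cast (List.length_map _))).2.2) :=
    List.getElem_map (fun c : Term × Transducer k × Term => (c.1, c.2.2))
  cases β <;> simp only [Skeleton.side, h, cond_true, cond_false]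

/-- Satisfiable formulae with a given chain-free skeleton have small solutions. -/
theorem exists_small_model {S : Skeleton} (hS : ¬ S.HasChain) :
    ∃ g : ℕ → ℕ → ℕ, Primrec₂ g ∧ ∀ (k E : ℕ) (Φ : ConjFormula k), Φ.skeleton = S → Φ.SizeLE E →
      Φ.Satisfiable → ∃ η, ConjFormula.Models η Φ ∧ (∀ x, E ≤ x → η x = []) ∧
        ∀ x, (η x).length ≤ g Φ.lens.length E := by
  obtain ⟨g, hg, hmain⟩ := smallModel_of_chainFree hS Finset.univ
  refine ⟨fun m E => g m (formulaBound E),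
    (hg.comp Primrec.fst (formulaBound_primrec.comp Primrec.snd)).to₂, ?_⟩
  rintro k E Φ rfl hE ⟨η₀, hrel, hmem, hlen⟩
  let L : List (FA k) := Φ.mems.map fun c => c.2.2
  have hL : ∀ M ∈ L, ∀ t ∈ M.trans, t.2.2 < E := by
    intro M hM
    obtain ⟨c, hc, rfl⟩ := List.mem_map.1 hM
    exact (hE.mem_state c hc).2.2
  let wt : ℕ → Fin Φ.lens.length → ℤ := fun x i => slackCoeff (Φ.lens.get i) x
  let P : ℕ → WNet k (Fin Φ.lens.length → ℤ) := fun x =>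
    typeNet (typeOf L E) (wt x) (typeOf L E (η₀ x))
  have hφ : ∀ w w' a, typeOf L E w = typeOf L E w' → typeOf L E (w ++ [a]) = typeOf L E (w' ++ [a]) :=
    fun w w' a h => typeOf_append_congr hL h rfl
  have hskel : ∀ j : Fin Φ.skeleton.length, ∃ c ∈ Φ.rels,
      c.1 = Skeleton.side Φ.skeleton j false ∧ c.2.2 = Skeleton.side Φ.skeleton j true := by
    intro j
    obtain ⟨c, hc, hcj⟩ := List.mem_map.1 (List.get_mem Φ.skeleton j)
    exact ⟨c, hc, by simp only [Skeleton.side, ← hcj], by simp only [Skeleton.side, ← hcj]⟩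
  have hE0 : ∀ c ∈ Φ.lens, ∀ s, s = c.2.1 ∨ s = c.2.2 → ∀ ct ∈ s.1, ∀ x ∈ ct.2, x < E :=
    fun c hc s hs ct hct => ((hE.len_term c hc s hs).2.2 ct hct).2.2
  have hT : ∀ j : Fin Φ.skeleton.length, ∃ T : PTrans k, Nat.card T.Q ≤ E ∧
      T.PRel (termValue η₀ (Skeleton.side Φ.skeleton j false))
        (termValue η₀ (Skeleton.side Φ.skeleton j true)) ∧
      ∀ u w, T.PRel u w → (u, w) ∈ (Φ.rels.get (j.cast (List.length_map _))).2.1.relation := by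
    intro j
    have hc := List.get_mem Φ.rels (j.cast (List.length_map _))
    rw [Φ.skeleton_side, Φ.skeleton_side]
    generalize Φ.rels.get (j.cast (List.length_map _)) = c at *
    obtain ⟨l, ⟨q, hq, q', hq', hrun⟩, h1, h2⟩ := hrel c hc
    obtain ⟨h3, h4⟩ := hE.rel_state c hc
    have hq'E := Automaton.run_lt h4 (h3 q hq) hrun
    refine ⟨c.2.1.toNet ⟨q, h3 q hq⟩ ⟨q', hq'E⟩, by simp, ⟨l, (Automaton.toNet_acc h4).2 hrun,
      h1.symm, h2.symm⟩, ?_⟩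
    rintro u w ⟨l, h5, rfl, rfl⟩
    exact ⟨l, ⟨q, hq, q', hq', (Automaton.toNet_acc h4).1 h5⟩, rfl, rfl⟩
  choose T hTcard hTrel hTinv using hT
  obtain ⟨hB₁, hB₂, hB₃⟩ := le_formulaBound E
  have hEB : E ≤ formulaBound E := by omega
  have hX : (Finset.range E).card ≤ formulaBound E := by simpa using hEB
  have hgen : ∀ x ∈ Finset.range E, (P x).Gen (η₀ x) ((η₀ x).length • wt x) (η₀ x).length :=
    fun x _ => typeNet_gen _ _ _
  have hslack : ∀ (η : Interpretation k) (i : Fin Φ.lens.length),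
      slackConst (Φ.lens.get i) + ∑ x ∈ Finset.range E, ((η x).length • wt x) i =
        slackConst (Φ.lens.get i) + ∑ x ∈ Finset.range E,
          slackCoeff (Φ.lens.get i) x * (η x).length := by
    intro η i
    congr 1
    refine Finset.sum_congr rfl fun x _ => ?_
    simp [wt, mul_comm]
  obtain ⟨η, u, n, hsol, hn⟩ := hmain k Φ.lens.length (formulaBound E) T P (Finset.range E)
    (fun i => slackConst (Φ.lens.get i)) η₀ _ _ (fun j => (hTcard j).trans hEB) (by
      intro x _
      refine ⟨?_, ?_⟩
      · have h1 : Nat.card (P x).Q = 2 ^ (E * E * L.length) := card_types _ _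
        have h2 : L.length ≤ E := by simpa [L] using hE.mem_length
        have h3 : 2 ^ (E * E * L.length) ≤ 2 ^ (E * E * E) :=
          Nat.pow_le_pow_right (by norm_num) (Nat.mul_le_mul_left _ h2)
        rw [h1]
        exact h3.trans hB₁
      · rintro q a v q' ⟨b, w, h1, -, -⟩ i
        obtain rfl : v = wt x := congrArg Prod.snd h1
        have h2 := hE.len_term _ (List.get_mem Φ.lens i)
        have h3 := fun s hs => abs_coeff_le (h2 s hs).1
          (fun ct hct => ⟨((h2 s hs).2.2 ct hct).1, ((h2 s hs).2.2 ct hct).2.1⟩) x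
        have h4 := abs_le.1 (h3 _ (.inl rfl))
        have h5 := abs_le.1 (h3 _ (.inr rfl))
        have h6 : ((E * E * E : ℕ) : ℤ) + ((E * E * E : ℕ) : ℤ) ≤ (formulaBound E : ℕ) := by
          rw [← Nat.cast_add]
          exact Nat.cast_le.2 hB₂
        simp only [wt, slackCoeff]
        rw [abs_le]
        split_ifs <;> constructor <;> linarith) hX (by
      intro i
      have h2 := hE.len_term _ (List.get_mem Φ.lens i)
      have h4 := abs_le.1 (h2 _ (.inl rfl)).2.1
      have h5 := abs_le.1 (h2 _ (.inr rfl)).2.1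
      have h6 : (E : ℤ) + E + 1 ≤ (formulaBound E : ℕ) := by
        exact_mod_cast hB₃
      simp only [slackConst]
      rw [abs_le]
      split_ifs <;> constructor <;> linarith) (by
      intro j _ β x hx
      obtain ⟨c, hc, h1, h2⟩ := hskel j
      rw [Finset.mem_range]
      cases β
      · exact (hE.rel_var c hc).1 x (h1 ▸ hx)
      · exact (hE.rel_var c hc).2 x (h2 ▸ hx))
    ⟨hgen, fun j _ => hTrel j, fun i => by
      rw [hslack, ← len_iff_slack η₀ _ (hE0 _ (List.get_mem _ _))]
      exact hlen _ (List.get_mem _ _)⟩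
  let η' : Interpretation k := fun x => if x < E then η x else []
  have hinv : ∀ x, x < E → typeOf L E (η x) = typeOf L E (η₀ x) ∧ u x = (η x).length • wt x ∧
      n x = (η x).length := fun x hx =>
    typeNet_gen_inv hφ (hsol.gen x (Finset.mem_range.2 hx))
  have hη' : ∀ x, x < E → η' x = η x := fun x hx => if_pos hx
  have hval : ∀ t : Term, (∀ x ∈ t, x < E) → termValue η' t = termValue η t := fun t ht =>
    termValue_congr fun x hx => hη' x (ht x hx)
  refine ⟨η', ⟨?_, ?_, ?_⟩, fun x hx => if_neg (by omega), ?_⟩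
  · intro c hc
    obtain ⟨i, rfl⟩ := List.mem_iff_get.1 hc
    have h1 := hsol.rel (i.cast (List.length_map _).symm) (Finset.mem_univ _)
    have h2 := hTinv _ _ _ h1
    have h3 := hE.rel_var _ hc
    rw [hval _ h3.1, hval _ h3.2]
    rw [Φ.skeleton_side, Φ.skeleton_side] at h2
    exact h2
  · intro c hc
    rw [hmem c hc]
    obtain ⟨i, rfl⟩ := List.mem_iff_get.1 hc
    have hv := hE.mem_var _ hc
    obtain ⟨h1, h2, -⟩ := hE.mem_state _ hc
    have hget : L.get (i.cast (List.length_map _).symm) = (Φ.mems.get i).2.2 := by simp [L]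
    rw [hval _ hv, ← hget, mem_language_iff_typeOf (by rwa [hget]) (by rwa [hget]),
      mem_language_iff_typeOf (by rwa [hget]) (by rwa [hget]),
      typeOf_termValue_congr hL fun x hx => (hinv x (hv x hx)).1]
  · intro c hc
    have hc' := hc
    obtain ⟨i, rfl⟩ := List.mem_iff_get.1 hc
    rw [len_iff_slack η' _ (hE0 _ hc')]
    have h1 := hsol.nonneg i
    have h2 : ∑ x ∈ Finset.range E, u x i =
        ∑ x ∈ Finset.range E, slackCoeff (Φ.lens.get i) x * (η' x).length := by
      refine Finset.sum_congr rfl fun x hx => ?_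
      have hx := Finset.mem_range.1 hx
      rw [(hinv x hx).2.1, hη' x hx]
      simp [wt, mul_comm]
    rwa [h2] at h1
  · intro x
    by_cases hx : x < E
    · rw [hη' x hx, ← (hinv x hx).2.2]
      exact hn x (Finset.mem_range.2 hx)
    · simp [η', hx]

/-! ### The code of a formula bounds its size -/

section Size

variable {α β : Type} [Primcodable α] [Primcodable β]

/-- The code of an object, used as a measure of its size. -/
def codeSize (a : α) : ℕ := @Encodable.encode α Primcodable.toEncodable a

theorem codeSize_fst_le (p : α × β) : codeSize p.1 ≤ codeSize p := Nat.left_le_pair _ _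

theorem codeSize_snd_le (p : α × β) : codeSize p.2 ≤ codeSize p := Nat.right_le_pair _ _

theorem codeSize_lt_of_mem {a : α} {l : List α} (h : a ∈ l) : codeSize a < codeSize l := by
  induction l with
  | nil => simp at h
  | cons b l ih =>
    have hcons : codeSize (b :: l) = (Nat.pair (codeSize b) (codeSize l)).succ := rfl
    rw [hcons, Nat.lt_succ_iff]
    rcases List.mem_cons.1 h with rfl | h
    · exact Nat.left_le_pair _ _
    · exact (ih h).le.trans (Nat.right_le_pair _ _)

theorem length_le_codeSize (l : List α) : l.length ≤ codeSize l := Encodable.length_le_encode l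

theorem codeSize_int_natCast (n : ℕ) : codeSize (n : ℤ) = 2 * n := rfl

theorem codeSize_int_negSucc (n : ℕ) : codeSize (Int.negSucc n) = 2 * n + 1 := rfl

theorem abs_le_codeSize (z : ℤ) : |z| ≤ codeSize z := by
  obtain n | n := z
  · rw [Int.ofNat_eq_natCast, codeSize_int_natCast, Nat.abs_cast]
    push_cast; omega
  · rw [codeSize_int_negSucc, Int.negSucc_eq, abs_neg, abs_of_nonneg (by positivity)]
    push_cast; omega

theorem codeSize_automaton (M : Automaton α) :
    codeSize M.trans ≤ codeSize M ∧ codeSize M.init ≤ codeSize M ∧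
      codeSize M.final ≤ codeSize M := by
  have h : codeSize M = codeSize (M.trans, M.init, M.final) := rfl
  rw [h]
  have h1 := codeSize_fst_le (M.trans, M.init, M.final)
  have h2 := codeSize_snd_le (M.trans, M.init, M.final)
  exact ⟨h1, (codeSize_fst_le (M.init, M.final)).trans h2,
    (codeSize_snd_le (M.init, M.final)).trans h2⟩

theorem lt_codeSize_of_mem {x : ℕ} {l : List ℕ} (h : x ∈ l) : x < codeSize l :=
  codeSize_lt_of_mem h

theorem target_lt_codeSize {M : Automaton α} {t : ℕ × α × ℕ} (h : t ∈ M.trans) :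
    t.2.2 < codeSize M :=
  (codeSize_snd_le t.2).trans (codeSize_snd_le t) |>.trans_lt
    ((codeSize_lt_of_mem h).trans_le (codeSize_automaton M).1)

end Size

theorem ConjFormula.sizeLE_codeSize {k : ℕ} (Φ : ConjFormula k) : Φ.SizeLE (codeSize Φ) := by
  have h : codeSize Φ = codeSize (Φ.rels, Φ.mems, Φ.lens) := rfl
  have h1 : codeSize Φ.rels ≤ codeSize Φ := h ▸ codeSize_fst_le (Φ.rels, Φ.mems, Φ.lens)
  have h23 : codeSize (Φ.mems, Φ.lens) ≤ codeSize Φ :=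
    h ▸ codeSize_snd_le (Φ.rels, Φ.mems, Φ.lens)
  have h2 : codeSize Φ.mems ≤ codeSize Φ := (codeSize_fst_le (Φ.mems, Φ.lens)).trans h23
  have h3 : codeSize Φ.lens ≤ codeSize Φ := (codeSize_snd_le (Φ.mems, Φ.lens)).trans h23
  have hrel : ∀ c ∈ Φ.rels, codeSize c < codeSize Φ := fun c hc =>
    (codeSize_lt_of_mem hc).trans_le h1
  have hmem : ∀ c ∈ Φ.mems, codeSize c < codeSize Φ := fun c hc =>
    (codeSize_lt_of_mem hc).trans_le h2
  have hlen : ∀ c ∈ Φ.lens, codeSize c < codeSize Φ := fun c hc =>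
    (codeSize_lt_of_mem hc).trans_le h3
  refine ⟨?_, ?_, (length_le_codeSize _).trans h2, ?_, ?_, ?_⟩
  · intro c hc
    have hc1 := codeSize_fst_le c
    have hc2 := (codeSize_snd_le c.2).trans (codeSize_snd_le c)
    have := hrel c hc
    exact ⟨fun x hx => (lt_codeSize_of_mem hx).trans_le (by omega),
      fun x hx => (lt_codeSize_of_mem hx).trans_le (by omega)⟩
  · intro c hc
    have hc1 := (codeSize_fst_le c.2).trans (codeSize_snd_le c)
    have h4 := codeSize_automaton c.2.1
    have := hrel c hc
    exact ⟨fun q hq => (lt_codeSize_of_mem hq).trans_le (by omega),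
      fun t ht => (target_lt_codeSize ht).trans_le (by omega)⟩
  · intro c hc x hx
    have hc1 := (codeSize_fst_le c.2).trans (codeSize_snd_le c)
    have := hmem c hc
    exact (lt_codeSize_of_mem hx).trans_le (by omega)
  · intro c hc
    have hc1 := (codeSize_snd_le c.2).trans (codeSize_snd_le c)
    have h4 := codeSize_automaton c.2.2
    have := hmem c hc
    exact ⟨fun q hq => (lt_codeSize_of_mem hq).trans_le (by omega),
      fun q hq => (lt_codeSize_of_mem hq).trans_le (by omega),
      fun t ht => (target_lt_codeSize ht).trans_le (by omega)⟩
  · intro c hc s hs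
    have hc1 : codeSize s ≤ codeSize c := by
      rcases hs with rfl | rfl
      · exact (codeSize_fst_le c.2).trans (codeSize_snd_le c)
      · exact (codeSize_snd_le c.2).trans (codeSize_snd_le c)
    have h4 := hlen c hc
    have h5 := codeSize_fst_le s
    have h6 := codeSize_snd_le s
    refine ⟨(length_le_codeSize s.1).trans (by omega), (abs_le_codeSize s.2).trans (by
      exact_mod_cast (by omega : codeSize s.2 ≤ codeSize Φ)), fun ct hct => ?_⟩
    have h7 := codeSize_lt_of_mem hct
    have h8 := codeSize_fst_le ct
    have h9 := codeSize_snd_le ct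
    refine ⟨(abs_le_codeSize ct.1).trans (by
      exact_mod_cast (by omega : codeSize ct.1 ≤ codeSize Φ)),
      (length_le_codeSize ct.2).trans (by omega), fun x hx => ?_⟩
    exact (lt_codeSize_of_mem hx).trans_le (by omega)

/-! ### Deciding the relation of a transducer -/

section Decide

variable {k : ℕ}

/-- A configuration of a transducer: a state and what remains to be read on the two tapes. -/
abbrev TConfig (k : ℕ) := ℕ × Word k × Word k

/-- Read a letter or `ε` at the front of a word. -/
def consume (a : Option (Fin k)) (u : Word k) : Option (Word k) :=
  Option.casesOn a (some u) fun a => if u.head? = some a then some u.tail else none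

theorem consume_eq_some {a : Option (Fin k)} {u u' : Word k} :
    consume a u = some u' ↔ u = a.toList ++ u' := by
  cases a with
  | none => simp [consume]
  | some a =>
    cases u with
    | nil => simp [consume]
    | cons b u =>
      by_cases h : b = a <;> simp [consume, h]

/-- The configuration reached from `c` along the transition `t`, if `t` applies. -/
def advance (c : TConfig k) (t : ℕ × (Option (Fin k) × Option (Fin k)) × ℕ) :
    Option (TConfig k) :=
  if c.1 = t.1 then (consume t.2.1.1 c.2.1).bind fun u => (consume t.2.1.2 c.2.2).map fun v =>
    (t.2.2, u, v) else none

/-- One step of a transducer on configurations. -/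
def CStep (T : Transducer k) (c : TConfig k) (a : Option (Fin k) × Option (Fin k))
    (c' : TConfig k) : Prop :=
  (c.1, a, c'.1) ∈ T.trans ∧ c.2.1 = a.1.toList ++ c'.2.1 ∧ c.2.2 = a.2.toList ++ c'.2.2

theorem advance_eq_some {c c' : TConfig k} {t : ℕ × (Option (Fin k) × Option (Fin k)) × ℕ} :
    advance c t = some c' ↔ t = (c.1, t.2.1, c'.1) ∧ c.2.1 = t.2.1.1.toList ++ c'.2.1 ∧
      c.2.2 = t.2.1.2.toList ++ c'.2.2 := by
  obtain ⟨q, u, v⟩ := c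
  obtain ⟨q', u', v'⟩ := c'
  obtain ⟨p, ⟨a, b⟩, p'⟩ := t
  simp only [advance]
  split_ifs with h
  · simp only [Option.bind_eq_some_iff, Option.map_eq_some_iff, Prod.mk.injEq, consume_eq_some]
    constructor
    · rintro ⟨_, h1, _, h2, rfl, rfl, rfl⟩; exact ⟨⟨h.symm, trivial, rfl⟩, h1, h2⟩
    · rintro ⟨⟨_, _, rfl⟩, h1, h2⟩; exact ⟨_, h1, _, h2, rfl, rfl, rfl⟩
  · simp only [Prod.mk.injEq, false_iff]
    rintro ⟨⟨rfl, -⟩, -⟩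
    exact h rfl

/-- Add to a list of configurations all their successors. -/
def successors (T : Transducer k) (C : List (TConfig k)) : List (TConfig k) :=
  C ++ C.flatMap fun c => T.trans.filterMap (advance c)

theorem mem_successors {T : Transducer k} {C : List (TConfig k)} {c' : TConfig k} :
    c' ∈ successors T C ↔ c' ∈ C ∨ ∃ c ∈ C, ∃ a, CStep T c a c' := by
  simp only [successors, List.mem_append, List.mem_flatMap, List.mem_filterMap]
  refine or_congr_right (exists_congr fun c => and_congr_right fun _ => ?_)
  constructor
  · rintro ⟨t, ht, h⟩
    obtain ⟨h1, h2, h3⟩ := advance_eq_some.1 h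
    exact ⟨t.2.1, h1 ▸ ht, h2, h3⟩
  · rintro ⟨a, h1, h2, h3⟩
    exact ⟨_, h1, advance_eq_some.2 ⟨rfl, h2, h3⟩⟩

theorem mem_successors_iterate {T : Transducer k} {n : ℕ} {C : List (TConfig k)}
    {c' : TConfig k} : c' ∈ (successors T)^[n] C ↔
      ∃ c ∈ C, ∃ l, l.length ≤ n ∧ Path (CStep T) c l c' := by
  induction n generalizing C with
  | zero =>
    constructor
    · intro h; exact ⟨c', h, [], le_rfl, rfl⟩
    · rintro ⟨c, hc, l, hl, h⟩
      obtain rfl := List.length_eq_zero_iff.1 (Nat.le_zero.1 hl)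
      obtain rfl := h
      exact hc
  | succ n ih =>
    rw [Function.iterate_succ_apply, ih]
    constructor
    · rintro ⟨c, hc, l, hl, h⟩
      rcases mem_successors.1 hc with hc | ⟨c₀, hc₀, a, ha⟩
      · exact ⟨c, hc, l, by omega, h⟩
      · exact ⟨c₀, hc₀, a :: l, by simpa using hl, c, ha, h⟩
    · rintro ⟨c, hc, l, hl, h⟩
      cases l with
      | nil => exact ⟨c, mem_successors.2 (.inl hc), [], by simp, h⟩
      | cons a l =>
        obtain ⟨c₁, h1, h2⟩ := h
        exact ⟨c₁, mem_successors.2 (.inr ⟨c, hc, a, h1⟩), l, by simpa using hl, h2⟩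

theorem path_cStep {T : Transducer k} {c c' : TConfig k}
    {l : List (Option (Fin k) × Option (Fin k))} : Path (CStep T) c l c' ↔ T.Run c.1 l c'.1 ∧
      c.2.1 = (l.map Prod.fst).reduceOption ++ c'.2.1 ∧
      c.2.2 = (l.map Prod.snd).reduceOption ++ c'.2.2 := by
  rw [Automaton.run_iff_path]
  induction l generalizing c with
  | nil =>
    simp only [path_nil, List.map_nil, List.reduceOption_nil, List.nil_append]
    constructor
    · rintro rfl; exact ⟨rfl, rfl, rfl⟩
    · rintro ⟨h1, h2, h3⟩; exact Prod.ext h1 (Prod.ext h2 h3)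
  | cons a l ih =>
    have hred : ∀ (a : Option (Fin k)) l, (a :: l).reduceOption = a.toList ++ l.reduceOption := by
      intro a l; cases a <;> rfl
    simp only [path_cons, List.map_cons, hred, List.append_assoc, ih]
    constructor
    · rintro ⟨r, ⟨h1, h2, h3⟩, h4, h5, h6⟩
      exact ⟨⟨r.1, h1, h4⟩, by rw [h2, h5], by rw [h3, h6]⟩
    · rintro ⟨⟨r, h1, h2⟩, h3, h4⟩
      exact ⟨(r, _, _), ⟨h1, h3, h4⟩, h2, rfl, rfl⟩

/-- A bound for the number of configurations of a transducer on a pair of words. -/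
def configBound (p : Transducer k × Word k × Word k) : ℕ :=
  codeSize p.1 * ((p.2.1.length + 1) * (p.2.2.length + 1))

theorem tPath_cStep_mem {T : Transducer k} {c c' : TConfig k}
    {t : List ((Option (Fin k) × Option (Fin k)) × TConfig k)} (h : TPath (CStep T) c t c') :
    ∀ x ∈ t, x.2.1 < codeSize T ∧ x.2.2.1 <:+ c.2.1 ∧ x.2.2.2 <:+ c.2.2 := by
  induction t generalizing c with
  | nil => simp
  | cons y t ih =>
    obtain ⟨a, r⟩ := y
    obtain ⟨_, ⟨rfl, h1, h2, h3⟩, h4⟩ := h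
    intro x hx
    have hr1 : r.2.1 <:+ c.2.1 := ⟨_, h2.symm⟩
    have hr2 : r.2.2 <:+ c.2.2 := ⟨_, h3.symm⟩
    rcases List.mem_cons.1 hx with rfl | hx
    · exact ⟨target_lt_codeSize h1, hr1, hr2⟩
    · obtain ⟨h5, h6, h7⟩ := ih h4 x hx
      exact ⟨h5, h6.trans hr1, h7.trans hr2⟩

/-- Shortest paths between configurations visit no configuration twice. -/
theorem exists_short_path {T : Transducer k} {c c' : TConfig k} (hc : c.1 < codeSize T)
    {l : List (Option (Fin k) × Option (Fin k))} (h : Path (CStep T) c l c') :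
    ∃ l', l'.length ≤ configBound (T, c.2.1, c.2.2) ∧ Path (CStep T) c l' c' := by
  classical
  induction hn : l.length using Nat.strong_induction_on generalizing l with
  | _ n ih =>
  obtain ⟨t, ht, rfl⟩ := h.exists_tPath
  rcases ht.nodup_or_cycle with hnd | ⟨α, γ, β, p, rfl, hγ, h1, -, h2⟩
  · refine ⟨_, ?_, h⟩
    have hsub : (c :: t.map Prod.snd).toFinset ⊆ Finset.range (codeSize T) ×ˢ
        (c.2.1.tails.toFinset ×ˢ c.2.2.tails.toFinset) := by
      intro x hx
      simp only [List.mem_toFinset, List.mem_cons, List.mem_map] at hx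
      simp only [Finset.mem_product, Finset.mem_range, List.mem_toFinset, List.mem_tails]
      rcases hx with rfl | ⟨y, hy, rfl⟩
      · exact ⟨hc, List.suffix_refl _, List.suffix_refl _⟩
      · exact tPath_cStep_mem ht y hy
    have h3 := Finset.card_le_card hsub
    rw [List.toFinset_card_of_nodup hnd, Finset.card_product, Finset.card_product,
      Finset.card_range] at h3
    have h4 : c.2.1.tails.toFinset.card ≤ c.2.1.length + 1 :=
      (List.toFinset_card_le _).trans (by simp)
    have h5 : c.2.2.tails.toFinset.card ≤ c.2.2.length + 1 :=
      (List.toFinset_card_le _).trans (by simp)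
    have h6 := h3.trans (Nat.mul_le_mul_left _ (Nat.mul_le_mul h4 h5))
    simp only [List.length_cons, List.length_map] at h6 ⊢
    exact (Nat.le_succ _).trans h6
  · refine ih (α ++ β).length ?_ (l := (α ++ β).map Prod.fst) ?_ (by simp)
    · have := List.length_pos_iff.2 hγ
      rw [← hn]; simp; omega
    · exact TPath.path (Path.append h1 h2)

/-- Membership in the relation of a transducer is reachability in boundedly many steps, where a
configuration consists of a state and the parts of the two words still to be read. -/
theorem mem_relation_iff {T : Transducer k} {u v : Word k} : (u, v) ∈ T.relation ↔
    ∃ c ∈ (successors T)^[configBound (T, u, v)] (T.init.map fun q => (q, u, v)),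
      (∃ q ∈ T.final, q = c.1) ∧ c.2.1 = [] ∧ c.2.2 = [] := by
  constructor
  · rintro ⟨l, ⟨q, hq, q', hq', h⟩, h1, h2⟩
    have hqT : q < codeSize T := (lt_codeSize_of_mem hq).trans_le (codeSize_automaton T).2.1
    obtain ⟨l', h3, h4⟩ := exists_short_path (c := (q, u, v)) (c' := (q', [], [])) hqT
      (path_cStep.2 ⟨h, by simpa using h1, by simpa using h2⟩)
    exact ⟨(q', [], []), mem_successors_iterate.2 ⟨_, List.mem_map.2 ⟨q, hq, rfl⟩, l', h3, h4⟩,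
      ⟨q', hq', rfl⟩, rfl, rfl⟩
  · rintro ⟨⟨q', u', v'⟩, hc, ⟨_, hq', rfl⟩, rfl, rfl⟩
    obtain ⟨c, hc, l, -, hl⟩ := mem_successors_iterate.1 hc
    obtain ⟨q, hq, rfl⟩ := List.mem_map.1 hc
    obtain ⟨h1, h2, h3⟩ := path_cStep.1 hl
    exact ⟨l, ⟨q, hq, _, hq', h1⟩, by simpa using h2, by simpa using h3⟩

/-- The transducer that relates the words of a finite automaton to the empty word. -/
def FA.toTransducer (M : FA k) : Transducer k :=
  ⟨M.trans.map fun t => (t.1, (t.2.1, none), t.2.2), M.init, M.final⟩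

theorem FA.mem_language_iff {M : FA k} {w : Word k} :
    w ∈ M.language ↔ (w, []) ∈ Transducer.relation M.toTransducer := by
  have key : ∀ q q' l, Automaton.Run M q l q' ↔
      Automaton.Run M.toTransducer q (l.map fun a => (a, none)) q' := by
    intro q q' l
    rw [Automaton.run_iff_path, Automaton.run_iff_path]
    induction l generalizing q with
    | nil => rfl
    | cons a l ih =>
      simp only [List.map_cons, path_cons]
      refine exists_congr fun r => and_congr ?_ (ih r)
      simp [FA.toTransducer]
  have hnone : ∀ {q q' l}, Automaton.Run M.toTransducer q l q' → ∀ a ∈ l, a.2 = none := by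
    intro q q' l h
    induction h with
    | nil => simp
    | cons h1 _ ih =>
      obtain ⟨t, -, ht⟩ := List.mem_map.1 h1
      simp only [List.forall_mem_cons]
      simp only [Prod.mk.injEq] at ht
      exact ⟨by rw [← ht.2.1], ih⟩
  constructor
  · rintro ⟨l, ⟨q, hq, q', hq', h⟩, rfl⟩
    refine ⟨_, ⟨q, hq, q', hq', (key _ _ _).1 h⟩, by simp [Function.comp_def], ?_⟩
    symm
    rw [List.reduceOption_eq_nil_iff]
    exact ⟨l.length, by simp [Function.comp_def]⟩
  · rintro ⟨l, ⟨q, hq, q', hq', h⟩, hw, -⟩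
    refine ⟨l.map Prod.fst, ⟨q, hq, q', hq', (key _ _ _).2 ?_⟩, hw⟩
    have : (l.map Prod.fst).map (fun a => (a, (none : Option (Fin k)))) = l := by
      rw [List.map_map]
      conv_rhs => rw [← List.map_id l]
      exact List.map_congr_left fun a ha => Prod.ext rfl (hnone h a ha).symm
    rwa [this]

end Decide

/-! ### Computability of the bounded search for solutions -/

section Primrec

variable {α : Type} [Primcodable α] {k : ℕ}

theorem codeSize_primrec : Primrec (codeSize : α → ℕ) := Primrec.encode

theorem automaton_primrec : Primrec (Automaton.trans : Automaton α → _) ∧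
    Primrec (Automaton.init : Automaton α → _) ∧ Primrec (Automaton.final : Automaton α → _) := by
  have h : Primrec (Automaton.equivProd α) := Primrec.of_equiv
  exact ⟨Primrec.fst.comp h, Primrec.fst.comp (Primrec.snd.comp h),
    Primrec.snd.comp (Primrec.snd.comp h)⟩

theorem automaton_mk_primrec : Primrec fun p : List (ℕ × α × ℕ) × List ℕ × List ℕ =>
    (⟨p.1, p.2.1, p.2.2⟩ : Automaton α) := by
  have h : Primrec (Automaton.equivProd α).symm := Primrec.of_equiv_symm
  exact h

theorem formula_primrec : Primrec (ConjFormula.rels : ConjFormula k → _) ∧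
    Primrec (ConjFormula.mems : ConjFormula k → _) ∧
    Primrec (ConjFormula.lens : ConjFormula k → _) := by
  have h : Primrec (ConjFormula.equivProd k) := Primrec.of_equiv
  exact ⟨Primrec.fst.comp h, Primrec.fst.comp (Primrec.snd.comp h),
    Primrec.snd.comp (Primrec.snd.comp h)⟩

theorem formula_mk_primrec : Primrec fun p : List (Term × Transducer k × Term) ×
    List (Bool × Term × FA k) × List (Bool × LengthTerm × LengthTerm) =>
    (⟨p.1, p.2.1, p.2.2⟩ : ConjFormula k) := by
  have h : Primrec (ConjFormula.equivProd k).symm := Primrec.of_equiv_symm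
  exact h

theorem consume_primrec : Primrec₂ (consume : Option (Fin k) → Word k → Option (Word k)) := by
  refine Primrec.option_casesOn Primrec.fst (Primrec.option_some.comp Primrec.snd) ?_
  refine Primrec.ite ?_ ?_ (Primrec.const none)
  · exact Primrec.eq.comp (Primrec.list_head?.comp (Primrec.snd.comp Primrec.fst))
      (Primrec.option_some.comp Primrec.snd)
  · exact Primrec.option_some.comp (Primrec.list_tail.comp (Primrec.snd.comp Primrec.fst))

theorem advance_primrec : Primrec₂ (advance : TConfig k → _ → Option (TConfig k)) := by
  have hc : Primrec fun p : TConfig k × (ℕ × (Option (Fin k) × Option (Fin k)) × ℕ) => p.1 :=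
    Primrec.fst
  have ht : Primrec fun p : TConfig k × (ℕ × (Option (Fin k) × Option (Fin k)) × ℕ) => p.2 :=
    Primrec.snd
  have ht2 := Primrec.snd.comp ht
  refine Primrec.ite (Primrec.eq.comp (Primrec.fst.comp hc) (Primrec.fst.comp ht)) ?_
    (Primrec.const none)
  refine Primrec.option_bind (consume_primrec.comp (Primrec.fst.comp (Primrec.fst.comp ht2))
    (Primrec.fst.comp (Primrec.snd.comp hc))) ?_
  refine Primrec.option_map (consume_primrec.comp
    (Primrec.snd.comp (Primrec.fst.comp (ht2.comp Primrec.fst)))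
    (Primrec.snd.comp (Primrec.snd.comp (hc.comp Primrec.fst)))) ?_
  exact (Primrec.snd.comp (ht2.comp (Primrec.fst.comp Primrec.fst))).pair
    ((Primrec.snd.comp Primrec.fst).pair Primrec.snd)

theorem successors_primrec :
    Primrec₂ (successors : Transducer k → List (TConfig k) → List (TConfig k)) := by
  refine Primrec.list_append.comp Primrec.snd (Primrec.list_flatMap Primrec.snd ?_)
  refine Primrec.listFilterMap (automaton_primrec.1.comp (Primrec.fst.comp Primrec.fst)) ?_
  exact advance_primrec.comp (Primrec.snd.comp Primrec.fst) Primrec.snd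

theorem configBound_primrec : Primrec (configBound : Transducer k × Word k × Word k → ℕ) :=
  Primrec.nat_mul.comp (codeSize_primrec.comp Primrec.fst) (Primrec.nat_mul.comp
    (Primrec.succ.comp (Primrec.list_length.comp (Primrec.fst.comp Primrec.snd)))
    (Primrec.succ.comp (Primrec.list_length.comp (Primrec.snd.comp Primrec.snd))))

theorem mem_relation_primrec :
    PrimrecPred fun p : Transducer k × Word k × Word k => p.2 ∈ Transducer.relation p.1 := by
  have hreach : Primrec fun p : Transducer k × Word k × Word k =>
      (successors p.1)^[configBound p] (p.1.init.map fun q => (q, p.2.1, p.2.2)) := by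
    refine Primrec.nat_iterate configBound_primrec
      (Primrec.list_map (automaton_primrec.2.1.comp Primrec.fst)
        (Primrec.snd.pair (Primrec.snd.comp Primrec.fst)))
      (successors_primrec.comp (Primrec.fst.comp Primrec.fst) Primrec.snd)
  have hrel : PrimrecRel fun (c : TConfig k) (T : Transducer k) =>
      (∃ q ∈ T.final, q = c.1) ∧ c.2.1 = [] ∧ c.2.2 = [] := by
    refine PrimrecPred.and ?_ (PrimrecPred.and ?_ ?_)
    · exact (PrimrecRel.exists_mem_list (R := fun (q q' : ℕ) => q = q') Primrec.eq).comp
        (automaton_primrec.2.2.comp Primrec.snd) (Primrec.fst.comp Primrec.fst)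
    · exact Primrec.eq.comp (Primrec.fst.comp (Primrec.snd.comp Primrec.fst)) (Primrec.const [])
    · exact Primrec.eq.comp (Primrec.snd.comp (Primrec.snd.comp Primrec.fst)) (Primrec.const [])
  exact (hrel.exists_mem_list.comp hreach Primrec.fst).of_eq fun p => mem_relation_iff.symm

theorem toTransducer_primrec : Primrec (FA.toTransducer : FA k → Transducer k) := by
  refine automaton_mk_primrec.comp (Primrec.pair (Primrec.list_map automaton_primrec.1 ?_)
    (automaton_primrec.2.1.pair automaton_primrec.2.2))
  exact (Primrec.fst.comp Primrec.snd).pair (((Primrec.fst.comp (Primrec.snd.comp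
    Primrec.snd)).pair (Primrec.const none)).pair (Primrec.snd.comp (Primrec.snd.comp
    Primrec.snd)))

theorem mem_language_primrec :
    PrimrecPred fun p : FA k × Word k => p.2 ∈ FA.language p.1 :=
  (mem_relation_primrec.comp ((toTransducer_primrec.comp Primrec.fst).pair
    (Primrec.snd.pair (Primrec.const [])))).of_eq fun _ => FA.mem_language_iff.symm

/-- The interpretation given by a list of words; other variables are empty. -/
def interp (ws : List (Word k)) : Interpretation k := fun x => ws.getD x []

theorem termValue_interp_primrec :
    Primrec₂ fun (ws : List (Word k)) (t : Term) => termValue (interp ws) t :=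
  Primrec.list_flatMap Primrec.snd
    ((Primrec.list_getD []).comp (Primrec.fst.comp Primrec.fst) Primrec.snd)

theorem int_toNat_primrec : Primrec Int.toNat := by
  have h : Primrec fun z : ℤ => if codeSize z % 2 = 0 then codeSize z / 2 else 0 :=
    Primrec.ite (Primrec.eq.comp (Primrec.nat_mod.comp codeSize_primrec (Primrec.const 2))
      (Primrec.const 0)) (Primrec.nat_div.comp codeSize_primrec (Primrec.const 2))
      (Primrec.const 0)
  refine h.of_eq fun z => ?_
  obtain n | n := z
  · simp [codeSize_int_natCast]
  · simp [codeSize_int_negSucc, Nat.add_mod]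

theorem int_neg_toNat_primrec : Primrec fun z : ℤ => (-z).toNat := by
  have h : Primrec fun z : ℤ => if codeSize z % 2 = 0 then 0 else codeSize z / 2 + 1 :=
    Primrec.ite (Primrec.eq.comp (Primrec.nat_mod.comp codeSize_primrec (Primrec.const 2))
      (Primrec.const 0)) (Primrec.const 0)
      (Primrec.succ.comp (Primrec.nat_div.comp codeSize_primrec (Primrec.const 2)))
  refine h.of_eq fun z => ?_
  obtain n | n := z
  · simp [codeSize_int_natCast]
  · simp only [codeSize_int_negSucc, Int.neg_negSucc]
    have h1 : (2 * n + 1) % 2 = 1 := by omega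
    have h2 : (2 * n + 1) / 2 = n := by omega
    simp [h1, h2]

/-- The part of a length term made of the contributions `f c` of its coefficients. -/
def partValue (f : ℤ → ℕ) (η : Interpretation k) (s : LengthTerm) : ℕ :=
  (s.1.map fun ct => f ct.1 * (termValue η ct.2).length).foldr (· + ·) 0 + f s.2

theorem lengthValue_eq_sub (η : Interpretation k) (s : LengthTerm) :
    lengthValue η s = partValue Int.toNat η s - partValue (fun z => (-z).toNat) η s := by
  have hz : ∀ z : ℤ, z = (z.toNat : ℤ) - ((-z).toNat : ℤ) := fun z => by omega
  obtain ⟨l, d⟩ := s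
  simp only [lengthValue, partValue]
  induction l with
  | nil => simp
  | cons ct l ih =>
    simp only [List.map_cons, List.sum_cons, List.foldr_cons, add_assoc, ih]
    push_cast
    conv_lhs => rw [hz ct.1]
    ring

theorem partValue_primrec {f : ℤ → ℕ} (hf : Primrec f) :
    Primrec₂ fun (ws : List (Word k)) (s : LengthTerm) => partValue f (interp ws) s := by
  refine Primrec.nat_add.comp (Primrec.list_foldr (h := fun _ q => q.1 + q.2)
    (Primrec.list_map (Primrec.fst.comp Primrec.snd) ?_) (Primrec.const 0) ?_)
    (hf.comp (Primrec.snd.comp Primrec.snd))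
  · exact Primrec.nat_mul.comp (hf.comp (Primrec.fst.comp Primrec.snd)) (Primrec.list_length.comp
      (termValue_interp_primrec.comp (Primrec.fst.comp Primrec.fst)
        (Primrec.snd.comp Primrec.snd)))
  · exact Primrec.nat_add.comp (Primrec.fst.comp Primrec.snd) (Primrec.snd.comp Primrec.snd)

theorem primrecPred_iff {p q : α → Prop} (hp : PrimrecPred p) (hq : PrimrecPred q) :
    PrimrecPred fun a => (p a ↔ q a) :=
  ((hp.and hq).or (hp.not.and hq.not)).of_eq fun a => by tauto

theorem models_primrec : PrimrecRel fun (ws : List (Word k)) (Φ : ConjFormula k) =>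
    ConjFormula.Models (interp ws) Φ := by
  obtain ⟨hrels, hmems, hlens⟩ := formula_primrec (k := k)
  refine PrimrecPred.and ?_ (PrimrecPred.and ?_ ?_)
  · refine (PrimrecRel.forall_mem_list (R := fun (c : Term × Transducer k × Term)
      (ws : List (Word k)) => (termValue (interp ws) c.1, termValue (interp ws) c.2.2) ∈
        Transducer.relation c.2.1) ?_).comp (hrels.comp Primrec.snd) Primrec.fst
    exact mem_relation_primrec.comp ((Primrec.fst.comp (Primrec.snd.comp Primrec.fst)).pair
      ((termValue_interp_primrec.comp Primrec.snd (Primrec.fst.comp Primrec.fst)).pair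
        (termValue_interp_primrec.comp Primrec.snd
          (Primrec.snd.comp (Primrec.snd.comp Primrec.fst)))))
  · refine (PrimrecRel.forall_mem_list (R := fun (c : Bool × Term × FA k)
      (ws : List (Word k)) => (c.1 = true ↔ termValue (interp ws) c.2.1 ∈
        FA.language c.2.2)) ?_).comp (hmems.comp Primrec.snd) Primrec.fst
    exact primrecPred_iff (Primrec.eq.comp (Primrec.fst.comp Primrec.fst) (Primrec.const true))
      (mem_language_primrec.comp ((Primrec.snd.comp (Primrec.snd.comp Primrec.fst)).pair
        (termValue_interp_primrec.comp Primrec.snd (Primrec.fst.comp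
          (Primrec.snd.comp Primrec.fst)))))
  · refine (PrimrecRel.forall_mem_list (R := fun (c : Bool × LengthTerm × LengthTerm)
      (ws : List (Word k)) => (c.1 = true ↔ lengthValue (interp ws) c.2.1 ≤
        lengthValue (interp ws) c.2.2)) ?_).comp (hlens.comp Primrec.snd) Primrec.fst
    refine primrecPred_iff (Primrec.eq.comp (Primrec.fst.comp Primrec.fst) (Primrec.const true))
      ?_
    have hs : Primrec fun p : (Bool × LengthTerm × LengthTerm) × List (Word k) => p.1.2.1 :=
      Primrec.fst.comp (Primrec.snd.comp Primrec.fst)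
    have hs' : Primrec fun p : (Bool × LengthTerm × LengthTerm) × List (Word k) => p.1.2.2 :=
      Primrec.snd.comp (Primrec.snd.comp Primrec.fst)
    have hpos := partValue_primrec (k := k) int_toNat_primrec
    have hneg := partValue_primrec (k := k) int_neg_toNat_primrec
    refine (Primrec.nat_le.comp
      (Primrec.nat_add.comp (hpos.comp Primrec.snd hs) (hneg.comp Primrec.snd hs'))
      (Primrec.nat_add.comp (hpos.comp Primrec.snd hs') (hneg.comp Primrec.snd hs))).of_eq
      fun p => ?_
    rw [lengthValue_eq_sub, lengthValue_eq_sub]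
    omega

/-- All lists of length `n` with entries in `L`. -/
def listsOver (L : List α) (n : ℕ) : List (List α) :=
  (fun M : List (List α) => L.flatMap fun a => M.map fun l => a :: l)^[n] [[]]

theorem mem_listsOver {α : Type} {L : List α} {n : ℕ} {l : List α} :
    l ∈ listsOver L n ↔ l.length = n ∧ ∀ a ∈ l, a ∈ L := by
  induction n generalizing l with
  | zero => cases l <;> simp [listsOver]
  | succ n ih =>
    simp only [listsOver, Function.iterate_succ_apply', List.mem_flatMap, List.mem_map] at ih ⊢
    constructor
    · rintro ⟨a, ha, l, hl, rfl⟩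
      obtain ⟨h1, h2⟩ := ih.1 hl
      exact ⟨by simp [h1], by simpa [ha] using h2⟩
    · rintro ⟨h1, h2⟩
      cases l with
      | nil => simp at h1
      | cons a l =>
        exact ⟨a, h2 a (by simp), l, ih.2 ⟨by simpa using h1, fun b hb => h2 b (by simp [hb])⟩,
          rfl⟩

theorem listsOver_primrec : Primrec₂ (listsOver : List α → ℕ → List (List α)) := by
  refine Primrec.nat_iterate Primrec.snd (Primrec.const [[]]) ?_
  refine Primrec.list_flatMap (Primrec.fst.comp Primrec.fst) ?_
  exact Primrec.list_map (Primrec.snd.comp Primrec.fst)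
    (Primrec.list_cons.comp (Primrec.snd.comp Primrec.fst) Primrec.snd)

/-- All words of length at most `n`. -/
def wordsUpTo (k n : ℕ) : List (Word k) :=
  (List.range (n + 1)).flatMap (listsOver (List.finRange k))

theorem mem_wordsUpTo {n : ℕ} {w : Word k} : w ∈ wordsUpTo k n ↔ w.length ≤ n := by
  simp [wordsUpTo, mem_listsOver]

theorem wordsUpTo_primrec : Primrec (wordsUpTo k) :=
  Primrec.list_flatMap (Primrec.list_range.comp Primrec.succ)
    (listsOver_primrec.comp (Primrec.const _) Primrec.snd)

end Primrec

/-- Satisfiability is decidable on the formulae with a given chain-free skeleton: it suffices to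
search among interpretations of bounded size. -/
theorem satDecidable_of_chainFree {k : ℕ} {Φ : ConjFormula k} (hΦ : Φ.ChainFree) :
    SatDecidable Φ.skeletonClass := by
  obtain ⟨g, hg, hsmall⟩ := exists_small_model hΦ
  let cand : ConjFormula k → List (List (Word k)) := fun Ψ =>
    listsOver (wordsUpTo k (g Ψ.lens.length (codeSize Ψ))) (codeSize Ψ)
  have hcand : Primrec cand :=
    listsOver_primrec.comp (wordsUpTo_primrec.comp (hg.comp
      (Primrec.list_length.comp formula_primrec.2.2) codeSize_primrec)) codeSize_primrec
  refine ⟨fun Ψ => ∃ ws ∈ cand Ψ, ConjFormula.Models (interp ws) Ψ,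
    (models_primrec.exists_mem_list.comp hcand Primrec.id).computablePred, fun Ψ hΨ => ⟨?_, ?_⟩⟩
  · rintro ⟨ws, -, h⟩; exact ⟨_, h⟩
  · intro hsat
    obtain ⟨η, h1, h2, h3⟩ := hsmall k _ Ψ hΨ Ψ.sizeLE_codeSize hsat
    refine ⟨(List.range (codeSize Ψ)).map η, mem_listsOver.2 ⟨by simp, ?_⟩, ?_⟩
    · intro w hw
      obtain ⟨x, -, rfl⟩ := List.mem_map.1 hw
      exact mem_wordsUpTo.2 (h3 x)
    · convert h1 using 1
      funext x
      by_cases hx : x < codeSize Ψ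
      · simp [interp, hx]
      · simp [interp, hx, h2 x (not_lt.1 hx)]

/-! ### Rational relations -/

/-- The concatenation of two relations between words. -/
def RelMul {A B : Type} (R S : List A → List B → Prop) (x : List A) (y : List B) : Prop :=
  ∃ x₁ y₁ x₂ y₂, R x₁ y₁ ∧ S x₂ y₂ ∧ x = x₁ ++ x₂ ∧ y = y₁ ++ y₂

/-- The iteration of a relation between words. -/
inductive RelStar {A B : Type} (R : List A → List B → Prop) : List A → List B → Prop
  | nil : RelStar R [] []
  | cons {x₁ y₁ x₂ y₂} : R x₁ y₁ → RelStar R x₂ y₂ → RelStar R (x₁ ++ x₂) (y₁ ++ y₂)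

/-- Rational relations: those obtained from relations with one element or none by unions,
concatenations and iterations. -/
inductive Rational {A B : Type} : (List A → List B → Prop) → Prop
  | empty : Rational fun _ _ => False
  | single (u : List A) (v : List B) : Rational fun x y => x = u ∧ y = v
  | union {R S} : Rational R → Rational S → Rational fun x y => R x y ∨ S x y
  | mul {R S} : Rational R → Rational S → Rational (RelMul R S)
  | star {R} : Rational R → Rational (RelStar R)

namespace Rational

variable {A B C D : Type}

theorem congr {R S : List A → List B → Prop} (hR : Rational R) (h : ∀ x y, R x y ↔ S x y) :
    Rational S := by
  have : R = S := by ext x y; exact h x y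
  exact this ▸ hR

theorem iUnion {ι : Type} [Finite ι] {R : ι → List A → List B → Prop}
    (hR : ∀ i, Rational (R i)) : Rational fun x y => ∃ i, R i x y := by
  have key : ∀ s : Finset ι, Rational fun x y => ∃ i ∈ s, R i x y := fun s => by
    classical
    induction s using Finset.induction_on with
    | empty => exact empty.congr fun x y => by simp
    | insert i s _ ih => exact ((hR i).union ih).congr fun x y => by simp
  have := Fintype.ofFinite ι
  exact (key Finset.univ).congr fun x y => by simp

/-- Images of rational relations under a pair of morphisms are rational. -/
theorem image {R : List A → List B → Prop} (hR : Rational R) (f : A → List C) (g : B → List D) :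
    Rational fun x y => ∃ x' y', R x' y' ∧ x = x'.flatMap f ∧ y = y'.flatMap g := by
  induction hR with
  | empty => exact empty.congr fun x y => by simp
  | single u v => exact (single (u.flatMap f) (v.flatMap g)).congr fun x y => by simp
  | union _ _ ih₁ ih₂ =>
    refine (ih₁.union ih₂).congr fun x y => ?_
    constructor
    · rintro (⟨x', y', h, h'⟩ | ⟨x', y', h, h'⟩)
      · exact ⟨x', y', .inl h, h'⟩
      · exact ⟨x', y', .inr h, h'⟩
    · rintro ⟨x', y', h | h, h'⟩
      · exact .inl ⟨x', y', h, h'⟩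
      · exact .inr ⟨x', y', h, h'⟩
  | mul _ _ ih₁ ih₂ =>
    refine (ih₁.mul ih₂).congr fun x y => ?_
    constructor
    · rintro ⟨_, _, _, _, ⟨x₁, y₁, h₁, rfl, rfl⟩, ⟨x₂, y₂, h₂, rfl, rfl⟩, rfl, rfl⟩
      exact ⟨_, _, ⟨_, _, _, _, h₁, h₂, rfl, rfl⟩, by simp, by simp⟩
    · rintro ⟨_, _, ⟨x₁, y₁, x₂, y₂, h₁, h₂, rfl, rfl⟩, rfl, rfl⟩
      exact ⟨_, _, _, _, ⟨_, _, h₁, rfl, rfl⟩, ⟨_, _, h₂, rfl, rfl⟩, by simp, by simp⟩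
  | star _ ih =>
    refine ih.star.congr fun x y => ?_
    constructor
    · intro h
      induction h with
      | nil => exact ⟨_, _, .nil, rfl, rfl⟩
      | cons h₁ _ ih =>
        obtain ⟨x₁, y₁, h₁, rfl, rfl⟩ := h₁
        obtain ⟨x₂, y₂, h₂, rfl, rfl⟩ := ih
        exact ⟨_, _, .cons h₁ h₂, by simp, by simp⟩
    · rintro ⟨x', y', h, rfl, rfl⟩
      induction h with
      | nil => exact .nil
      | cons h₁ _ ih =>
        simp only [List.flatMap_append]
        exact .cons ⟨_, _, h₁, rfl, rfl⟩ ih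

/-- The identity relation. -/
theorem eq [Finite A] : Rational fun x y : List A => x = y := by
  refine (star (iUnion fun a : A => single [a] [a])).congr fun x y => ?_
  constructor
  · intro h
    induction h with
    | nil => rfl
    | cons h _ ih => obtain ⟨a, rfl, rfl⟩ := h; rw [ih]
  · rintro rfl
    induction x with
    | nil => exact .nil
    | cons a x ih => exact .cons ⟨a, rfl, rfl⟩ ih

/-- The relation between all words and the empty word. -/
theorem left_univ [Finite A] : Rational fun (_ : List A) (y : List B) => y = [] := by
  refine (eq.image (fun a : A => [a]) fun _ : A => ([] : List B)).congr fun x y => ?_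
  constructor
  · rintro ⟨x, y, -, -, rfl⟩; simp
  · rintro rfl; exact ⟨x, x, rfl, by simp, by simp⟩

/-- The relation between the empty word and all words. -/
theorem right_univ [Finite B] : Rational fun (x : List A) (_ : List B) => x = [] := by
  refine (eq.image (fun _ : B => ([] : List A)) fun a : B => [a]).congr fun x y => ?_
  constructor
  · rintro ⟨x, y, -, rfl, -⟩; simp
  · rintro rfl; exact ⟨y, y, rfl, by simp, by simp⟩

end Rational

/-! ### Rational relations are recognised by transducers -/

namespace Net

variable {k : ℕ}

/-- An unweighted transducer with an arbitrary finite type of states. -/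
abbrev NTrans (k : ℕ) := Net (Option (Fin k) × Option (Fin k))

/-- The relation recognised by a network. -/
def Recog (N : NTrans k) (x y : Word k) : Prop :=
  ∃ l, N.Acc l ∧ x = (l.map Prod.fst).reduceOption ∧ y = (l.map Prod.snd).reduceOption

/-- The steps of a graph of networks: the edges `i : ι` of a finite graph with vertices in `H` are
replaced by networks `N i`, which are entered and left along edges labelled `e`. -/
inductive GraphStep {L H ι : Type} (e : L) (src tgt : ι → H) (N : ι → Net L) :
    H ⊕ (Σ i, (N i).Q) → L → H ⊕ (Σ i, (N i).Q) → Prop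
  | enter (i) : GraphStep e src tgt N (.inl (src i)) e (.inr ⟨i, (N i).init⟩)
  | inside {i q a q'} : (N i).step q a q' →
      GraphStep e src tgt N (.inr ⟨i, q⟩) a (.inr ⟨i, q'⟩)
  | leave (i) : GraphStep e src tgt N (.inr ⟨i, (N i).final⟩) e (.inl (tgt i))

/-- A graph of networks, with initial vertex `h` and final vertex `h'`. -/
def graph {L H ι : Type} [Finite H] [Finite ι] (e : L) (src tgt : ι → H)
    (N : ι → Net L) (h h' : H) : Net L where
  Q := H ⊕ (Σ i, (N i).Q)
  finite := inferInstance
  step := GraphStep e src tgt N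
  init := .inl h
  final := .inl h'

/-- The pairs of words along the walks from `h` to `h'` in a graph whose edges carry relations. -/
inductive Walk {A B H ι : Type} (src tgt : ι → H) (R : ι → List A → List B → Prop) (h' : H) :
    H → List A → List B → Prop
  | nil : Walk src tgt R h' h' [] []
  | cons (i) {x₁ y₁ x₂ y₂} : R i x₁ y₁ → Walk src tgt R h' (tgt i) x₂ y₂ →
      Walk src tgt R h' (src i) (x₁ ++ x₂) (y₁ ++ y₂)

section

variable {H ι : Type} {src tgt : ι → H} {N : ι → NTrans k} {h' : H}

theorem graph_path_inside {i : ι} {q : (N i).Q} {l : List (Option (Fin k) × Option (Fin k))}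
    (h : Path (GraphStep (none, none) src tgt N) (.inr ⟨i, q⟩) l (.inl h')) :
    ∃ l₁ l₂, l = l₁ ++ (none, none) :: l₂ ∧ Path (N i).step q l₁ (N i).final ∧
      Path (GraphStep (none, none) src tgt N) (.inl (tgt i)) l₂ (.inl h') := by
  induction l generalizing q with
  | nil => simp at h
  | cons a l ih =>
    obtain ⟨r, h1, h2⟩ := h
    cases h1 with
    | inside h1 =>
      obtain ⟨l₁, l₂, rfl, h3, h4⟩ := ih h2
      exact ⟨a :: l₁, l₂, rfl, ⟨_, h1, h3⟩, h4⟩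
    | leave => exact ⟨[], l, rfl, rfl, h2⟩

theorem graph_path {h : H} {x y : Word k} :
    (∃ l, Path (GraphStep (none, none) src tgt N) (.inl h) l (.inl h') ∧
      x = (l.map Prod.fst).reduceOption ∧ y = (l.map Prod.snd).reduceOption) ↔
    Walk src tgt (fun i => (N i).Recog) h' h x y := by
  constructor
  · rintro ⟨l, h1, h2, h3⟩
    induction hn : l.length using Nat.strong_induction_on generalizing l h x y with
    | _ n ih =>
      cases l with
      | nil => cases h1; subst h2 h3; exact .nil
      | cons a l =>
        obtain ⟨r, h1, h4⟩ := h1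
        cases h1 with
        | enter i =>
          obtain ⟨l₁, l₂, rfl, h5, h6⟩ := graph_path_inside h4
          have := Walk.cons i ⟨l₁, h5, rfl, rfl⟩
            (ih l₂.length (by simp at hn; omega) l₂ h6 rfl rfl rfl)
          simpa [h2, h3, List.reduceOption_append] using this
  · intro h
    induction h with
    | nil => exact ⟨[], rfl, rfl, rfl⟩
    | cons i h1 _ ih =>
      obtain ⟨l₁, h1, rfl, rfl⟩ := h1
      obtain ⟨l₂, h2, rfl, rfl⟩ := ih
      refine ⟨(none, none) :: (l₁ ++ (none, none) :: l₂), ⟨_, .enter i, ?_⟩, ?_, ?_⟩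
      · refine Path.append (r := .inr ⟨i, (N i).final⟩) ?_ ⟨_, .leave i, h2⟩
        simpa using Path.map (g := id) (fun q => (.inr ⟨i, q⟩ : H ⊕ (Σ i, (N i).Q)))
          (fun _ _ _ h => GraphStep.inside h) h1
      · simp [List.reduceOption_append]
      · simp [List.reduceOption_append]

end

end Net

theorem walk_two_edges {A B : Type} {R : Bool → List A → List B → Prop} {x : List A} {y : List B} :
    Net.Walk (fun _ => false) (fun _ => true) R true false x y ↔ R false x y ∨ R true x y := by
  have h0 : ∀ {h x y}, Net.Walk (fun _ : Bool => false) (fun _ => true) R true h x y →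
      h = true → x = [] ∧ y = [] := by
    intro h x y hw hh
    cases hw with
    | nil => exact ⟨rfl, rfl⟩
    | cons => cases hh
  have h1 : ∀ {h x y}, Net.Walk (fun _ : Bool => false) (fun _ => true) R true h x y →
      h = false → R false x y ∨ R true x y := by
    intro h x y hw hh
    cases hw with
    | nil => cases hh
    | cons i h1 h2 =>
      obtain ⟨rfl, rfl⟩ := h0 h2 rfl
      cases i <;> simp [h1]
  constructor
  · exact fun hw => h1 hw rfl
  · rintro (h | h)
    · simpa using Net.Walk.cons (src := fun _ : Bool => false) (tgt := fun _ => true) false h .nil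
    · simpa using Net.Walk.cons (src := fun _ : Bool => false) (tgt := fun _ => true) true h .nil

theorem walk_loop {A B : Type} {R : List A → List B → Prop} {x : List A} {y : List B} :
    Net.Walk (fun _ : Unit => ()) (fun _ => ()) (fun _ => R) () () x y ↔ RelStar R x y := by
  have key : ∀ {u x y}, Net.Walk (fun _ : Unit => ()) (fun _ => ()) (fun _ => R) () u x y →
      RelStar R x y := by
    intro u x y h
    induction h with
    | nil => exact .nil
    | cons _ h1 _ ih => exact .cons h1 ih
  constructor
  · exact key
  · intro h
    induction h with
    | nil => exact .nil
    | cons h1 _ ih => exact .cons () h1 ih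

/-- Every rational relation is recognised by a network. -/
theorem Rational.exists_net {k : ℕ} {R : Word k → Word k → Prop} (hR : Rational R) :
    ∃ N : Net.NTrans k, ∀ x y, N.Recog x y ↔ R x y := by
  induction hR with
  | empty =>
    refine ⟨⟨Bool, inferInstance, fun _ _ _ => False, false, true⟩, fun x y => ?_⟩
    simp only [Net.Recog, iff_false]
    rintro ⟨_ | ⟨a, l⟩, h, -⟩
    · cases h
    · obtain ⟨_, h, -⟩ := h; exact h
  | single u v =>
    -- the letters of `u` are read first, then those of `v`
    have key : ∀ l : List (Option (Fin k) × Option (Fin k)), ∃ N : Net.NTrans k,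
        ∀ x y, N.Recog x y ↔ x = (l.map Prod.fst).reduceOption ∧
          y = (l.map Prod.snd).reduceOption := by
      intro l
      induction l with
      | nil =>
        refine ⟨Net.unit, fun x y => ?_⟩
        simp [Net.Recog, Net.unit_acc]
      | cons a l ih =>
        obtain ⟨N, hN⟩ := ih
        refine ⟨Net.seq a Net.unit N, fun x y => ?_⟩
        have : N.Recog = fun x y => x = (l.map Prod.fst).reduceOption ∧
          y = (l.map Prod.snd).reduceOption := by ext x y; exact hN x y
        simp only [Net.Recog, Net.seq_acc, Net.unit_acc]
        constructor
        · rintro ⟨_, ⟨_, l', rfl, rfl, h⟩, rfl, rfl⟩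
          obtain ⟨h1, h2⟩ := (hN _ _).1 ⟨l', h, rfl, rfl⟩
          rcases a with ⟨_ | a, _ | b⟩ <;> simp [h1, h2]
        · rintro ⟨rfl, rfl⟩
          obtain ⟨l', h, h1, h2⟩ := (hN _ _).2 ⟨rfl, rfl⟩
          refine ⟨_, ⟨_, l', rfl, rfl, h⟩, ?_, ?_⟩ <;>
            rcases a with ⟨_ | a, _ | b⟩ <;> simp [h1, h2]
    obtain ⟨N, hN⟩ := key (u.map (fun a => (some a, none)) ++ v.map fun b => (none, some b))
    refine ⟨N, fun x y => (hN x y).trans ?_⟩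
    have h2 : ∀ w : Word k, (w.map some).reduceOption = w := by
      intro w; induction w <;> simp_all
    simp [List.reduceOption_append, Function.comp_def, h2]
  | @union R S _ _ ih₁ ih₂ =>
    obtain ⟨M, hM⟩ := ih₁
    obtain ⟨N, hN⟩ := ih₂
    refine ⟨Net.graph (H := Bool) (ι := Bool) (none, none) (fun _ => false) (fun _ => true)
      (fun b => cond b N M) false true, fun x y => ?_⟩
    exact (Net.graph_path.trans walk_two_edges).trans (or_congr (hM x y) (hN x y))
  | @mul R S _ _ ih₁ ih₂ =>
    obtain ⟨M, hM⟩ := ih₁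
    obtain ⟨N, hN⟩ := ih₂
    refine ⟨Net.seq (none, none) M N, fun x y => ?_⟩
    simp only [Net.Recog, Net.seq_acc]
    constructor
    · rintro ⟨_, ⟨l₁, l₂, rfl, h1, h2⟩, rfl, rfl⟩
      exact ⟨_, _, _, _, (hM _ _).1 ⟨l₁, h1, rfl, rfl⟩, (hN _ _).1 ⟨l₂, h2, rfl, rfl⟩,
        by simp [List.reduceOption_append], by simp [List.reduceOption_append]⟩
    · rintro ⟨x₁, y₁, x₂, y₂, h1, h2, rfl, rfl⟩
      obtain ⟨l₁, h3, rfl, rfl⟩ := (hM _ _).2 h1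
      obtain ⟨l₂, h4, rfl, rfl⟩ := (hN _ _).2 h2
      exact ⟨_, ⟨l₁, l₂, rfl, h3, h4⟩, by simp [List.reduceOption_append],
        by simp [List.reduceOption_append]⟩
  | @star R _ ih =>
    obtain ⟨N, hN⟩ := ih
    refine ⟨Net.graph (H := Unit) (ι := Unit) (none, none) (fun _ => ()) (fun _ => ())
      (fun _ => N) () (), fun x y => ?_⟩
    have : N.Recog = R := by ext x y; exact hN x y
    rw [← this]
    exact Net.graph_path.trans walk_loop

/-- A network with finitely many labels is an automaton, up to the names of its states. -/
theorem Net.exists_automaton {L : Type} [Finite L] (N : Net L) :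
    ∃ M : Automaton L, ∀ l, M.Accepts l ↔ N.Acc l := by
  obtain ⟨n, ⟨e⟩⟩ := Finite.exists_equiv_fin N.Q
  have hfin : {t : ℕ × L × ℕ | ∃ q a q', N.step q a q' ∧
      t = ((e q : ℕ), a, (e q' : ℕ))}.Finite := by
    refine (Set.finite_range fun t : N.Q × L × N.Q =>
      ((e t.1 : ℕ), t.2.1, (e t.2.2 : ℕ))).subset ?_
    rintro _ ⟨q, a, q', -, rfl⟩
    exact ⟨(q, a, q'), rfl⟩
  have hinj : ∀ {q q' : N.Q}, (e q : ℕ) = e q' → q = q' := fun h => e.injective (Fin.ext h)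
  refine ⟨⟨hfin.toFinset.toList, [(e N.init : ℕ)], [(e N.final : ℕ)]⟩, fun l => ?_⟩
  simp only [Automaton.Accepts, List.mem_singleton, exists_eq_left, Automaton.run_iff_path,
    Finset.mem_toList, Set.Finite.mem_toFinset, Set.mem_ofPred_eq, Net.Acc]
  constructor
  · generalize N.init = q
    induction l generalizing q with
    | nil => exact fun h => hinj h
    | cons a l ih =>
      rintro ⟨_, ⟨q₁, b, q', h1, h2⟩, h3⟩
      simp only [Prod.mk.injEq] at h2
      obtain ⟨h2, rfl, rfl⟩ := h2
      obtain rfl := hinj h2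
      exact ⟨q', h1, ih _ h3⟩
  · intro h
    simpa using Path.map (g := id) (step' := fun q a q' => ∃ r b r', N.step r b r' ∧
      (q, a, q') = ((e r : ℕ), b, (e r' : ℕ))) (fun q => (e q : ℕ))
      (fun q a q' h => ⟨q, a, q', h, rfl⟩) h

theorem Rational.exists_transducer {k : ℕ} {R : Word k → Word k → Prop} (hR : Rational R) :
    ∃ T : Transducer k, ∀ x y, (x, y) ∈ T.relation ↔ R x y := by
  obtain ⟨N, hN⟩ := hR.exists_net
  obtain ⟨T, hT⟩ := N.exists_automaton
  refine ⟨T, fun x y => ?_⟩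
  rw [← hN]
  simp only [Transducer.relation, Set.mem_ofPred_eq, hT, Net.Recog]

/-- The words that a rational relation relates to the empty word form a regular language. -/
theorem Rational.exists_fa {k : ℕ} {R : Word k → Word k → Prop} (hR : Rational R) :
    ∃ M : FA k, ∀ x, x ∈ M.language ↔ ∃ y, R x y := by
  obtain ⟨N, hN⟩ := hR.exists_net
  obtain ⟨M, hM⟩ := Net.exists_automaton (⟨N.Q, N.finite,
    fun q a q' => ∃ b, N.step q (a, b) q', N.init, N.final⟩ : Net (Option (Fin k)))
  refine ⟨M, fun x => ?_⟩
  simp only [← hN, FA.language, Set.mem_ofPred_eq, hM, Net.Acc, Net.Recog]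
  have key : ∀ q l, Path (fun q a q' => ∃ b, N.step q (a, b) q') q l N.final ↔
      ∃ l', Path N.step q l' N.final ∧ l = l'.map Prod.fst := by
    intro q l
    induction l generalizing q with
    | nil =>
      constructor
      · exact fun h => ⟨[], h, rfl⟩
      · rintro ⟨_ | ⟨a, l⟩, h, h'⟩
        · exact h
        · simp at h'
    | cons a l ih =>
      constructor
      · rintro ⟨r, ⟨b, h1⟩, h2⟩
        obtain ⟨l', h3, rfl⟩ := (ih r).1 h2
        exact ⟨(a, b) :: l', ⟨r, h1, h3⟩, rfl⟩
      · rintro ⟨_ | ⟨⟨a', b⟩, l'⟩, h, h'⟩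
        · simp at h'
        · obtain ⟨r, h1, h2⟩ := h
          simp only [List.map_cons, List.cons.injEq] at h'
          obtain ⟨rfl, rfl⟩ := h'
          exact ⟨r, ⟨b, h1⟩, (ih r).2 ⟨l', h2, rfl⟩⟩
  constructor
  · rintro ⟨l, h1, rfl⟩
    obtain ⟨l', h2, rfl⟩ := (key _ _).1 h1
    exact ⟨_, l', h2, rfl, rfl⟩
  · rintro ⟨_, l, h1, rfl, rfl⟩
    exact ⟨_, (key _ _).2 ⟨l, h1, rfl⟩, rfl⟩

/-! ### Sequences of blocks -/

section Blocks

variable {B : Type}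

/-- A sequence of words as a single word: every word is followed by the terminator `none`. -/
def enc (xs : List (List B)) : List (Option B) := xs.flatMap fun x => x.map some ++ [none]

@[simp] theorem enc_nil : enc ([] : List (List B)) = [] := rfl

@[simp] theorem enc_cons (x : List B) (xs : List (List B)) :
    enc (x :: xs) = x.map some ++ none :: enc xs := by simp [enc]

@[simp] theorem enc_append (xs ys : List (List B)) : enc (xs ++ ys) = enc xs ++ enc ys := by
  simp [enc]

theorem map_some_append_none_inj {x y : List B} {u v : List (Option B)}
    (h : x.map some ++ none :: u = y.map some ++ none :: v) : x = y ∧ u = v := by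
  induction x generalizing y with
  | nil => cases y <;> simp_all
  | cons a x ih =>
    cases y with
    | nil => simp at h
    | cons b y =>
      simp only [List.map_cons, List.cons_append, List.cons.injEq, Option.some.injEq] at h
      obtain ⟨rfl, h⟩ := h
      obtain ⟨rfl, rfl⟩ := ih h
      exact ⟨rfl, rfl⟩

theorem enc_append_eq {t s : List (List B)} {u : List (Option B)} (h : enc t ++ u = enc s) :
    ∃ s', s = t ++ s' ∧ u = enc s' := by
  induction t generalizing s with
  | nil => exact ⟨s, rfl, h⟩
  | cons x t ih =>
    cases s with
    | nil => simp at h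
    | cons y s =>
      simp only [enc_cons, List.append_assoc, List.cons_append] at h
      obtain ⟨h1, h2⟩ := map_some_append_none_inj h
      obtain ⟨s', rfl, h3⟩ := ih h2
      exact ⟨s', by rw [h1]; rfl, h3⟩

theorem enc_injective : Function.Injective (enc : List (List B) → _) := by
  intro t s h
  obtain ⟨s', rfl, h⟩ := enc_append_eq (u := []) (by simpa using h)
  cases s' <;> simp_all

theorem map_some_prefix_enc {w x : List B} {xs : List (List B)}
    (h : w.map some <+: enc (x :: xs)) : w <+: x := by
  induction w generalizing x with
  | nil => exact List.nil_prefix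
  | cons a w ih =>
    cases x with
    | nil => simp at h
    | cons b x =>
      simp only [List.map_cons, enc_cons, List.cons_append, List.cons_prefix_cons,
        Option.some.injEq] at h ⊢
      exact ⟨h.1, ih (by simpa using h.2)⟩

/-- The relation between terminated words induced by a relation between words. -/
def BlockRel (R : List B → List B → Prop) (x y : List (Option B)) : Prop :=
  ∃ x' y', R x' y' ∧ x = enc [x'] ∧ y = enc [y']

theorem Rational.blockRel {R : List B → List B → Prop} (hR : Rational R) :
    Rational (BlockRel R) := by
  refine ((hR.image (fun a => [some a]) (fun a => [some a])).mul
    (.single [none] [none])).congr fun x y => ?_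
  constructor
  · rintro ⟨_, _, _, _, ⟨x, y, h, rfl, rfl⟩, ⟨rfl, rfl⟩, rfl, rfl⟩
    exact ⟨x, y, h, by simp [← List.map_eq_flatMap], by simp [← List.map_eq_flatMap]⟩
  · rintro ⟨x, y, h, rfl, rfl⟩
    exact ⟨_, _, _, _, ⟨x, y, h, rfl, rfl⟩, ⟨rfl, rfl⟩, by simp [← List.map_eq_flatMap],
      by simp [← List.map_eq_flatMap]⟩

theorem relStar_blockRel {R : List B → List B → Prop} {x y : List (Option B)} :
    RelStar (BlockRel R) x y ↔ ∃ xs ys, List.Forall₂ R xs ys ∧ x = enc xs ∧ y = enc ys := by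
  constructor
  · intro h
    induction h with
    | nil => exact ⟨[], [], .nil, rfl, rfl⟩
    | cons h _ ih =>
      obtain ⟨x, y, h, rfl, rfl⟩ := h
      obtain ⟨xs, ys, h', rfl, rfl⟩ := ih
      exact ⟨x :: xs, y :: ys, .cons h h', by simp, by simp⟩
  · rintro ⟨xs, ys, h, rfl, rfl⟩
    induction h with
    | nil => exact .nil
    | @cons x y xs ys h _ ih =>
      have := RelStar.cons (R := BlockRel R) ⟨x, y, h, rfl, rfl⟩ ih
      simpa using this

theorem Rational.enc_right [Finite B] {A : Type} :
    Rational fun (x : List A) (y : List (Option B)) => x = [] ∧ ∃ D, y = enc [D] := by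
  refine ((Rational.right_univ.image (fun _ : B => ([] : List A))
    fun a : B => [some a]).mul (.single [] [none])).congr fun x y => ?_
  constructor
  · rintro ⟨_, _, _, _, ⟨x, y, rfl, rfl, rfl⟩, ⟨rfl, rfl⟩, rfl, rfl⟩
    exact ⟨rfl, y, by simp [← List.map_eq_flatMap]⟩
  · rintro ⟨rfl, D, rfl⟩
    exact ⟨_, _, _, _, ⟨[], D, rfl, rfl, rfl⟩, ⟨rfl, rfl⟩, rfl,
      by simp [← List.map_eq_flatMap]⟩

theorem Rational.enc_left {F : List B → Prop} (hF : Rational fun x (y : List B) => F x ∧ y = []) :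
    Rational fun (x y : List (Option B)) => (∃ C, F C ∧ x = enc [C]) ∧ y = [] := by
  refine ((hF.image (fun a => [some a]) (fun a => [some a])).mul
    (.single [none] [])).congr fun x y => ?_
  constructor
  · rintro ⟨_, _, _, _, ⟨x, y, ⟨h, rfl⟩, rfl, rfl⟩, ⟨rfl, rfl⟩, rfl, rfl⟩
    exact ⟨⟨x, h, by simp [← List.map_eq_flatMap]⟩, rfl⟩
  · rintro ⟨⟨C, h, rfl⟩, rfl⟩
    exact ⟨_, _, _, _, ⟨C, [], ⟨h, rfl⟩, rfl, rfl⟩, ⟨rfl, rfl⟩,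
      by simp [← List.map_eq_flatMap], rfl⟩

theorem Rational.enc_of_length [Finite B] (n : ℕ) : Rational fun x y : List (Option B) =>
    x = y ∧ ∃ t : List (List B), t.length = n ∧ x = enc t := by
  induction n with
  | zero =>
    refine (Rational.single [] []).congr fun x y => ?_
    constructor
    · rintro ⟨rfl, rfl⟩; exact ⟨rfl, [], rfl, rfl⟩
    · rintro ⟨rfl, t, ht, rfl⟩; simp [List.length_eq_zero_iff.1 ht]
  | succ n ih =>
    refine (Rational.eq.blockRel.mul ih).congr fun x y => ?_
    constructor
    · rintro ⟨_, _, _, _, ⟨l, _, rfl, rfl, rfl⟩, ⟨rfl, t, ht, rfl⟩, rfl, rfl⟩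
      exact ⟨rfl, l :: t, by simp [ht], by simp⟩
    · rintro ⟨rfl, t, ht, rfl⟩
      cases t with
      | nil => simp at ht
      | cons l t =>
        exact ⟨_, _, _, _, ⟨l, l, rfl, rfl, rfl⟩, ⟨rfl, t, by simpa using ht, rfl⟩, by simp,
          by simp⟩

/-- The words that `computation S F` relates to themselves are the encodings of the finite
sequences of `S`-steps that end in `F`: the first word `C₀, …, Cₘ` is compared with a second word
`D₀, …, Dₘ` shifted by one position. -/
def computation (S : List B → List B → Prop) (F : List B → Prop) (x y : List (Option B)) : Prop :=
  ∃ Cs C D Ds, List.Forall₂ S Cs Ds ∧ F C ∧ x = enc (Cs ++ [C]) ∧ y = enc (D :: Ds)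

theorem Rational.computation [Finite B] {S : List B → List B → Prop} {F : List B → Prop}
    (hS : Rational S) (hF : Rational fun x (y : List B) => F x ∧ y = []) :
    Rational (computation S F) := by
  refine (Rational.enc_right.mul (hS.blockRel.star.mul hF.enc_left)).congr fun x y => ?_
  constructor
  · rintro ⟨_, _, _, _, ⟨rfl, D, rfl⟩, ⟨_, _, _, _, h, ⟨⟨C, hC, rfl⟩, rfl⟩, rfl, rfl⟩, rfl, rfl⟩
    obtain ⟨Cs, Ds, h', rfl, rfl⟩ := relStar_blockRel.1 h
    exact ⟨Cs, C, D, Ds, h', hC, by simp, by simp⟩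
  · rintro ⟨Cs, C, D, Ds, h, hC, rfl, rfl⟩
    exact ⟨[], enc [D], _, enc Ds, ⟨rfl, D, rfl⟩, ⟨_, _, enc [C], [],
      relStar_blockRel.2 ⟨Cs, Ds, h, rfl, rfl⟩, ⟨⟨C, hC, rfl⟩, rfl⟩, rfl, by simp⟩, by simp,
      by simp⟩

/-- A word is related to itself by `computation S F` if and only if the successors of its
configurations, shifted by one, are its configurations again: it encodes an `S`-path that ends
in `F`. -/
theorem exists_computation_iff {S : List B → List B → Prop} {F : List B → Prop} {I : List B} :
    (∃ x, computation S F x x ∧ enc [I] <+: x) ↔ ∃ C, Relation.ReflTransGen S I C ∧ F C := by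
  constructor
  · rintro ⟨_, ⟨Cs, C, D, Ds, h1, h2, rfl, h3⟩, u, h4⟩
    replace h3 := enc_injective h3
    obtain ⟨s, h5, -⟩ := enc_append_eq h4
    refine ⟨C, ?_, h2⟩
    rw [h3] at h5
    obtain ⟨rfl, -⟩ := List.cons.inj h5
    clear h4 h5
    induction Cs generalizing D Ds with
    | nil =>
      simp only [List.nil_append, List.cons.injEq] at h3
      rw [h3.1]
    | cons c Cs ih =>
      cases h1 with
      | cons h1 h1' =>
        simp only [List.cons_append, List.cons.injEq] at h3
        obtain ⟨rfl, h3⟩ := h3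
        exact .head h1 (ih _ _ h1' h3)
  · rintro ⟨C, h, hC⟩
    suffices ∃ Cs Ds, List.Forall₂ S Cs Ds ∧ Cs ++ [C] = I :: Ds by
      obtain ⟨Cs, Ds, h1, h2⟩ := this
      refine ⟨enc (I :: Ds), ⟨Cs, C, I, Ds, h1, hC, by rw [h2], rfl⟩, enc Ds, by simp⟩
    induction h using Relation.ReflTransGen.head_induction_on with
    | refl => exact ⟨[], [], .nil, rfl⟩
    | @head a c h _ ih =>
      obtain ⟨Cs, Ds, h1, h2⟩ := ih
      exact ⟨a :: Cs, c :: Ds, .cons h h1, by simp [h2]⟩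

end Blocks

/-! ### Stack machines as rational relations -/

/-- What a step of a stack machine does to a stack. -/
inductive StackOp (Γ : Type)
  | push (a : Γ)
  | keep
  | pop

namespace StackOp

variable {Γ : Type}

def act : StackOp Γ → List Γ → List Γ
  | push a, l => a :: l
  | keep, l => l
  | pop, l => l.tail

/-- The replacement of the first letter of a terminated stack that performs an operation. -/
def out : StackOp Γ → Option Γ → List (Option Γ)
  | push a, c => [some a, c]
  | keep, c => [c]
  | pop, some _ => []
  | pop, none => [none]

theorem out_append (o : StackOp Γ) {c : Option Γ} {l : List Γ} {w r : List (Option Γ)}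
    (h : c :: w = l.map some ++ none :: r) :
    c = l.head? ∧ o.out c ++ w = (o.act l).map some ++ none :: r := by
  cases l <;> cases o <;> simp_all [act, out]

end StackOp

/-- A machine with several stacks. In state `q` it applies `op q` to the stack number `stack q`; if
`c` is the top of that stack, it may go to any state `q'` with `next q c q'`. -/
structure StackMachine (Q Γ : Type) where
  stack : Q → ℕ
  op : Q → StackOp Γ
  next : Q → Option Γ → Q → Prop

namespace StackMachine

variable {Q Γ : Type} (M : StackMachine Q Γ)

/-- One step of the machine, on configurations made of a state and a list of stacks. -/
def Step (C D : Q × List (List Γ)) : Prop :=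
  ∃ t l r, C.2 = t ++ l :: r ∧ t.length = M.stack C.1 ∧ M.next C.1 l.head? D.1 ∧
    D.2 = t ++ (M.op C.1).act l :: r

/-- A configuration as a word. -/
def confWord (C : Q × List (List Γ)) : List (Q ⊕ Option Γ) :=
  .inl C.1 :: (enc C.2).map .inr

/-- One step of the machine, as a rewriting of words. -/
def WordStep (x y : List (Q ⊕ Option Γ)) : Prop :=
  ∃ i : Q × Option Γ × Q, M.next i.1 i.2.1 i.2.2 ∧ ∃ t w, t.length = M.stack i.1 ∧
    x = .inl i.1 :: (enc t ++ i.2.1 :: w).map .inr ∧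
    y = .inl i.2.2 :: (enc t ++ (M.op i.1).out i.2.1 ++ w).map .inr

theorem wordStep_confWord {C : Q × List (List Γ)} {y : List (Q ⊕ Option Γ)} :
    M.WordStep (confWord C) y ↔ ∃ D, M.Step C D ∧ y = confWord D := by
  obtain ⟨q, s⟩ := C
  constructor
  · rintro ⟨⟨q, c, q'⟩, hn, t, w, ht, h, rfl⟩
    simp only [confWord, List.cons.injEq, Sum.inl.injEq] at h
    obtain ⟨rfl, h1⟩ := h
    obtain ⟨s', rfl, h2⟩ := enc_append_eq (List.map_injective_iff.2 Sum.inr_injective h1).symm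
    cases s' with
    | nil => simp at h2
    | cons l r =>
      rw [enc_cons] at h2
      obtain ⟨rfl, h'⟩ := (M.op q).out_append h2
      refine ⟨(q', t ++ (M.op q).act l :: r), ⟨t, l, r, rfl, ht, hn, rfl⟩, ?_⟩
      simp only [confWord, List.append_assoc, h', enc_append, enc_cons]
  · rintro ⟨⟨q', s'⟩, ⟨t, l, r, rfl, ht, hn, rfl⟩, rfl⟩
    obtain ⟨w, hw⟩ : ∃ w, l.head? :: w = l.map some ++ none :: enc r := by
      cases l <;> simp
    refine ⟨(q, l.head?, q'), hn, t, w, ht, ?_, ?_⟩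
    · simp [confWord, ← hw]
    · simp [confWord, ← ((M.op q).out_append hw).2]

theorem reflTransGen_wordStep {C : Q × List (List Γ)} {y : List (Q ⊕ Option Γ)} :
    Relation.ReflTransGen M.WordStep (confWord C) y ↔
      ∃ D, Relation.ReflTransGen M.Step C D ∧ y = confWord D := by
  constructor
  · intro h
    induction h with
    | refl => exact ⟨C, .refl, rfl⟩
    | tail _ h ih =>
      obtain ⟨D, h1, rfl⟩ := ih
      obtain ⟨E, h2, rfl⟩ := M.wordStep_confWord.1 h
      exact ⟨E, h1.tail h2, rfl⟩
  · rintro ⟨D, h, rfl⟩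
    exact h.lift _ fun _ _ h => M.wordStep_confWord.2 ⟨_, h, rfl⟩

variable [Finite Q] [Finite Γ]

theorem rational_wordStep : Rational M.WordStep := by
  refine Rational.iUnion (ι := Q × Option Γ × Q) fun ⟨q, c, q'⟩ => ?_
  by_cases hn : M.next q c q'
  · refine ((Rational.single [.inl q] [.inl q']).mul ((((Rational.enc_of_length (M.stack q)).mul
      (.single [c] ((M.op q).out c))).mul .eq).image (fun a => [.inr a])
        fun a => [.inr a])).congr fun x y => ?_
    simp only [hn, true_and]
    constructor
    · rintro ⟨_, _, _, _, ⟨rfl, rfl⟩, ⟨_, _, ⟨_, _, w, _, ⟨_, _, _, _, ⟨rfl, t, ht, rfl⟩, ⟨rfl, rfl⟩,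
        rfl, rfl⟩, rfl, rfl, rfl⟩, rfl, rfl⟩, rfl, rfl⟩
      exact ⟨t, w, ht, by simp [← List.map_eq_flatMap], by simp [← List.map_eq_flatMap]⟩
    · rintro ⟨t, w, ht, rfl, rfl⟩
      exact ⟨_, _, _, _, ⟨rfl, rfl⟩, ⟨_, _, ⟨_, _, w, _, ⟨_, _, _, _, ⟨rfl, t, ht, rfl⟩, ⟨rfl, rfl⟩,
        rfl, rfl⟩, rfl, rfl, rfl⟩, rfl, rfl⟩, by simp [← List.map_eq_flatMap],
        by simp [← List.map_eq_flatMap]⟩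
  · exact Rational.empty.congr fun x y => by simp [hn]

theorem rational_state (F : Q → Prop) : Rational fun (x y : List (Q ⊕ Option Γ)) =>
    (∃ q w, F q ∧ x = .inl q :: w) ∧ y = [] := by
  refine (Rational.iUnion fun q : {q // F q} =>
    (Rational.single [.inl q.1] []).mul Rational.left_univ).congr fun x y => ?_
  constructor
  · rintro ⟨⟨q, hq⟩, _, _, w, _, ⟨rfl, rfl⟩, rfl, rfl, rfl⟩
    exact ⟨⟨q, w, hq, by simp⟩, by simp⟩
  · rintro ⟨⟨q, w, hq, rfl⟩, rfl⟩
    exact ⟨⟨q, hq⟩, _, _, w, _, ⟨rfl, rfl⟩, rfl, by simp, by simp⟩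

end StackMachine

/-! ### Turing machines performing one stack operation at a time -/

section Micro

open Turing

variable {K Γ Λ σ : Type} [DecidableEq K] [Inhabited K]

/-- A state of a machine that executes a `TM2` program one stack operation at a time: the rest of
the current statement, or `none` after halting, and the value of the local store. -/
abbrev MicroState (K Γ Λ σ : Type) := Option (TM2.Stmt (fun _ : K => Γ) Λ σ) × σ

/-- The stack used by the next operation; operations without stack may use any. -/
def microStack : MicroState K Γ Λ σ → K
  | (some (.push k _ _), _) => k
  | (some (.peek k _ _), _) => k
  | (some (.pop k _ _), _) => k
  | _ => default

/-- The operation performed on that stack. -/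
def microOp : MicroState K Γ Λ σ → StackOp Γ
  | (some (.push _ f _), v) => .push (f v)
  | (some (.pop _ _ _), _) => .pop
  | _ => .keep

/-- The next state; the second argument is the top of the stack in use. -/
def microNext (M : Λ → TM2.Stmt (fun _ : K => Γ) Λ σ) :
    MicroState K Γ Λ σ → Option Γ → Option (MicroState K Γ Λ σ)
  | (none, _), _ => none
  | (some (.push _ _ q), v), _ => some (some q, v)
  | (some (.peek _ f q), v), c => some (some q, f v c)
  | (some (.pop _ f q), v), c => some (some q, f v c)
  | (some (.load a q), v), _ => some (some q, a v)
  | (some (.branch f q₁ q₂), v), _ => some (some (cond (f v) q₁ q₂), v)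
  | (some (.goto l), v), _ => some (some (M (l v)), v)
  | (some .halt, v), _ => some (none, v)

/-- One stack operation, on full configurations. -/
def microStep (M : Λ → TM2.Stmt (fun _ : K => Γ) Λ σ) (c : MicroState K Γ Λ σ × (K → List Γ)) :
    Option (MicroState K Γ Λ σ × (K → List Γ)) :=
  (microNext M c.1 (c.2 (microStack c.1)).head?).map fun q =>
    (q, Function.update c.2 (microStack c.1) ((microOp c.1).act (c.2 (microStack c.1))))

theorem microStep_eq_none {M : Λ → TM2.Stmt (fun _ : K => Γ) Λ σ}
    {c : MicroState K Γ Λ σ × (K → List Γ)} : microStep M c = none ↔ c.1.1 = none := by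
  obtain ⟨⟨_ | s, v⟩, S⟩ := c
  · simp [microStep, microNext]
  · cases s <;> simp [microStep, microNext]

/-- The configurations of a `TM2` machine that correspond to a configuration between
operations. -/
def MicroRel (M : Λ → TM2.Stmt (fun _ : K => Γ) Λ σ) (c : TM2.Cfg (fun _ : K => Γ) Λ σ)
    (d : MicroState K Γ Λ σ × (K → List Γ)) : Prop :=
  d = ((c.l.map M, c.var), c.stk)

/-- Executing a program one operation at a time simulates the `TM2` semantics, in which a step
executes a whole statement. -/
theorem microStep_respects (M : Λ → TM2.Stmt (fun _ : K => Γ) Λ σ) :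
    StateTransition.Respects (TM2.step M) (microStep M) (MicroRel M) := by
  have key : ∀ (q : TM2.Stmt (fun _ : K => Γ) Λ σ) (v : σ) (S : K → List Γ),
      StateTransition.Reaches₁ (microStep M) ((some q, v), S)
        (((TM2.stepAux q v S).l.map M, (TM2.stepAux q v S).var), (TM2.stepAux q v S).stk) := by
    intro q
    induction q with
    | push k f q ih =>
      intro v S
      refine .head (b := ((some q, v), Function.update S k (f v :: S k))) ?_ (ih _ _)
      rfl
    | peek k f q ih =>
      intro v S
      refine .head (b := ((some q, f v (S k).head?), S)) ?_ (ih _ _)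
      simp [microStep, microNext, microStack, microOp, StackOp.act]
    | pop k f q ih =>
      intro v S
      refine .head (b := ((some q, f v (S k).head?), Function.update S k (S k).tail)) ?_ (ih _ _)
      rfl
    | load a q ih =>
      intro v S
      refine .head (b := ((some q, a v), S)) ?_ (ih _ _)
      simp [microStep, microNext, microStack, microOp, StackOp.act]
    | branch f q₁ q₂ ih₁ ih₂ =>
      intro v S
      refine .head (b := ((some (cond (f v) q₁ q₂), v), S)) ?_ ?_
      · simp [microStep, microNext, microStack, microOp, StackOp.act]
      · cases h : f v
        · simp only [h, cond_false, TM2.stepAux]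
          exact ih₂ v S
        · simp only [h, cond_true, TM2.stepAux]
          exact ih₁ v S
    | goto l =>
      intro v S
      refine .single ?_
      simp [microStep, microNext, microStack, microOp, StackOp.act]
    | halt =>
      intro v S
      refine .single ?_
      simp [microStep, microNext, microStack, microOp, StackOp.act]
  rintro ⟨_ | l, v, S⟩ _ rfl
  · simp [TM2.step, microStep, microNext]
  · exact ⟨_, rfl, key _ _ _⟩

end Micro

theorem microNext_mem_stmts {K Γ Λ σ : Type} [Inhabited Λ] {M : Λ → Turing.TM2.Stmt (fun _ : K => Γ) Λ σ} {F : Finset Λ}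
    (hF : Turing.TM2.Supports M F) {q q' : MicroState K Γ Λ σ} {c : Option Γ}
    (hq : q.1 ∈ Turing.TM2.stmts M F) (h : microNext M q c = some q') : q'.1 ∈ Turing.TM2.stmts M F := by
  obtain ⟨_ | s, v⟩ := q
  · simp [microNext] at h
  · cases s with
    | goto l =>
      obtain rfl : _ = q' := by simpa [microNext] using h
      have := Turing.TM2.stmts_supportsStmt hF hq v
      simp only [Turing.TM2.stmts, Finset.some_mem_insertNone, Finset.mem_biUnion]
      exact ⟨_, this, Turing.TM2.stmts₁_self⟩
    | halt =>
      obtain rfl : _ = q' := by simpa [microNext] using h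
      simp [Turing.TM2.stmts]
    | branch f q₁ q₂ =>
      obtain rfl : _ = q' := by simpa [microNext] using h
      refine Turing.TM2.stmts_trans ?_ hq
      cases f v <;> simp [Turing.TM2.stmts₁, Turing.TM2.stmts₁_self]
    | _ =>
      obtain rfl : _ = q' := by simpa [microNext] using h
      refine Turing.TM2.stmts_trans ?_ hq
      simp [Turing.TM2.stmts₁, Turing.TM2.stmts₁_self]


/-! ### A rational relation with an undecidable correspondence problem -/

section Undecidable

open Turing PartrecToTM2

/-- The number of a stack. -/
def stackIndex : K' → ℕ
  | .main => 0
  | .rev => 1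
  | .aux => 2
  | .stack => 3

/-- The four stacks in the order of `stackIndex`. -/
def stackList (S : K' → List Γ') : List (List Γ') := [S .main, S .rev, S .aux, S .stack]

theorem stackList_eq_append {S : K' → List Γ'} {k : K'} {t : List (List Γ')} {l : List Γ'}
    {r : List (List Γ')} (h : stackList S = t ++ l :: r) (ht : t.length = stackIndex k) (l' : List Γ') :
    l = S k ∧ stackList (Function.update S k l') = t ++ l' :: r := by
  have h1 : (stackList S)[stackIndex k]? = some l := by rw [h, ← ht]; simp
  have h2 : stackList (Function.update S k l') = (stackList S).set (stackIndex k) l' := by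
    cases k <;> simp [stackList, stackIndex, Function.update]
  refine ⟨?_, ?_⟩
  · cases k <;> simpa [stackList, stackIndex, eq_comm] using h1
  · rw [h2, h, ← ht]; simp

theorem exists_stackList_eq_append (S : K' → List Γ') (k : K') :
    ∃ t r, stackList S = t ++ S k :: r ∧ t.length = stackIndex k := by
  cases k
  exacts [⟨[], _, rfl, rfl⟩, ⟨[_], _, rfl, rfl⟩, ⟨[_, _], _, rfl, rfl⟩, ⟨[_, _, _], _, rfl, rfl⟩]

/-- The program that evaluates codes. -/
def codeProgram : Λ' → TM2.Stmt (fun _ : K' => Γ') Λ' (Option Γ') := tr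

/-- The states that occur when a code is evaluated. -/
abbrev CodeState (c : ToPartrec.Code) :=
  {s // s ∈ TM2.stmts codeProgram (codeSupp c .halt)} × Option Γ'

/-- The machine that evaluates a code. -/
def codeMachine (c : ToPartrec.Code) : StackMachine (CodeState c) Γ' where
  stack q := stackIndex (microStack (q.1.1, q.2))
  op q := microOp (q.1.1, q.2)
  next q a q' := microNext codeProgram (q.1.1, q.2) a = some (q'.1.1, q'.2)

theorem codeMachine_step {c : ToPartrec.Code} {q : CodeState c} {S : K' → List Γ'}
    {D : CodeState c × List (List Γ')} :
    (codeMachine c).Step (q, stackList S) D ↔ ∃ S', D.2 = stackList S' ∧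
      microStep codeProgram ((q.1.1, q.2), S) = some ((D.1.1.1, D.1.2), S') := by
  simp only [microStep, Option.map_eq_some_iff, Prod.mk.injEq, StackMachine.Step]
  constructor
  · rintro ⟨t, l, r, h1, h2, h3, h4⟩
    obtain ⟨rfl, h5⟩ := stackList_eq_append h1 h2
      ((microOp (q.1.1, q.2)).act l)
    exact ⟨_, h4.trans h5.symm, _, h3, rfl, rfl⟩
  · rintro ⟨_, h1, q', h2, rfl, rfl⟩
    obtain ⟨t, r, h3, h4⟩ := exists_stackList_eq_append S
      (microStack (q.1.1, q.2))
    exact ⟨t, _, r, h3, h4, h2, h1.trans (stackList_eq_append h3 h4 _).2⟩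

theorem codeSupp_supports' (c : ToPartrec.Code) : @TM2.Supports K' (fun _ => Γ') Λ' (Option Γ')
    ⟨trNormal c .halt⟩ codeProgram (codeSupp c .halt) := tr_supports c .halt

theorem codeMachine_reaches {c : ToPartrec.Code} {q : CodeState c} {S : K' → List Γ'} :
    (∃ D, Relation.ReflTransGen (codeMachine c).Step (q, stackList S) D ∧ D.1.1.1 = none) ↔
      (StateTransition.eval (microStep codeProgram) ((q.1.1, q.2), S)).Dom := by
  rw [Part.dom_iff_mem]
  simp only [StateTransition.mem_eval]
  constructor
  · rintro ⟨D, h, hD⟩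
    have : ∃ S', D.2 = stackList S' ∧
        StateTransition.Reaches (microStep codeProgram) ((q.1.1, q.2), S)
          ((D.1.1.1, D.1.2), S') := by
      clear hD
      induction h with
      | refl => exact ⟨S, rfl, .refl⟩
      | @tail D E _ h ih =>
        obtain ⟨S', h1, h2⟩ := ih
        obtain ⟨D, T⟩ := D
        obtain rfl : T = _ := h1
        obtain ⟨S'', h3, h4⟩ := codeMachine_step.1 h
        exact ⟨S'', h3, h2.tail h4⟩
    obtain ⟨S', -, h'⟩ := this
    exact ⟨_, h', microStep_eq_none.2 hD⟩
  · rintro ⟨b, h, hb⟩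
    have : ∃ D : CodeState c, (D.1.1, D.2) = b.1 ∧
        Relation.ReflTransGen (codeMachine c).Step (q, stackList S) (D, stackList b.2) := by
      clear hb
      induction h with
      | refl => exact ⟨q, rfl, .refl⟩
      | @tail d e _ h ih =>
        obtain ⟨D, h1, h2⟩ := ih
        obtain ⟨d, T⟩ := d
        obtain rfl : _ = d := h1
        have h3 : e.1.1 ∈ TM2.stmts codeProgram (codeSupp c .halt) := by
          obtain ⟨q', h3, rfl⟩ := Option.map_eq_some_iff.1 h
          exact @microNext_mem_stmts K' Γ' Λ' (Option Γ') ⟨trNormal c .halt⟩ _ _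
            (codeSupp_supports' c) _ _ _ D.1.2 h3
        exact ⟨(⟨e.1.1, h3⟩, e.1.2), rfl, h2.tail (codeMachine_step.2 ⟨e.2, rfl, h⟩)⟩
    obtain ⟨D, h1, h2⟩ := this
    exact ⟨_, h2, (congrArg Prod.fst h1).trans (microStep_eq_none.1 hb)⟩

/-- The state in which the evaluation of a code begins. -/
def codeStart (c : ToPartrec.Code) : CodeState c :=
  (⟨some (codeProgram (trNormal c .halt)), by
    simp only [TM2.stmts, Finset.some_mem_insertNone, Finset.mem_biUnion]
    exact ⟨_, (codeSupp_supports' c).1, TM2.stmts₁_self⟩⟩, none)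

/-- The machine reaches a halting state on `v` if and only if the code is defined at `v`. -/
theorem codeMachine_halts (c : ToPartrec.Code) (v : List ℕ) :
    (∃ D, Relation.ReflTransGen (codeMachine c).Step (codeStart c, [trList v, [], [], []]) D ∧
      D.1.1.1 = none) ↔ (c.eval v).Dom := by
  refine (codeMachine_reaches (S := K'.elim (trList v) [] [] [])).trans ?_
  have h1 := StateTransition.tr_eval_dom (microStep_respects codeProgram)
    (a₁ := init c v) rfl
  refine h1.trans ?_
  have h2 := tr_eval c v
  exact (iff_of_eq (congrArg Part.Dom h2)).trans (by simp)

end Undecidable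

section Undecidable

open Turing PartrecToTM2

/-- The successor on binary numbers, least significant digit first. -/
def incBits : List Bool → List Bool
  | [] => [true]
  | false :: l => true :: l
  | true :: l => false :: incBits l

theorem incBits_primrec : Primrec incBits := by
  have h : Primrec fun l : List Bool => (List.recOn l [true]
      fun b l r => cond b (false :: r) (true :: l) : List Bool) :=
    Primrec.list_rec Primrec.id (Primrec.const [true])
      (h := fun _ (p : Bool × List Bool × List Bool) =>
        cond p.1 (false :: p.2.2) (true :: p.2.1))
      (Primrec.cond (Primrec.fst.comp Primrec.snd)
        (Primrec.list_cons.comp (Primrec.const false) (Primrec.snd.comp (Primrec.snd.comp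
          Primrec.snd)))
        (Primrec.list_cons.comp (Primrec.const true) (Primrec.fst.comp (Primrec.snd.comp
          Primrec.snd))))
  refine h.of_eq fun l => ?_
  induction l with
  | nil => rfl
  | cons b l ih => cases b <;> simp_all [incBits]

theorem trPosNum_succ (p : PosNum) (l : List Bool)
    (h : trPosNum p = l.map fun b => cond b Γ'.bit1 Γ'.bit0) :
    trPosNum p.succ = (incBits l).map fun b => cond b Γ'.bit1 Γ'.bit0 := by
  induction p generalizing l with
  | one =>
    obtain _ | ⟨_ | _, _ | ⟨_, _⟩⟩ := l <;> simp [trPosNum] at h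
    simp [PosNum.succ, trPosNum, incBits]
  | bit0 p _ =>
    obtain _ | ⟨_ | _, l⟩ := l <;> simp [trPosNum] at h
    simp [PosNum.succ, trPosNum, incBits, h]
  | bit1 p ih =>
    obtain _ | ⟨_ | _, l⟩ := l <;> simp [trPosNum] at h
    simp [PosNum.succ, trPosNum, incBits, ih l h]

theorem trNat_eq_map (n : ℕ) :
    trNat n = (incBits^[n] []).map fun b => cond b Γ'.bit1 Γ'.bit0 := by
  induction n with
  | zero => simp
  | succ n ih =>
    rw [Function.iterate_succ_apply']
    generalize incBits^[n] [] = l at ih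
    have h : ((n + 1 : ℕ) : Num) = (n : Num).succ := by
      rw [Nat.cast_succ, Num.add_one]
    rw [trNat, h]
    rw [trNat] at ih
    cases hn : (n : Num) with
    | zero =>
      rw [hn] at ih
      obtain rfl : l = [] := by simpa [trNum] using ih
      simp [Num.succ, Num.succ', trNum, trPosNum, incBits]
    | pos p =>
      rw [hn] at ih
      exact trPosNum_succ p l ih

theorem trNat_map_primrec (f : Γ' → ℕ) : Primrec fun n => (trNat n).map f := by
  have h : Primrec fun n : ℕ => (incBits^[n] []).map fun b => f (cond b Γ'.bit1 Γ'.bit0) :=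
    Primrec.list_map (Primrec.nat_iterate Primrec.id (Primrec.const [])
      (incBits_primrec.comp Primrec.snd))
      ((Primrec.dom_finite fun b => f (cond b Γ'.bit1 Γ'.bit0)).comp Primrec.snd)
  refine h.of_eq fun n => ?_
  rw [trNat_eq_map, List.map_map]
  rfl

/-- Some code halts on an undecidable set of inputs. -/
theorem exists_code_halting_undecidable :
    ∃ c : ToPartrec.Code, ¬ ComputablePred fun n => (c.eval [n]).Dom := by
  let f : ℕ →. ℕ := fun n => (Denumerable.ofNat Nat.Partrec.Code n).eval 0
  have hf : Partrec f :=
    Nat.Partrec.Code.eval_part.comp (Computable.ofNat _) (Computable.const 0)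
  obtain ⟨c, hc⟩ := ToPartrec.Code.exists_code (Nat.Partrec'.part_iff₁.2 hf)
  refine ⟨c, fun h => ComputablePred.halting_problem 0 ?_⟩
  refine ComputablePred.computable_of_manyOneReducible ⟨Encodable.encode, Computable.encode,
    fun d => ?_⟩ h
  have := hc ⟨[Encodable.encode d], rfl⟩
  rw [this]
  simp [f, List.Vector.head]

/-- There is a rational relation `G` for which it is undecidable whether it relates some extension
of a given word `w` to itself. -/
theorem exists_rational_undecidable : ∃ (A : Type) (_ : Finite A) (G : List A → List A → Prop)
    (e : A → ℕ) (w : ℕ → List A), Rational G ∧ Function.Injective e ∧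
      (Computable fun n => (w n).map e) ∧
      ¬ ComputablePred fun n => ∃ x, G x x ∧ w n <+: x := by
  obtain ⟨c, hc⟩ := exists_code_halting_undecidable
  have hA : Finite (Option (CodeState c ⊕ Option Γ')) := inferInstance
  obtain ⟨m, ⟨e⟩⟩ := Finite.exists_equiv_fin (Option (CodeState c ⊕ Option Γ'))
  refine ⟨_, hA, computation (codeMachine c).WordStep (fun x => ∃ q w, q.1.1 = none ∧
    x = .inl q :: w), fun a => e a, fun n => enc [StackMachine.confWord (codeStart c,
      [trList [n], [], [], []])], ?_, ?_, ?_, ?_⟩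
  · exact (codeMachine c).rational_wordStep.computation (StackMachine.rational_state _)
  · exact fun a b h => e.injective (Fin.ext h)
  · have h : Primrec fun n => ((e (some (.inl (codeStart c))) : ℕ) ::
        ((trNat n).map fun a => (e (some (.inr (some a))) : ℕ))) ++
        ([some (.inr (some .cons)), some (.inr none), some (.inr none), some (.inr none),
          some (.inr none), none] : List (Option (CodeState c ⊕ Option Γ'))).map
          fun a => (e a : ℕ) :=
      Primrec.list_append.comp (Primrec.list_cons.comp (Primrec.const _) (trNat_map_primrec _))
        (Primrec.const _)
    refine (h.of_eq fun n => ?_).to_comp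
    simp [StackMachine.confWord, Function.comp_def]
  · intro h
    refine hc (h.of_eq fun n => ?_)
    rw [exists_computation_iff, ← codeMachine_halts]
    constructor
    · rintro ⟨C, h1, q, w, hq, rfl⟩
      obtain ⟨D, h2, h3⟩ := (codeMachine c).reflTransGen_wordStep.1 h1
      simp only [StackMachine.confWord, List.cons.injEq, Sum.inl.injEq] at h3
      exact ⟨D, h2, h3.1 ▸ hq⟩
    · rintro ⟨D, h1, h2⟩
      exact ⟨_, (codeMachine c).reflTransGen_wordStep.2 ⟨D, h1, rfl⟩, D.1, _, h2, rfl⟩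

end Undecidable

/-! ### Linking blocks of two words -/

section Link

/-- One step of a simultaneous reading of two sequences of blocks: skip a block on one side, or
link a block on the left with a block on the right. The flags of a link tell whether its left or
its right end is special. -/
inductive LinkOp
  | skipLeft
  | skipRight
  | link (a b : Bool)

/-- The marks of the blocks read on the left: `none` for skipped blocks, the flag for the ends of
links. -/
def LinkOp.left : LinkOp → List (Option Bool)
  | skipLeft => [none]
  | skipRight => []
  | link a _ => [some a]

/-- The marks of the blocks read on the right. -/
def LinkOp.right : LinkOp → List (Option Bool)
  | skipLeft => []
  | skipRight => [none]
  | link _ b => [some b]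

/-- Marks with as many link ends on both sides come from a list of operations. -/
theorem exists_linkOps (l r : List (Option Bool))
    (h : l.countP Option.isSome = r.countP Option.isSome) :
    ∃ s : List LinkOp, s.flatMap LinkOp.left = l ∧ s.flatMap LinkOp.right = r := by
  induction l generalizing r with
  | nil =>
    induction r with
    | nil => exact ⟨[], rfl, rfl⟩
    | cons b r ih =>
      cases b with
      | none =>
        obtain ⟨s, h1, h2⟩ := ih (by simpa using h)
        exact ⟨.skipRight :: s, by simpa [LinkOp.left] using h1, by simp [LinkOp.right, h2]⟩
      | some b => simp at h
  | cons a l ih =>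
    cases a with
    | none =>
      obtain ⟨s, h1, h2⟩ := ih r (by simpa using h)
      exact ⟨.skipLeft :: s, by simp [LinkOp.left, h1], by simpa [LinkOp.right] using h2⟩
    | some a =>
      induction r with
      | nil => simp at h
      | cons b r ih' =>
        cases b with
        | none =>
          obtain ⟨s, h1, h2⟩ := ih' (by simpa using h)
          exact ⟨.skipRight :: s, by simpa [LinkOp.left] using h1, by simp [LinkOp.right, h2]⟩
        | some b =>
          obtain ⟨s, h1, h2⟩ := ih r (by simpa using h)
          exact ⟨.link a b :: s, by simp [LinkOp.left, h1], by simp [LinkOp.right, h2]⟩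

variable {A : Type}

/-- Linked blocks are equal, except for links with a special end, which are related by `G`. -/
inductive Linked (G : List A → List A → Prop) :
    List LinkOp → List (List A) → List (List A) → Prop
  | nil : Linked G [] [] []
  | skipLeft (x) {s xs ys} : Linked G s xs ys → Linked G (.skipLeft :: s) (x :: xs) ys
  | skipRight (y) {s xs ys} : Linked G s xs ys → Linked G (.skipRight :: s) xs (y :: ys)
  | link (a b) {x y s xs ys} : (if a || b then G x y else x = y) → Linked G s xs ys →
      Linked G (.link a b :: s) (x :: xs) (y :: ys)

theorem Rational.linked [Finite A] {G : List A → List A → Prop} (hG : Rational G)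
    (s : List LinkOp) :
    Rational fun x y => ∃ xs ys, Linked G s xs ys ∧ x = enc xs ∧ y = enc ys := by
  induction s with
  | nil =>
    refine (Rational.single [] []).congr fun x y => ?_
    constructor
    · rintro ⟨rfl, rfl⟩; exact ⟨[], [], .nil, rfl, rfl⟩
    · rintro ⟨_, _, ⟨⟩, rfl, rfl⟩; exact ⟨rfl, rfl⟩
  | cons o s ih =>
    cases o with
    | skipLeft =>
      have h : Rational fun (x y : List A) => True ∧ y = [] :=
        Rational.left_univ.congr fun x y => by simp
      refine (h.enc_left.mul ih).congr fun x y => ?_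
      constructor
      · rintro ⟨_, _, _, _, ⟨⟨x, -, rfl⟩, rfl⟩, ⟨xs, ys, h, rfl, rfl⟩, rfl, rfl⟩
        exact ⟨_, _, h.skipLeft x, by simp, by simp⟩
      · rintro ⟨_, _, h, rfl, rfl⟩
        cases h with
        | skipLeft x h =>
          exact ⟨enc [x], [], _, _, ⟨⟨x, trivial, rfl⟩, rfl⟩, ⟨_, _, h, rfl, rfl⟩, by simp,
            by simp⟩
    | skipRight =>
      refine (Rational.enc_right.mul ih).congr fun x y => ?_
      constructor
      · rintro ⟨_, _, _, _, ⟨rfl, y, rfl⟩, ⟨xs, ys, h, rfl, rfl⟩, rfl, rfl⟩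
        exact ⟨_, _, h.skipRight y, by simp, by simp⟩
      · rintro ⟨_, _, h, rfl, rfl⟩
        cases h with
        | skipRight y h =>
          exact ⟨[], enc [y], _, _, ⟨rfl, y, rfl⟩, ⟨_, _, h, rfl, rfl⟩, by simp, by simp⟩
    | link a b =>
      have h : Rational fun x y : List A => if a || b then G x y else x = y := by
        by_cases hab : (a || b) = true
        · simpa only [hab, if_true] using hG
        · simpa only [hab, Bool.false_eq_true, if_false] using Rational.eq
      refine (h.blockRel.mul ih).congr fun x y => ?_
      constructor
      · rintro ⟨_, _, _, _, ⟨x, y, h, rfl, rfl⟩, ⟨xs, ys, h', rfl, rfl⟩, rfl, rfl⟩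
        exact ⟨_, _, h'.link a b h, by simp, by simp⟩
      · rintro ⟨_, _, ⟨⟩, rfl, rfl⟩
        exact ⟨_, _, _, _, ⟨_, _, ‹_›, rfl, rfl⟩, ⟨_, _, ‹_›, rfl, rfl⟩, by simp, by simp⟩

/-- If `G x x`, then sequences of blocks all equal to `x` are linked in every way. -/
theorem linked_replicate {G : List A → List A → Prop} {x : List A} (hx : G x x)
    (s : List LinkOp) : Linked G s (List.replicate (s.flatMap LinkOp.left).length x)
      (List.replicate (s.flatMap LinkOp.right).length x) := by
  induction s with
  | nil => exact .nil
  | cons o s ih =>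
    cases o with
    | skipLeft =>
      exact ih.skipLeft x
    | skipRight =>
      exact ih.skipRight x
    | link a b =>
      exact ih.link a b (x := x) (y := x) (by split <;> simp [hx])

open Classical in
/-- The number of times a marked block counts in the parity argument: once if it is the end of a
link and equals `w`, and once if it is special. -/
noncomputable def linkCount (w : List A) (c : Option Bool × List A) : ℕ :=
  (if c.1.isSome ∧ c.2 = w then 1 else 0) + if c.1 = some true then 1 else 0

/-- If all special blocks equal `w`, but `w` is not related to itself, then both ends of a link
together count an even number of times. -/
theorem even_linkCount {G : List A → List A → Prop} {w : List A} (hw : ¬ G w w)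
    {s : List LinkOp} {l r : List (Option Bool × List A)}
    (h : Linked G s (l.map Prod.snd) (r.map Prod.snd))
    (hl : l.map Prod.fst = s.flatMap LinkOp.left) (hr : r.map Prod.fst = s.flatMap LinkOp.right)
    (hlw : ∀ c ∈ l, c.1 = some true → c.2 = w) (hrw : ∀ c ∈ r, c.1 = some true → c.2 = w) :
    Even ((l.map (linkCount w)).sum + (r.map (linkCount w)).sum) := by
  induction s generalizing l r with
  | nil =>
    obtain rfl : l = [] := by simpa using hl
    obtain rfl : r = [] := by simpa using hr
    simp
  | cons o s ih =>
    cases o with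
    | skipLeft =>
      obtain _ | ⟨⟨m, x⟩, l⟩ := l
      · simp [LinkOp.left] at hl
      obtain ⟨rfl, hl'⟩ : m = none ∧ l.map Prod.fst = s.flatMap LinkOp.left := by
        simpa [LinkOp.left] using hl
      cases h with
      | skipLeft _ h =>
        simpa [linkCount] using ih h hl' hr (fun c hc => hlw c (by simp [hc])) hrw
    | skipRight =>
      obtain _ | ⟨⟨m, x⟩, r⟩ := r
      · simp [LinkOp.right] at hr
      obtain ⟨rfl, hr'⟩ : m = none ∧ r.map Prod.fst = s.flatMap LinkOp.right := by
        simpa [LinkOp.right] using hr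
      generalize hxs : l.map Prod.snd = xs at h
      cases h with
      | skipRight _ h =>
        subst hxs
        simpa [linkCount] using ih h hl hr' hlw (fun c hc => hrw c (by simp [hc]))
    | link a b =>
      obtain _ | ⟨⟨m, x⟩, l⟩ := l
      · simp [LinkOp.left] at hl
      obtain ⟨rfl, hl'⟩ : m = some a ∧ l.map Prod.fst = s.flatMap LinkOp.left := by
        simpa [LinkOp.left] using hl
      obtain _ | ⟨⟨m, y⟩, r⟩ := r
      · simp [LinkOp.right] at hr
      obtain ⟨rfl, hr'⟩ : m = some b ∧ r.map Prod.fst = s.flatMap LinkOp.right := by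
        simpa [LinkOp.right] using hr
      cases h with
      | link _ _ hxy h =>
        have h1 := ih h hl' hr' (fun c hc => hlw c (by simp [hc])) (fun c hc => hrw c (by simp [hc]))
        have h2 : Even (linkCount w (some a, x) + linkCount w (some b, y)) := by
          have h3 : a = true → x = w := fun h => hlw (some a, x) (by simp) (by simp [h])
          have h4 : b = true → y = w := fun h => hrw (some b, y) (by simp) (by simp [h])
          cases a <;> cases b
          · obtain rfl : x = y := by simpa using hxy
            by_cases hx : x = w <;> simp [linkCount, hx]
          · obtain rfl := h4 rfl
            have : x ≠ y := by rintro rfl; exact hw (by simpa using hxy)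
            simp [linkCount, this]
          · obtain rfl := h3 rfl
            have : y ≠ x := by rintro rfl; exact hw (by simpa using hxy)
            simp [linkCount, this]
          · obtain rfl := h3 rfl
            obtain rfl := h4 rfl
            exact (hw (by simpa using hxy)).elim
        have h5 := h2.add h1
        simp only [List.map_cons, List.sum_cons]
        rwa [add_add_add_comm] at h5

end Link

/-! ### Words over two letters -/

section Code

variable {k : ℕ} {A : Type}

/-- The code of a letter, or of the terminator `none`, in unary. -/
def letterCode (z o : Fin k) (e : A → ℕ) (a : Option A) : Word k :=
  List.replicate (a.elim 0 fun a => e a + 1) o ++ [z]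

theorem letterCode_append_inj {z o : Fin k} (hzo : z ≠ o) {e : A → ℕ} (he : Function.Injective e)
    {a b : Option A} {u v : Word k} (h : letterCode z o e a ++ u = letterCode z o e b ++ v) :
    a = b ∧ u = v := by
  have key : ∀ m n : ℕ, List.replicate m o ++ z :: u = List.replicate n o ++ z :: v →
      m = n ∧ u = v := by
    intro m
    induction m with
    | zero =>
      rintro (_ | n) h
      · simpa using h
      · simp [List.replicate_succ, hzo] at h
    | succ m ih =>
      rintro (_ | n) h
      · simp [List.replicate_succ, hzo.symm] at h
      · simp only [List.replicate_succ, List.cons_append, List.cons.injEq, true_and] at h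
        obtain ⟨h1, h2⟩ := ih n h
        exact ⟨by rw [h1], h2⟩
  obtain ⟨h1, h2⟩ := key _ _ (by simpa [letterCode] using h)
  refine ⟨?_, h2⟩
  cases a <;> cases b <;> simp at h1
  · rfl
  · rw [he h1]

theorem flatMap_letterCode_append {z o : Fin k} (hzo : z ≠ o) {e : A → ℕ}
    (he : Function.Injective e) {u v : List (Option A)} {r : Word k}
    (h : u.flatMap (letterCode z o e) ++ r = v.flatMap (letterCode z o e)) :
    ∃ v', v = u ++ v' ∧ r = v'.flatMap (letterCode z o e) := by
  induction u generalizing v with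
  | nil => exact ⟨v, rfl, h⟩
  | cons a u ih =>
    cases v with
    | nil => simp [letterCode] at h
    | cons b v =>
      simp only [List.flatMap_cons, List.append_assoc] at h
      obtain ⟨rfl, h1⟩ := letterCode_append_inj hzo he h
      obtain ⟨v', rfl, h2⟩ := ih h1
      exact ⟨v', rfl, h2⟩

/-- A sequence of words over `A` as a word over `k` letters. -/
def blockWord (z o : Fin k) (e : A → ℕ) (xs : List (List A)) : Word k :=
  (enc xs).flatMap (letterCode z o e)

theorem blockWord_injective {z o : Fin k} (hzo : z ≠ o) {e : A → ℕ} (he : Function.Injective e) :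
    Function.Injective (blockWord z o e) := by
  intro xs ys h
  obtain ⟨v, h1, h2⟩ := flatMap_letterCode_append hzo he (r := [])
    (by simpa [blockWord] using h)
  refine enc_injective ?_
  cases v with
  | nil => simpa using h1.symm
  | cons a v => simp [letterCode] at h2

theorem blockWord_flatMap {ι : Type} (z o : Fin k) (e : A → ℕ) (f : ι → List (List A))
    (l : List ι) : (l.flatMap fun i => blockWord z o e (f i)) = blockWord z o e (l.flatMap f) := by
  induction l with
  | nil => rfl
  | cons i l ih => simp_all [blockWord]

theorem prefix_of_prefix_blockWord {z o : Fin k} (hzo : z ≠ o) {e : A → ℕ}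
    (he : Function.Injective e) {w x : List A} {xs : List (List A)} :
    (w.map some).flatMap (letterCode z o e) <+: blockWord z o e (x :: xs) ↔ w <+: x := by
  constructor
  · rintro ⟨r, hr⟩
    obtain ⟨v, h, -⟩ := flatMap_letterCode_append hzo he hr
    exact map_some_prefix_enc ⟨v, h.symm⟩
  · rintro ⟨r, rfl⟩
    exact ⟨(r.map some ++ none :: enc xs).flatMap (letterCode z o e), by simp [blockWord]⟩

end Code

/-! ### The formulae that express a correspondence problem along a chain -/

section Gadget

variable {S : Skeleton} {n : ℕ}

/-- The values `f p i` for all positions `p` on a side of a constraint and all tracks `i`. -/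
def sideList {α : Type} (j : Fin S.length) (b : Bool) (f : Position S → Fin (n + 1) → α) : List α :=
  (List.finRange (S.side j b).length).flatMap fun idx =>
    (List.finRange (n + 1)).map fun i => f ⟨j, b, idx⟩ i

theorem map_sideList {α β : Type} (j : Fin S.length) (b : Bool) (g : α → β)
    (f : Position S → Fin (n + 1) → α) :
    (sideList j b f).map g = sideList j b fun p i => g (f p i) := by
  simp [sideList, List.map_flatMap, Function.comp_def]

theorem mem_sideList {α : Type} {j : Fin S.length} {b : Bool}
    {f : Position S → Fin (n + 1) → α} {a : α} (h : a ∈ sideList j b f) : ∃ p i, f p i = a := by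
  simp only [sideList, List.mem_flatMap, List.mem_finRange, true_and, List.mem_map] at h
  obtain ⟨idx, i, h⟩ := h
  exact ⟨_, i, h⟩

theorem length_sideList {α β : Type} (j : Fin S.length) (b : Bool)
    (f : Position S → Fin (n + 1) → α) (g : Position S → Fin (n + 1) → β) :
    (sideList j b f).length = (sideList j b g).length := by
  simp [sideList]

theorem sum_sideList (j : Fin S.length) (b : Bool) (f : Position S → Fin (n + 1) → ℕ) :
    (sideList j b f).sum = ∑ idx, ∑ i, f ⟨j, b, idx⟩ i := by
  have h : ∀ (m : ℕ) (g : Fin m → ℕ), ((List.finRange m).map g).sum = ∑ i, g i := fun m g => by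
    rw [← List.ofFn_eq_map, List.sum_ofFn]
  simp only [sideList, List.flatMap, List.sum_flatten, List.map_map, Function.comp_def, h]

theorem flatMap_side {α : Type} (j : Fin S.length) (b : Bool) (f : ℕ → List α) :
    (S.side j b).flatMap f =
      (List.finRange (S.side j b).length).flatMap fun idx =>
        f (Position.var (S := S) ⟨j, b, idx⟩) := by
  conv_lhs => rw [← List.map_get_finRange (S.side j b), List.flatMap_map]
  rfl

open Classical in
theorem sum_idx_ite (y : Position S) (j : Fin S.length) (b : Bool) (c : ℕ) :
    (∑ idx, if (⟨j, b, idx⟩ : Position S) = y then c else 0) =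
      if j = y.con ∧ b = y.right then c else 0 := by
  split_ifs with h
  · obtain ⟨rfl, rfl⟩ := h
    rw [Finset.sum_eq_single y.idx]
    · simp
    · rintro idx - h
      refine if_neg fun h' => h ?_
      cases y
      simpa using h'
    · simp
  · refine Finset.sum_eq_zero fun idx _ => if_neg ?_
    rintro rfl
    exact h ⟨rfl, rfl⟩

/-- The links along a chain: the endpoints on track `i` are the positions `q i` and `p (i + 1)`,
which carry the same variable. -/
structure ChainLinks (S : Skeleton) (n : ℕ) where
  p : Fin (n + 1) → Position S
  q : Fin (n + 1) → Position S
  ne : ∀ i, q i ≠ p (i + 1)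
  opposing : ∀ i, (p i).Opposing (q i)
  var_eq : ∀ i, (q i).var = (p (i + 1)).var

namespace ChainLinks

variable (L : ChainLinks S n)

open Classical in
/-- The mark of a block. The endpoint `q 0` on track `0` is special. -/
noncomputable def mark (x : Position S) (i : Fin (n + 1)) : Option Bool :=
  if x = L.q i then some (decide (i = 0)) else if x = L.p (i + 1) then some false else none

open Classical in
theorem mark_isSome (x : Position S) (i : Fin (n + 1)) :
    (if (L.mark x i).isSome then 1 else 0) =
      (if x = L.q i then 1 else 0) + if x = L.p (i + 1) then 1 else 0 := by
  have := L.ne i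
  by_cases h1 : x = L.q i
  · subst h1; simp [mark, this]
  · by_cases h2 : x = L.p (i + 1)
    · subst h2; simp [mark, this.symm]
    · simp [mark, h1, h2]

theorem mark_eq_some_true {x : Position S} {i : Fin (n + 1)} :
    L.mark x i = some true ↔ x = L.q 0 ∧ i = 0 := by
  unfold mark
  split_ifs with h1 h2
  · subst h1
    constructor
    · intro h
      obtain rfl : i = 0 := by simpa using h
      exact ⟨rfl, rfl⟩
    · rintro ⟨-, rfl⟩; simp
  · simp only [Option.some.injEq, Bool.false_eq_true, false_iff]
    rintro ⟨rfl, rfl⟩; exact h1 rfl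
  · simp only [false_iff]
    rintro ⟨rfl, rfl⟩; exact h1 rfl

/-- Both sides of a constraint have the same number of endpoints: `p i` is on one side if and only
if `q i` is on the other one. -/
theorem countP_mark (j : Fin S.length) :
    (sideList j false L.mark).countP Option.isSome =
      (sideList j true L.mark).countP Option.isSome := by
  classical
  have h1 : ∀ l : List (Option Bool), l.countP Option.isSome =
      (l.map fun m => if m.isSome then 1 else 0).sum := fun l => by
    induction l with
    | nil => rfl
    | cons m l ih => cases m <;> simp [ih, add_comm]
  have h2 : ∀ b, (sideList j b L.mark).countP Option.isSome =
      (∑ i, if j = (L.p i).con ∧ (!b) = (L.p i).right then 1 else 0) +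
        ∑ i, if j = (L.p i).con ∧ b = (L.p i).right then 1 else 0 := fun b => by
    rw [h1, map_sideList, sum_sideList, Finset.sum_comm]
    simp only [L.mark_isSome, Finset.sum_add_distrib, sum_idx_ite]
    congr 1
    · refine Finset.sum_congr rfl fun i _ => ?_
      obtain ⟨h3, h4⟩ := L.opposing i
      have h5 : b = (L.q i).right ↔ (!b) = (L.p i).right := by
        revert h4
        cases b <;> cases (L.q i).right <;> cases (L.p i).right <;> simp
      simp only [h3, h5]
    · exact Equiv.sum_comp (Equiv.addRight (1 : Fin (n + 1)))
        fun i => if j = (L.p i).con ∧ b = (L.p i).right then 1 else 0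
  rw [h2, h2, add_comm]
  rfl

variable {A : Type}

/-- If all links hold for some choice of tracks that agree at positions with the same variable,
then the special track is related to itself: every track `i` contributes its two endpoints, which
are equal, to the parity count, whereas the special endpoint counts once more. -/
theorem self_related {G : List A → List A → Prop} (s : Fin S.length → List LinkOp)
    (hleft : ∀ j, (s j).flatMap LinkOp.left = sideList j false L.mark)
    (hright : ∀ j, (s j).flatMap LinkOp.right = sideList j true L.mark)
    (X : ℕ → Fin (n + 1) → List A)
    (h : ∀ j, Linked G (s j) (sideList j false fun x i => X x.var i)
      (sideList j true fun x i => X x.var i)) :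
    G (X (L.q 0).var 0) (X (L.q 0).var 0) := by
  classical
  by_contra hG
  set w := X (L.q 0).var 0 with hw
  have hmark : ∀ j b, ∀ c ∈ sideList j b fun x i => (L.mark x i, X x.var i),
      c.1 = some true → c.2 = w := by
    rintro j b _ hc h1
    obtain ⟨x, i, rfl⟩ := mem_sideList hc
    obtain ⟨rfl, rfl⟩ := L.mark_eq_some_true.1 h1
    rfl
  have heven : ∀ j, Even (∑ b, ∑ idx, ∑ i,
      linkCount w (L.mark ⟨j, b, idx⟩ i, X (Position.var (S := S) ⟨j, b, idx⟩) i)) := by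
    intro j
    have := even_linkCount hG (s := s j)
      (l := sideList j false fun x i => (L.mark x i, X x.var i))
      (r := sideList j true fun x i => (L.mark x i, X x.var i))
      (by simpa only [map_sideList] using h j) (by rw [map_sideList, hleft])
      (by rw [map_sideList, hright]) (hmark _ _) (hmark _ _)
    rw [map_sideList, map_sideList, sum_sideList, sum_sideList, add_comm] at this
    rwa [Fintype.sum_bool]
  have hcount : ∀ (x : Position S) (i : Fin (n + 1)), linkCount w (L.mark x i, X x.var i) =
      ((if x = L.q i then (if X (L.q i).var i = w then 1 else 0) else 0) +
        if x = L.p (i + 1) then (if X (L.q i).var i = w then 1 else 0) else 0) +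
          if x = L.q 0 then (if i = 0 then 1 else 0) else 0 := by
    intro x i
    have h1 : (if (L.mark x i).isSome ∧ X x.var i = w then 1 else 0) =
        (if x = L.q i then (if X (L.q i).var i = w then 1 else 0) else 0) +
          if x = L.p (i + 1) then (if X (L.q i).var i = w then 1 else 0) else 0 := by
      have h2 := L.ne i
      by_cases h3 : x = L.q i
      · subst h3; simp [mark, h2]
      · by_cases h4 : x = L.p (i + 1)
        · subst h4; simp [mark, h2.symm, L.var_eq i]
        · simp [mark, h3, h4]
    simp only [linkCount, L.mark_eq_some_true, h1, ite_and]
  have hsum : ∀ (y : Position S) (c : ℕ),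
      (∑ j, ∑ b, ∑ idx, if (⟨j, b, idx⟩ : Position S) = y then c else 0) = c := by
    intro y c
    simp only [sum_idx_ite, ite_and]
    simp
  have htotal : Even (∑ j, ∑ b, ∑ idx, ∑ i,
      linkCount w (L.mark ⟨j, b, idx⟩ i, X (Position.var (S := S) ⟨j, b, idx⟩) i)) :=
    Finset.sum_induction _ Even (fun _ _ => Even.add) Even.zero fun j _ => heven j
  have hodd : (∑ j, ∑ b, ∑ idx, ∑ i,
      linkCount w (L.mark ⟨j, b, idx⟩ i, X (Position.var (S := S) ⟨j, b, idx⟩) i)) =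
        ∑ i, (((if X (L.q i).var i = w then 1 else 0) + if X (L.q i).var i = w then 1 else 0) +
          if i = 0 then 1 else 0) := by
    have h1 : ∀ F : Position S → Fin (n + 1) → ℕ, (∑ j, ∑ b, ∑ idx, ∑ i, F ⟨j, b, idx⟩ i) =
        ∑ i, ∑ j, ∑ b, ∑ idx, F ⟨j, b, idx⟩ i := by
      intro F
      refine (Finset.sum_congr rfl fun j _ => ?_).trans Finset.sum_comm
      exact (Finset.sum_congr rfl fun b _ => Finset.sum_comm).trans Finset.sum_comm
    rw [h1 fun x i => linkCount w (L.mark x i, X x.var i)]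
    refine Finset.sum_congr rfl fun i _ => ?_
    simp only [hcount, Finset.sum_add_distrib, hsum]
  rw [hodd, Finset.sum_add_distrib, Finset.sum_add_distrib, Finset.sum_ite_eq' Finset.univ
    (0 : Fin (n + 1))] at htotal
  simp [Nat.even_add_one] at htotal

end ChainLinks

end Gadget

/-! ### Automata for prefixes -/

section Prefix

variable {k : ℕ}

/-- An automaton for the words with prefix `u`. -/
def prefixFA (u : Word k) : FA k where
  trans := ((List.range u.length).map fun i => (i, u[i]?, i + 1)) ++
    (List.finRange k).map fun a => (u.length, some a, u.length)
  init := [0]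
  final := [u.length]

theorem mem_prefixFA_trans {u : Word k} {i j : ℕ} {a : Option (Fin k)} :
    (i, a, j) ∈ (prefixFA u).trans ↔ (i < u.length ∧ a = u[i]? ∧ j = i + 1) ∨
      (i = u.length ∧ (∃ b, a = some b) ∧ j = u.length) := by
  simp only [prefixFA, List.mem_append, List.mem_map, List.mem_range, List.mem_finRange, true_and,
    Prod.mk.injEq]
  constructor
  · rintro (⟨i, h, rfl, rfl, rfl⟩ | ⟨b, rfl, rfl, rfl⟩)
    · exact .inl ⟨h, rfl, rfl⟩
    · exact .inr ⟨rfl, ⟨b, rfl⟩, rfl⟩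
  · rintro (⟨h, rfl, rfl⟩ | ⟨rfl, ⟨b, rfl⟩, rfl⟩)
    · exact .inl ⟨i, h, rfl, rfl, rfl⟩
    · exact .inr ⟨b, rfl, rfl, rfl⟩

theorem mem_prefixFA_language {u v : Word k} : v ∈ (prefixFA u).language ↔ u <+: v := by
  have hacc : ∀ l, (prefixFA u).Accepts l ↔
      Path (fun q a q' => (q, a, q') ∈ (prefixFA u).trans) 0 l u.length := fun l => by
    rw [← Automaton.run_iff_path]
    simp [Automaton.Accepts, prefixFA]
  simp only [FA.language, Set.mem_ofPred_eq, hacc]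
  constructor
  · have key : ∀ l i, i ≤ u.length →
        Path (fun q a q' => (q, a, q') ∈ (prefixFA u).trans) i l u.length →
          u.drop i <+: l.reduceOption := by
      intro l
      induction l with
      | nil =>
        rintro i - h
        obtain rfl : i = u.length := h
        simp
      | cons a l ih =>
        rintro i - ⟨j, h1, h2⟩
        obtain ⟨h, rfl, rfl⟩ | ⟨rfl, -, -⟩ := mem_prefixFA_trans.1 h1
        · rw [List.drop_eq_getElem_cons h, List.getElem?_eq_getElem h,
            List.reduceOption_cons_of_some]
          exact List.cons_prefix_cons.2 ⟨rfl, ih _ h h2⟩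
        · simp
    rintro ⟨l, h, rfl⟩
    exact key l 0 (Nat.zero_le _) h
  · rintro ⟨r, rfl⟩
    have h1 : ∀ d i, i ≤ u.length → u.drop i = d →
        Path (fun q a q' => (q, a, q') ∈ (prefixFA u).trans) i (d.map some) u.length := by
      intro d
      induction d with
      | nil => exact fun i h1 h2 => le_antisymm h1 (List.drop_eq_nil_iff.1 h2)
      | cons a d ih =>
        intro i h1 h2
        have h3 : i < u.length := by
          by_contra h
          rw [List.drop_eq_nil_of_le (not_lt.1 h)] at h2
          simp at h2
        rw [List.drop_eq_getElem_cons h3, List.cons.injEq] at h2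
        refine ⟨i + 1, mem_prefixFA_trans.2 (.inl ⟨h3, ?_, rfl⟩), ih _ h3 h2.2⟩
        rw [List.getElem?_eq_getElem h3, h2.1]
    have h2 : Path (fun q a q' => (q, a, q') ∈ (prefixFA u).trans) u.length (r.map some)
        u.length := by
      induction r with
      | nil => rfl
      | cons a r ih => exact ⟨_, mem_prefixFA_trans.2 (.inr ⟨rfl, ⟨a, rfl⟩, rfl⟩), ih⟩
    have h3 : ∀ v : Word k, (v.map some).reduceOption = v := fun v => by
      induction v <;> simp_all
    exact ⟨_, (h1 u 0 (Nat.zero_le _) (by simp)).append h2, by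
      rw [List.reduceOption_append, h3, h3]⟩

theorem prefixFA_primrec : Primrec (prefixFA : Word k → FA k) := by
  have h1 : Primrec fun u : Word k => (List.range u.length).map fun i => (i, u[i]?, i + 1) :=
    Primrec.list_map (Primrec.list_range.comp Primrec.list_length)
      (Primrec.snd.pair ((Primrec.list_getElem?.comp Primrec.fst Primrec.snd).pair
        (Primrec.succ.comp Primrec.snd)))
  have h2 : Primrec fun u : Word k =>
      (List.finRange k).map fun a => (u.length, some a, u.length) :=
    Primrec.list_map (Primrec.const _) ((Primrec.list_length.comp Primrec.fst).pair
      ((Primrec.option_some.comp Primrec.snd).pair (Primrec.list_length.comp Primrec.fst)))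
  exact automaton_mk_primrec.comp ((Primrec.list_append.comp h1 h2).pair
    ((Primrec.const [0]).pair (Primrec.list_cons.comp Primrec.list_length (Primrec.const []))))

end Prefix

/-! ### Chaining skeletons are undecidable -/

section Gadget

variable {S : Skeleton} {n k : ℕ}

theorem Skeleton.HasChain.exists_chainLinks (hS : S.HasChain) :
    ∃ n, Nonempty (ChainLinks S n) := by
  obtain ⟨n, p, hp⟩ := hS
  choose q h1 h2 h3 using hp
  exact ⟨n, ⟨⟨p, q, h1, h2, h3⟩⟩⟩

/-- The value of a side of a constraint when every variable consists of `n + 1` tracks. -/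
theorem termValue_side {A : Type} {z o : Fin k} {e : A → ℕ} {η : Interpretation k}
    {X : ℕ → Fin (n + 1) → List A} {j : Fin S.length} {b : Bool}
    (h : ∀ v ∈ S.side j b, η v = blockWord z o e ((List.finRange (n + 1)).map (X v))) :
    termValue η (S.side j b) = blockWord z o e (sideList j b fun x i => X x.var i) := by
  have h1 : termValue η (S.side j b) =
      (S.side j b).flatMap fun v => blockWord z o e ((List.finRange (n + 1)).map (X v)) := by
    simp only [termValue, List.flatMap]
    rw [List.map_congr_left h]
  rw [h1, blockWord_flatMap, flatMap_side]
  rfl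

/-- Along a chain, a rational correspondence problem can be expressed by relational constraints
with the given skeleton and memberships, up to a condition on a prefix of the value of one
variable. -/
theorem ChainLinks.exists_constraints (L : ChainLinks S n) {z o : Fin k} (hzo : z ≠ o) {A : Type}
    [Finite A] {G : List A → List A → Prop} (hG : Rational G) {e : A → ℕ}
    (he : Function.Injective e) :
    ∃ (rels : List (Term × Transducer k × Term)) (mems : List (Bool × Term × FA k)) (v₀ : ℕ),
      (rels.map fun c => (c.1, c.2.2)) = S ∧ ∀ w : List A,
        (∃ η : Interpretation k,
          (∀ c ∈ rels, (termValue η c.1, termValue η c.2.2) ∈ c.2.1.relation) ∧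
          (∀ c ∈ mems, (c.1 = true ↔ termValue η c.2.1 ∈ c.2.2.language)) ∧
          (w.map some).flatMap (letterCode z o e) <+: η v₀) ↔ ∃ x, G x x ∧ w <+: x := by
  choose s hleft hright using fun j => exists_linkOps _ _ (L.countP_mark j)
  choose T hT using fun j => ((hG.linked (s j)).image (letterCode z o e)
    (letterCode z o e)).exists_transducer
  obtain ⟨M, hM⟩ := ((Rational.enc_of_length (B := A) (n + 1)).image (letterCode z o e)
    (letterCode z o e)).exists_fa
  have hM' : ∀ u, u ∈ M.language ↔ ∃ xs : List (List A), xs.length = n + 1 ∧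
      u = blockWord z o e xs := fun u => by
    rw [hM]
    constructor
    · rintro ⟨_, _, _, ⟨rfl, xs, h, rfl⟩, rfl, rfl⟩; exact ⟨xs, h, rfl⟩
    · rintro ⟨xs, h, rfl⟩; exact ⟨_, _, _, ⟨rfl, xs, h, rfl⟩, rfl, rfl⟩
  let vars : List ℕ := S.flatMap fun c => c.1 ++ c.2
  have hvars : ∀ j b, ∀ v ∈ S.side j b, v ∈ vars := by
    intro j b v hv
    refine List.mem_flatMap.2 ⟨S.get j, List.get_mem _ _, List.mem_append.2 ?_⟩
    cases b
    · exact .inl hv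
    · exact .inr hv
  refine ⟨List.ofFn fun j => (S.side j false, T j, S.side j true),
    vars.map fun v => (true, [v], M), (L.q 0).var, ?_, fun w => ?_⟩
  · rw [List.map_ofFn]
    exact List.ofFn_get S
  · constructor
    · rintro ⟨η, hrels, hmems, hpre⟩
      have h1 : ∀ v, ∃ X : Fin (n + 1) → List A, v ∈ vars →
          η v = blockWord z o e ((List.finRange (n + 1)).map X) := by
        intro v
        by_cases hv : v ∈ vars
        · obtain ⟨xs, h, h'⟩ := (hM' _).1
            ((hmems (true, [v], M) (List.mem_map.2 ⟨v, hv, rfl⟩)).1 rfl)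
          refine ⟨fun i => xs.get (i.cast h.symm), fun _ => ?_⟩
          have h2 : (List.finRange (n + 1)).map (fun i => xs.get (i.cast h.symm)) = xs := by
            refine List.ext_getElem (by simp [h]) fun i hi hi' => by simp
          rw [h2]
          simpa [termValue] using h'
        · exact ⟨fun _ => [], fun h => (hv h).elim⟩
      choose X hX using h1
      refine ⟨_, L.self_related (G := G) s hleft hright X fun j => ?_, ?_⟩
      · have h2 := hrels (S.side j false, T j, S.side j true) (List.mem_ofFn.2 ⟨j, rfl⟩)
        rw [hT] at h2
        obtain ⟨_, _, ⟨xs, ys, h3, rfl, rfl⟩, h4, h5⟩ := h2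
        rw [termValue_side fun v hv => hX v (hvars _ _ v hv)] at h4 h5
        obtain rfl := blockWord_injective hzo he h4
        obtain rfl := blockWord_injective hzo he h5
        exact h3
      · rw [hX (L.q 0).var (hvars _ _ _ (List.get_mem (S.side _ (L.q 0).right) _)), List.finRange_succ, List.map_cons] at hpre
        exact (prefix_of_prefix_blockWord hzo he).1 hpre
    · rintro ⟨x, hx, hw⟩
      let η : Interpretation k := fun _ => blockWord z o e ((List.finRange (n + 1)).map fun _ => x)
      have h1 : ∀ j b, termValue η (S.side j b) =
          blockWord z o e (List.replicate (sideList j b L.mark).length x) := by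
        intro j b
        rw [termValue_side (X := fun _ _ => x) fun v _ => rfl]
        congr 1
        refine List.eq_replicate_iff.2 ⟨length_sideList _ _ _ _, fun y hy => ?_⟩
        obtain ⟨_, _, h⟩ := mem_sideList hy
        exact h.symm
      refine ⟨η, ?_, ?_, ?_⟩
      · intro c hc
        obtain ⟨j, rfl⟩ := List.mem_ofFn.1 hc
        rw [hT]
        refine ⟨_, _, ⟨_, _, linked_replicate hx (s j), rfl, rfl⟩, ?_, ?_⟩
        · rw [hleft]; exact h1 j false
        · rw [hright]; exact h1 j true
      · intro c hc
        obtain ⟨v, -, rfl⟩ := List.mem_map.1 hc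
        refine iff_of_true rfl ((hM' _).2 ⟨_, ?_, by simp [termValue, η]; rfl⟩)
        simp
      · simp only [η, List.finRange_succ, List.map_cons]
        exact (prefix_of_prefix_blockWord hzo he).2 hw

/-- Satisfiability is undecidable on the formulae with a given chaining skeleton. -/
theorem not_satDecidable_of_chaining (hk : 2 ≤ k) {Φ : ConjFormula k} (hΦ : Φ.Chaining) :
    ¬ SatDecidable Φ.skeletonClass := by
  rintro ⟨p, hp, hpC⟩
  obtain ⟨n, ⟨L⟩⟩ := hΦ.exists_chainLinks
  obtain ⟨A, _, G, e, w, hG, he, hw, hund⟩ := exists_rational_undecidable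
  have hzo : (⟨0, by omega⟩ : Fin k) ≠ ⟨1, by omega⟩ := by simp
  obtain ⟨rels, mems, v₀, hrels, hsat⟩ := L.exists_constraints hzo hG he
  set z : Fin k := ⟨0, by omega⟩
  set o : Fin k := ⟨1, by omega⟩
  let Ψ : List ℕ → ConjFormula k := fun l => ⟨rels,
    mems ++ [(true, [v₀], prefixFA (l.flatMap fun m => ((List.range (m + 1)).map fun _ => o) ++
      [z]))], []⟩
  have hΨ : Primrec Ψ := by
    have h1 : Primrec fun l : List ℕ => l.flatMap fun m =>
        ((List.range (m + 1)).map fun _ => o) ++ [z] :=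
      Primrec.list_flatMap Primrec.id (Primrec.list_append.comp
        (Primrec.list_map (Primrec.list_range.comp (Primrec.succ.comp Primrec.snd))
          (Primrec.const o)) (Primrec.const [z]))
    exact formula_mk_primrec.comp ((Primrec.const rels).pair ((Primrec.list_append.comp
      (Primrec.const mems) (Primrec.list_cons.comp ((Primrec.const true).pair
        ((Primrec.const [v₀]).pair (prefixFA_primrec.comp h1))) (Primrec.const []))).pair
          (Primrec.const [])))
  refine hund (ComputablePred.computable_of_manyOneReducible
    ⟨_, hΨ.to_comp.comp hw, fun m => ?_⟩ hp)
  rw [hpC _ (show Ψ ((w m).map e) ∈ Φ.skeletonClass from hrels)]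
  refine (hsat (w m)).symm.trans ?_
  have hcode : (((w m).map e).flatMap fun m => ((List.range (m + 1)).map fun _ => o) ++ [z]) =
      ((w m).map some).flatMap (letterCode z o e) := by
    simp only [List.flatMap_map]
    congr 1
    ext1 a
    simp [letterCode, List.map_const']
  refine exists_congr fun η => ?_
  simp only [ConjFormula.Models, Ψ, hcode, List.forall_mem_append, List.forall_mem_singleton,
    mem_prefixFA_language, true_iff, List.not_mem_nil, false_imp_iff, implies_true, and_true,
    termValue, List.flatMap_singleton]

end Gadget

end StringConstraints

theorem mainTheorem4 (k : ℕ) (Φ : StringConstraints.ConjFormula k) :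
    (2 ≤ k → Φ.Chaining → ¬ StringConstraints.SatDecidable Φ.skeletonClass) ∧
    (Φ.ChainFree → StringConstraints.SatDecidable Φ.skeletonClass) :=
  ⟨fun hk hΦ => StringConstraints.not_satDecidable_of_chaining hk hΦ,
    StringConstraints.satDecidable_of_chainFree⟩
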